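/- Let $k$ be an algebraically closed field of characteristic $p>2$, let $n\ge 1$, and let $\mathfrak g=\tilde{\mathfrak p}(n)\subset\mathfrak{gl}(n|n)$ be the periplectic Lie superalgebra of all matrices $\begin{pmatrix}A&B\\ C&-A^{t}\end{pmatrix}$ with $B=B^{t}$ and $C=-C^{t}$. Its even part $\mathfrak g_{\bar 0}$ ($B=C=0$) is isomorphic to $\mathfrak{gl}(n)$ via $A\mapsto \mathrm{diag}(A,-A^{t})$, with $p$-map $x^{[p]}$ the $p$-th power of matrices. Let $\mathfrak h$, $\mathfrak n_{\bar 0}^{+}$, $\mathfrak n_{\bar 0}^{-}\subset\mathfrak g_{\bar 0}$ correspond to the diagonal, strictly upper triangular and strictly lower triangular $A$, let $H_i=E_{i,i}-E_{n+i,n+i}$, let $\mathfrak g_1$ be the odd subspace $A=C=0$, and put $\mathcal B=\mathfrak h\oplus\mathfrak n_{\bar 0}^{+}\oplus\mathfrak g_1$. For $\chi\in\mathfrak g_{\bar 0}^*$ and a restricted subalgebra $\mathfrak a\subseteq\mathfrak g$, let $U_\chi(\mathfrak a)$ be the quotient of the enveloping superalgebra $U(\mathfrak a)$ by the two-sided ideal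 generated by all $x^p-x^{[p]}-\chi(x)^p$, $x\in\mathfrak a_{\bar 0}$. Let $\Lambda(\chi)=\{\lambda\in\mathfrak h^*\mid \lambda(H)^p-\lambda(H^{[p]})=\chi(H)^p\ \ \forall H\in\mathfrak h\}$. If $\chi(\mathfrak n_{\bar 0}^+)=0$ and $\lambda\in\Lambda(\chi)$, let $k_\lambda$ be the one-dimensional even $U_\chi(\mathcal B)$-module on which $\mathfrak h$ acts by $\lambda$ and $\mathfrak n_{\bar 0}^+\oplus\mathfrak g_1$ acts by zero, and let $Z_\chi(\lambda)=U_\chi(\mathfrak g)\otimes_{U_\chi(\mathcal B)}k_\lambda$ be the generalized baby Verma module. Modules are $\mathbb Z/2$-graded, and irreducible means nonzero without graded submodules other than $0$ and the whole module. Call $\chi$ regular semisimple if there is $g\in\mathrm{GL}(n)$ such that $\mathrm{Ad}(g)\chi$ vanishes on $\mathfrak n_{\bar 0}^{+}$ and $\mathfrak n_{\bar 0}^{-}$ and $(\mathrm{Ad}(g)\chi)(H_i-H_j)\neq 0$ for all $1\le i<j\le n$; here $g$ acts on $\mathfrak g_{\bar 0}$ by conjugation with $\mathrm{diag}(g,g^{-t})$,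 and on $\mathfrak g_{\bar 0}^*$ by the coadjoint action. Let $\chi\in\mathfrak g_{\bar 0}^*$ with $\chi(\mathfrak n_{\bar 0}^{+})=0$. Then the following hold. (1) Every irreducible $U_\chi(\mathfrak g)$-module is a quotient of $Z_\chi(\lambda)$ for some $\lambda\in\Lambda(\chi)$, through a $U_\chi(\mathfrak g)$-linear surjection that either preserves or reverses parity. (2) If $\chi$ is regular semisimple, then $Z_\chi(\lambda)$ is an irreducible $U_\chi(\mathfrak g)$-module for every $\lambda\in\Lambda(\chi)$. -/

import Mathlib

open scoped TensorProduct DirectSum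

universe u v

noncomputable section

/-! ### The Lie superalgebra `gl(n|n)` and its restricted subalgebras -/

/-- Square matrices of size `2n`, written in four `n × n` blocks. -/
abbrev BlockMat (k : Type u) (n : ℕ) : Type u := Matrix (Fin n ⊕ Fin n) (Fin n ⊕ Fin n) k

/-- The sign `(-1)^{ij}` for parities `i`, `j`. -/
def superSign (k : Type u) [Field k] (i j : ZMod 2) : k :=
  if i = 1 ∧ j = 1 then -1 else 1

/-- The parity of a matrix index. -/
def idxParity {n : ℕ} : Fin n ⊕ Fin n → ZMod 2 := Sum.elim (fun _ => 0) (fun _ => 1)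

/-- The homogeneous components of `gl(n|n)`: block diagonal matrices are even, block off-diagonal
matrices are odd. -/
def glPart (k : Type u) [Field k] (n : ℕ) (i : ZMod 2) : Submodule k (BlockMat k n) where
  carrier := {X | ∀ a b, idxParity a + idxParity b ≠ i → X a b = 0}
  add_mem' := by
    intro X Y hX hY a b hab
    rw [Matrix.add_apply, hX a b hab, hY a b hab, add_zero]
  zero_mem' := fun _ _ _ => rfl
  smul_mem' := by
    intro c X hX a b hab
    rw [Matrix.smul_apply, hX a b hab, smul_zero]

/-- A restricted Lie sub-superalgebra of `gl(n|n)`: a graded subspace `part 0 ⊕ part 1` which is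
closed under the supercommutator, and whose even part is closed under the `p`-map of `gl(n|n)`,
which is the `p`-th power of matrices. -/
structure RestrictedSubalgebra (k : Type u) [Field k] (p n : ℕ) where
  part : ZMod 2 → Submodule k (BlockMat k n)
  part_le : ∀ i, part i ≤ glPart k n i
  bracket_mem : ∀ (i j : ZMod 2) (x y : BlockMat k n), x ∈ part i → y ∈ part j →
    x * y - superSign k i j • (y * x) ∈ part (i + j)
  pow_mem : ∀ x : BlockMat k n, x ∈ part 0 → x ^ p ∈ part 0

namespace RestrictedSubalgebra

variable {k : Type u} [Field k] {p n : ℕ}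

/-- The superbracket of homogeneous elements. -/
def bracket (L : RestrictedSubalgebra k p n) {i j : ZMod 2} (x : L.part i) (y : L.part j) :
    L.part (i + j) :=
  ⟨x.1 * y.1 - superSign k i j • (y.1 * x.1), L.bracket_mem i j _ _ x.2 y.2⟩

/-- The `p`-map `x ↦ x^{[p]}` on the even part. -/
def pmap (L : RestrictedSubalgebra k p n) (x : L.part 0) : L.part 0 :=
  ⟨x.1 ^ p, L.pow_mem _ x.2⟩

/-- The intersection with an associative subalgebra of the algebra of matrices. -/
def inf (L : RestrictedSubalgebra k p n) (A : Subalgebra k (BlockMat k n)) :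
    RestrictedSubalgebra k p n where
  part i := L.part i ⊓ Subalgebra.toSubmodule A
  part_le i := inf_le_left.trans (L.part_le i)
  bracket_mem i j x y hx hy :=
    ⟨L.bracket_mem i j x y hx.1 hy.1,
      A.sub_mem (A.mul_mem hx.2 hy.2) (A.smul_mem (A.mul_mem hy.2 hx.2) _)⟩
  pow_mem x hx := ⟨L.pow_mem x hx.1, A.pow_mem hx.2 p⟩

/-! ### Enveloping algebras -/

/-- A homogeneous element as an element of the tensor algebra of `L = part 0 ⊕ part 1`. -/
def tensorGen (L : RestrictedSubalgebra k p n) (i : ZMod 2) :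
    L.part i →ₗ[k] TensorAlgebra k (⨁ i, L.part i) :=
  (TensorAlgebra.ι k).comp (DirectSum.lof k (ZMod 2) (fun i => L.part i) i)

/-- The relations `x y - (-1)^{|x||y|} y x = [x, y]`, for homogeneous `x` and `y`. -/
inductive EnvRel (L : RestrictedSubalgebra k p n) :
    TensorAlgebra k (⨁ i, L.part i) → TensorAlgebra k (⨁ i, L.part i) → Prop
  | bracket {i j : ZMod 2} (x : L.part i) (y : L.part j) :
      EnvRel L
        (L.tensorGen i x * L.tensorGen j y - superSign k i j • (L.tensorGen j y * L.tensorGen i x))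
        (L.tensorGen (i + j) (L.bracket x y))

/-- The universal enveloping superalgebra `U(L)`. -/
def Env (L : RestrictedSubalgebra k p n) : Type u := RingQuot (EnvRel L)

instance (L : RestrictedSubalgebra k p n) : Ring (Env L) :=
  inferInstanceAs (Ring (RingQuot (EnvRel L)))

instance (L : RestrictedSubalgebra k p n) : Algebra k (Env L) :=
  inferInstanceAs (Algebra k (RingQuot (EnvRel L)))

/-- The canonical map from the homogeneous components of `L` to `U(L)`. -/
def envGen (L : RestrictedSubalgebra k p n) (i : ZMod 2) : L.part i →ₗ[k] Env L :=
  (RingQuot.mkAlgHom k (EnvRel L)).toLinearMap.comp (L.tensorGen i)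

/-- The relations `x^p - x^{[p]} = χ(x)^p`, for even `x`. -/
inductive RedRel (L : RestrictedSubalgebra k p n) (χ : Module.Dual k (L.part 0)) :
    Env L → Env L → Prop
  | pcenter (x : L.part 0) :
      RedRel L χ (L.envGen 0 x ^ p - L.envGen 0 (L.pmap x)) (algebraMap k (Env L) (χ x ^ p))

/-- The reduced enveloping superalgebra `U_χ(L)`, the quotient of `U(L)` by the two-sided ideal
generated by all `x^p - x^{[p]} - χ(x)^p` with `x` even. -/
def RedEnv (L : RestrictedSubalgebra k p n) (χ : Module.Dual k (L.part 0)) : Type u :=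
  RingQuot (RedRel L χ)

instance (L : RestrictedSubalgebra k p n) (χ : Module.Dual k (L.part 0)) : Ring (RedEnv L χ) :=
  inferInstanceAs (Ring (RingQuot (RedRel L χ)))

instance (L : RestrictedSubalgebra k p n) (χ : Module.Dual k (L.part 0)) :
    Algebra k (RedEnv L χ) :=
  inferInstanceAs (Algebra k (RingQuot (RedRel L χ)))

/-- The canonical map from the homogeneous components of `L` to `U_χ(L)`. -/
def redGen (L : RestrictedSubalgebra k p n) (χ : Module.Dual k (L.part 0)) (i : ZMod 2) :
    L.part i →ₗ[k] RedEnv L χ :=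
  (RingQuot.mkAlgHom k (RedRel L χ)).toLinearMap.comp (L.envGen i)

theorem redGen_bracket (L : RestrictedSubalgebra k p n) (χ : Module.Dual k (L.part 0))
    {i j : ZMod 2} (x : L.part i) (y : L.part j) :
    L.redGen χ i x * L.redGen χ j y - superSign k i j • (L.redGen χ j y * L.redGen χ i x) =
      L.redGen χ (i + j) (L.bracket x y) := by
  have h := congrArg (RingQuot.mkAlgHom k (RedRel L χ))
    (RingQuot.mkAlgHom_rel k (EnvRel.bracket x y))
  exact (by
    refine Eq.trans ?_ h
    refine Eq.trans ?_ (congrArg _ ((map_sub _ _ _).trans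
      (congrArg₂ _ (map_mul _ _ _) ((map_smul _ _ _).trans
        (congrArg _ (map_mul _ _ _))))).symm)
    exact ((map_sub (RingQuot.mkAlgHom k (RedRel L χ)) _ _).trans
      (congrArg₂ _ (map_mul _ _ _) ((map_smul _ _ _).trans
        (congrArg _ (map_mul _ _ _))))).symm)

theorem redGen_pcenter (L : RestrictedSubalgebra k p n) (χ : Module.Dual k (L.part 0))
    (x : L.part 0) :
    L.redGen χ 0 x ^ p - L.redGen χ 0 (L.pmap x) = algebraMap k (RedEnv L χ) (χ x ^ p) := by
  have h := RingQuot.mkAlgHom_rel k (RedRel.pcenter (χ := χ) x)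
  rw [AlgHom.commutes, map_sub, map_pow] at h
  exact h

/-- The universal property of `U(L)`. -/
def envLift (L : RestrictedSubalgebra k p n) {A : Type*} [Ring A] [Algebra k A]
    (f : ∀ i, L.part i →ₗ[k] A)
    (hf : ∀ (i j : ZMod 2) (x : L.part i) (y : L.part j),
      f i x * f j y - superSign k i j • (f j y * f i x) = f (i + j) (L.bracket x y)) :
    Env L →ₐ[k] A :=
  RingQuot.liftAlgHom k
    ⟨TensorAlgebra.lift k (DirectSum.toModule k (ZMod 2) A f), by
      have key : ∀ (i : ZMod 2) (x : L.part i),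
          TensorAlgebra.lift k (DirectSum.toModule k (ZMod 2) A f) (L.tensorGen i x) = f i x := by
        intro i x
        refine (TensorAlgebra.lift_ι_apply _ _).trans ?_
        exact DirectSum.toModule_lof (M := fun i => L.part i) (φ := f) k i x
      rintro _ _ ⟨x, y⟩
      rw [map_sub, map_smul, map_mul, map_mul, key, key, key, hf]⟩

theorem envLift_envGen (L : RestrictedSubalgebra k p n) {A : Type*} [Ring A] [Algebra k A]
    (f : ∀ i, L.part i →ₗ[k] A)
    (hf : ∀ (i j : ZMod 2) (x : L.part i) (y : L.part j),
      f i x * f j y - superSign k i j • (f j y * f i x) = f (i + j) (L.bracket x y))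
    (i : ZMod 2) (x : L.part i) : L.envLift f hf (L.envGen i x) = f i x :=
  (RingQuot.liftAlgHom_mkAlgHom_apply _ _ _ _).trans
    ((TensorAlgebra.lift_ι_apply _ _).trans (DirectSum.toModule_lof (M := fun i => L.part i) (φ := f) k i x))

/-- The universal property of `U_χ(L)`. -/
def redLift (L : RestrictedSubalgebra k p n) (χ : Module.Dual k (L.part 0))
    {A : Type*} [Ring A] [Algebra k A] (f : ∀ i, L.part i →ₗ[k] A)
    (hf : ∀ (i j : ZMod 2) (x : L.part i) (y : L.part j),
      f i x * f j y - superSign k i j • (f j y * f i x) = f (i + j) (L.bracket x y))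
    (hp : ∀ x : L.part 0, f 0 x ^ p - f 0 (L.pmap x) = algebraMap k A (χ x ^ p)) :
    RedEnv L χ →ₐ[k] A :=
  RingQuot.liftAlgHom k
    ⟨L.envLift f hf, by
      rintro _ _ ⟨x⟩
      rw [AlgHom.commutes, map_sub, map_pow, envLift_envGen, envLift_envGen, hp]⟩

theorem redLift_redGen (L : RestrictedSubalgebra k p n) (χ : Module.Dual k (L.part 0))
    {A : Type*} [Ring A] [Algebra k A] (f : ∀ i, L.part i →ₗ[k] A)
    (hf : ∀ (i j : ZMod 2) (x : L.part i) (y : L.part j),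
      f i x * f j y - superSign k i j • (f j y * f i x) = f (i + j) (L.bracket x y))
    (hp : ∀ x : L.part 0, f 0 x ^ p - f 0 (L.pmap x) = algebraMap k A (χ x ^ p))
    (i : ZMod 2) (x : L.part i) : L.redLift χ f hf hp (L.redGen χ i x) = f i x :=
  (RingQuot.liftAlgHom_mkAlgHom_apply _ _ _ _).trans (L.envLift_envGen f hf i x)

/-- The restriction of a linear form on the even part of `L` to the even part of a subalgebra. -/
def restrict {K L : RestrictedSubalgebra k p n} (h : ∀ i, K.part i ≤ L.part i)
    (χ : Module.Dual k (L.part 0)) : Module.Dual k (K.part 0) :=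
  χ.comp (Submodule.inclusion (h 0))

/-- The canonical algebra homomorphism `U_χ(K) → U_χ(L)` for a subalgebra `K` of `L`. -/
def redMap {K L : RestrictedSubalgebra k p n} (h : ∀ i, K.part i ≤ L.part i)
    (χ : Module.Dual k (L.part 0)) : RedEnv K (restrict h χ) →ₐ[k] RedEnv L χ :=
  redLift K (restrict h χ) (fun i => (L.redGen χ i).comp (Submodule.inclusion (h i)))
    (fun _ _ x y => redGen_bracket L χ (Submodule.inclusion (h _) x) (Submodule.inclusion (h _) y))
    (fun x => redGen_pcenter L χ (Submodule.inclusion (h 0) x))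

/-- The `ℤ/2`-grading of `U_χ(L)`: the component of parity `i` is spanned by the products of
homogeneous elements of `L` whose parities add up to `i`. -/
def redPart (L : RestrictedSubalgebra k p n) (χ : Module.Dual k (L.part 0)) (i : ZMod 2) :
    Submodule k (RedEnv L χ) :=
  Submodule.span k {w | ∃ l : List (Σ j : ZMod 2, L.part j),
    (l.map Sigma.fst).sum = i ∧ w = (l.map fun x => L.redGen χ x.1 x.2).prod}

/-! ### Supermodules -/

/-- `M = ℳ 0 ⊕ ℳ 1` is a supermodule over the superalgebra `U_χ(L)`. -/
structure IsSupermodule (L : RestrictedSubalgebra k p n) (χ : Module.Dual k (L.part 0))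
    {M : Type v} [AddCommGroup M] [Module k M] [Module (RedEnv L χ) M]
    (ℳ : ZMod 2 → Submodule k M) : Prop where
  isInternal : DirectSum.IsInternal ℳ
  smul_mem : ∀ (i j : ZMod 2) (w : RedEnv L χ) (m : M), w ∈ redPart L χ i → m ∈ ℳ j →
    w • m ∈ ℳ (i + j)

/-- A submodule is a sub-supermodule if it is spanned by its homogeneous elements. -/
def IsSubsupermodule {L : RestrictedSubalgebra k p n} {χ : Module.Dual k (L.part 0)}
    {M : Type v} [AddCommGroup M] [Module k M] [Module (RedEnv L χ) M]
    (ℳ : ZMod 2 → Submodule k M) (W : Submodule (RedEnv L χ) M) : Prop :=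
  ∀ w ∈ W, ∃ w₀ ∈ W, ∃ w₁ ∈ W, w₀ ∈ ℳ 0 ∧ w₁ ∈ ℳ 1 ∧ w = w₀ + w₁

/-- `M = ℳ 0 ⊕ ℳ 1` is an irreducible supermodule over `U_χ(L)`. -/
structure IsIrreducible (L : RestrictedSubalgebra k p n) (χ : Module.Dual k (L.part 0))
    {M : Type v} [AddCommGroup M] [Module k M] [Module (RedEnv L χ) M]
    (ℳ : ZMod 2 → Submodule k M) : Prop extends IsSupermodule L χ ℳ where
  nontrivial : Nontrivial M
  eq_bot_or_eq_top : ∀ W : Submodule (RedEnv L χ) M, IsSubsupermodule ℳ W → W = ⊥ ∨ W = ⊤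

end RestrictedSubalgebra

/-! ### Tensor products over a noncommutative algebra -/

/-- The submodule of `R ⊗_k V` generated by all `r φ(s) ⊗ v - r ⊗ s v`. -/
def inducedRel {k : Type u} [Field k] {S R : Type u} [Ring S] [Algebra k S] [Ring R] [Algebra k R]
    (φ : S →ₐ[k] R) (V : Type u) [AddCommGroup V] [Module k V] [Module S V] :
    Submodule R (R ⊗[k] V) :=
  Submodule.span R {t | ∃ (r : R) (s : S) (v : V), t = (r * φ s) ⊗ₜ[k] v - r ⊗ₜ[k] (s • v)}

/-- The induced module `R ⊗_S V`, where `R` is a right `S`-module through `φ : S → R`. -/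
abbrev InducedModule {k : Type u} [Field k] {S R : Type u} [Ring S] [Algebra k S] [Ring R]
    [Algebra k R] (φ : S →ₐ[k] R) (V : Type u) [AddCommGroup V] [Module k V] [Module S V] :
    Type u :=
  (R ⊗[k] V) ⧸ inducedRel φ V

/-! ### The periplectic Lie superalgebra -/

namespace Periplectic

open RestrictedSubalgebra

variable (k : Type u) [Field k] (p n : ℕ)

/-- The matrices with blocks `A`, `B`, `C`, `-Aᵀ` where `B = Bᵀ` and `C = -Cᵀ`. -/
def periplecticCarrier : Submodule k (BlockMat k n) where
  carrier := {X | X.toBlocks₂₂ = -X.toBlocks₁₁.transpose ∧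
    X.toBlocks₁₂ = X.toBlocks₁₂.transpose ∧ X.toBlocks₂₁ = -X.toBlocks₂₁.transpose}
  add_mem' := by
    rintro X Y ⟨h1, h2, h3⟩ ⟨h4, h5, h6⟩
    simp only [Set.mem_ofPred_eq, ← Matrix.ext_iff, Matrix.toBlocks₁₂, Matrix.toBlocks₂₁,
      Matrix.toBlocks₁₁, Matrix.toBlocks₂₂, Matrix.of_apply, Matrix.transpose_apply,
      Matrix.neg_apply, Matrix.add_apply] at *
    refine ⟨fun i j => ?_, fun i j => ?_, fun i j => ?_⟩
    · rw [h1 i j, h4 i j]; ring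
    · rw [h2 i j, h5 i j]
    · rw [h3 i j, h6 i j]; ring
  zero_mem' := by
    simp only [Set.mem_ofPred_eq, ← Matrix.ext_iff, Matrix.toBlocks₁₂, Matrix.toBlocks₂₁,
      Matrix.toBlocks₁₁, Matrix.toBlocks₂₂, Matrix.of_apply, Matrix.transpose_apply,
      Matrix.neg_apply, Matrix.zero_apply]
    simp
  smul_mem' := by
    rintro c X ⟨h1, h2, h3⟩
    simp only [Set.mem_ofPred_eq, ← Matrix.ext_iff, Matrix.toBlocks₁₂, Matrix.toBlocks₂₁,
      Matrix.toBlocks₁₁, Matrix.toBlocks₂₂, Matrix.of_apply, Matrix.transpose_apply,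
      Matrix.neg_apply, Matrix.smul_apply, smul_eq_mul] at *
    refine ⟨fun i j => ?_, fun i j => ?_, fun i j => ?_⟩
    · rw [h1 i j]; ring
    · rw [h2 i j]
    · rw [h3 i j]; ring

variable {k n}

/-- The even element of the periplectic Lie superalgebra attached to `A ∈ gl(n)`. -/
def evenMat (A : Matrix (Fin n) (Fin n) k) : BlockMat k n :=
  Matrix.fromBlocks A 0 0 (-A.transpose)

theorem mem_even_iff (X : BlockMat k n) :
    X ∈ periplecticCarrier k n ⊓ glPart k n 0 ↔ ∃ A, X = evenMat A := by
  constructor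
  · rintro ⟨⟨h1, -, -⟩, h2⟩
    have h12 : X.toBlocks₁₂ = 0 := by
      ext i j
      exact h2 _ _ (by simp [idxParity])
    have h21 : X.toBlocks₂₁ = 0 := by
      ext i j
      exact h2 _ _ (by simp [idxParity])
    refine ⟨X.toBlocks₁₁, ?_⟩
    rw [evenMat, ← h1]
    conv_lhs => rw [← Matrix.fromBlocks_toBlocks X, h12, h21]
  · rintro ⟨A, rfl⟩
    refine ⟨⟨?_, ?_, ?_⟩, ?_⟩
    · simp [evenMat]
    · simp [evenMat]
    · simp [evenMat]
    · rintro (a | a) (b | b) hab <;> simp [evenMat, idxParity] at hab ⊢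
      exact absurd rfl hab

theorem mem_odd_iff (X : BlockMat k n) :
    X ∈ periplecticCarrier k n ⊓ glPart k n 1 ↔
      ∃ B C : Matrix (Fin n) (Fin n) k, B = B.transpose ∧ C = -C.transpose ∧
        X = Matrix.fromBlocks 0 B C 0 := by
  constructor
  · rintro ⟨⟨-, h1, h2⟩, h3⟩
    have h11 : X.toBlocks₁₁ = 0 := by
      ext i j
      exact h3 _ _ (by simp [idxParity])
    have h22 : X.toBlocks₂₂ = 0 := by
      ext i j
      exact h3 _ _ (by simp only [idxParity, Sum.elim_inr]; decide)
    refine ⟨X.toBlocks₁₂, X.toBlocks₂₁, h1, h2, ?_⟩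
    conv_lhs => rw [← Matrix.fromBlocks_toBlocks X, h11, h22]
  · rintro ⟨B, C, hB, hC, rfl⟩
    refine ⟨⟨?_, ?_, ?_⟩, ?_⟩
    · simp
    · simpa using hB
    · simpa using hC
    · rintro (a | a) (b | b) hab <;> simp [idxParity] at hab ⊢

variable (k n)

/-- The periplectic Lie superalgebra of all matrices with blocks `A`, `B`, `C`, `-Aᵀ` where
`B = Bᵀ` and `C = -Cᵀ`, as a restricted subalgebra of `gl(n|n)`. -/
def periplectic [Fact p.Prime] [CharP k p] : RestrictedSubalgebra k p n where
  part i := periplecticCarrier k n ⊓ glPart k n i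
  part_le _ := inf_le_right
  bracket_mem i j x y hx hy := by
    have key : ∀ i : ZMod 2, i = 0 ∨ i = 1 := by decide
    rcases key i with rfl | rfl <;> rcases key j with rfl | rfl
    · obtain ⟨A, rfl⟩ := (mem_even_iff x).1 hx
      obtain ⟨A', rfl⟩ := (mem_even_iff y).1 hy
      refine (mem_even_iff _).2 ⟨A * A' - A' * A, ?_⟩
      simp [superSign, evenMat, Matrix.fromBlocks_multiply, sub_eq_add_neg, Matrix.fromBlocks_neg,
        Matrix.fromBlocks_add, add_comm]
    · obtain ⟨A, rfl⟩ := (mem_even_iff x).1 hx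
      obtain ⟨B, C, hB, hC, rfl⟩ := (mem_odd_iff y).1 hy
      refine (mem_odd_iff _).2 ⟨A * B + B * A.transpose, -A.transpose * C - C * A, ?_, ?_, ?_⟩
      · rw [Matrix.transpose_add, Matrix.transpose_mul, Matrix.transpose_mul, ← hB,
          Matrix.transpose_transpose, add_comm]
      · have hC' : C.transpose = -C := (neg_eq_iff_eq_neg.2 hC).symm
        rw [Matrix.transpose_sub, Matrix.transpose_mul, Matrix.transpose_mul, hC']
        simp [sub_eq_add_neg, add_comm]
      · simp [superSign, evenMat, Matrix.fromBlocks_multiply, sub_eq_add_neg,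
          Matrix.fromBlocks_neg, Matrix.fromBlocks_add]
    · obtain ⟨A, rfl⟩ := (mem_even_iff y).1 hy
      obtain ⟨B, C, hB, hC, rfl⟩ := (mem_odd_iff x).1 hx
      refine (mem_odd_iff _).2 ⟨-(A * B + B * A.transpose), -(-A.transpose * C - C * A), ?_, ?_, ?_⟩
      · rw [Matrix.transpose_neg, Matrix.transpose_add, Matrix.transpose_mul, Matrix.transpose_mul,
          ← hB, Matrix.transpose_transpose, add_comm]
      · have hC' : C.transpose = -C := (neg_eq_iff_eq_neg.2 hC).symm
        rw [Matrix.transpose_neg, Matrix.transpose_sub, Matrix.transpose_mul, Matrix.transpose_mul,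
          hC']
        simp
      · simp [superSign, evenMat, Matrix.fromBlocks_multiply, sub_eq_add_neg,
          Matrix.fromBlocks_neg, Matrix.fromBlocks_add, add_comm]
    · obtain ⟨B, C, hB, hC, rfl⟩ := (mem_odd_iff x).1 hx
      obtain ⟨B', C', hB', hC', rfl⟩ := (mem_odd_iff y).1 hy
      refine (mem_even_iff _).2 ⟨B * C' + B' * C, ?_⟩
      have h1 : C.transpose = -C := (neg_eq_iff_eq_neg.2 hC).symm
      have h2 : C'.transpose = -C' := (neg_eq_iff_eq_neg.2 hC').symm
      simp [superSign, evenMat, Matrix.fromBlocks_multiply, Matrix.fromBlocks_add, ← hB, ← hB', h1,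
        h2, add_comm]
  pow_mem x hx := by
    obtain ⟨A, rfl⟩ := (mem_even_iff x).1 hx
    refine (mem_even_iff _).2 ⟨A ^ p, ?_⟩
    have h : ∀ m : ℕ, evenMat A ^ m = Matrix.fromBlocks (A ^ m) 0 0 ((-A.transpose) ^ m) := by
      intro m
      induction m with
      | zero => simp
      | succ m ih =>
        rw [pow_succ, ih, evenMat, Matrix.fromBlocks_multiply]
        simp [pow_succ]
    rw [h p, evenMat, Matrix.transpose_pow]
    congr 1
    rcases (Fact.out : p.Prime).eq_two_or_odd' with h2 | h2
    · subst h2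
      have : CharP (Matrix (Fin n) (Fin n) k) 2 ∨ Subsingleton (Matrix (Fin n) (Fin n) k) := by
        rcases isEmpty_or_nonempty (Fin n) with h0 | h0
        · exact Or.inr inferInstance
        · exact Or.inl inferInstance
      rcases this with h0 | h0
      · rw [even_two.neg_pow, CharTwo.neg_eq]
      · exact Subsingleton.elim _ _
    · exact h2.neg_pow _

/-- The associative algebra of matrices with upper triangular block `A` and block `C = 0`. -/
def upperAlgebra : Subalgebra k (BlockMat k n) where
  carrier := {X | (∀ i j, j < i → X (Sum.inl i) (Sum.inl j) = 0) ∧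
    ∀ i j, X (Sum.inr i) (Sum.inl j) = 0}
  mul_mem' := by
    rintro X Y ⟨h1, h2⟩ ⟨h3, h4⟩
    refine ⟨fun i j hij => ?_, fun i j => ?_⟩
    · rw [Matrix.mul_apply, Fintype.sum_sum_type]
      simp only [h4, mul_zero, Finset.sum_const_zero, add_zero]
      refine Finset.sum_eq_zero fun l _ => ?_
      rcases lt_or_ge l i with h | h
      · rw [h1 i l h, zero_mul]
      · rw [h3 l j (lt_of_lt_of_le hij h), mul_zero]
    · rw [Matrix.mul_apply, Fintype.sum_sum_type]
      simp [h2, h4]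
  add_mem' := by
    rintro X Y ⟨h1, h2⟩ ⟨h3, h4⟩
    refine ⟨fun i j hij => ?_, fun i j => ?_⟩
    · rw [Matrix.add_apply, h1 i j hij, h3 i j hij, add_zero]
    · rw [Matrix.add_apply, h2, h4, add_zero]
  algebraMap_mem' := by
    intro c
    refine ⟨fun i j hij => ?_, fun i j => ?_⟩
    · rw [Matrix.algebraMap_matrix_apply, if_neg (by simpa using hij.ne')]
    · rw [Matrix.algebraMap_matrix_apply, if_neg (by simp)]

/-- The associative algebra of diagonal matrices. -/
def diagAlgebra : Subalgebra k (BlockMat k n) where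
  carrier := {X | ∀ i j, i ≠ j → X i j = 0}
  mul_mem' := by
    intro X Y hX hY i j hij
    rw [Matrix.mul_apply]
    refine Finset.sum_eq_zero fun l _ => ?_
    by_cases h : i = l
    · subst h
      rw [hY _ _ hij, mul_zero]
    · rw [hX _ _ h, zero_mul]
  add_mem' := by
    intro X Y hX hY i j hij
    rw [Matrix.add_apply, hX i j hij, hY i j hij, add_zero]
  algebraMap_mem' := by
    intro c i j hij
    rw [Matrix.algebraMap_matrix_apply, if_neg hij]

variable [Fact p.Prime] [CharP k p]

/-- The subalgebra `B = b₀ ⊕ g₁`: the block `A` is upper triangular and `C = 0`. -/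
def borelSub : RestrictedSubalgebra k p n := (periplectic k p n).inf (upperAlgebra k n)

/-- The standard Cartan subalgebra `h` (purely even), of all `diag(h₁, …, hₙ, -h₁, …, -hₙ)`. -/
def cartanSub : RestrictedSubalgebra k p n := (periplectic k p n).inf (diagAlgebra k n)

theorem borelSub_le (i : ZMod 2) : (borelSub k p n).part i ≤ (periplectic k p n).part i := inf_le_left

theorem cartanSub_le (i : ZMod 2) : (cartanSub k p n).part i ≤ (periplectic k p n).part i := inf_le_left

/-- The isomorphism `gl(n) → g₀`, `A ↦ diag(A, -Aᵀ)`. -/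
def evenIso : Matrix (Fin n) (Fin n) k →ₗ[k] (periplectic k p n).part 0 where
  toFun A := ⟨evenMat A, (mem_even_iff _).2 ⟨A, rfl⟩⟩
  map_add' A A' := by
    apply Subtype.ext
    simp [evenMat, Matrix.fromBlocks_add, add_comm]
  map_smul' c A := by
    apply Subtype.ext
    simp [evenMat, Matrix.fromBlocks_smul]

/-- The subspace `n₀⁺` of `g₀`: the block `A` is strictly upper triangular. -/
def nPlus : Submodule k ((periplectic k p n).part 0) :=
  Submodule.span k {x | ∃ i j : Fin n, i < j ∧ x = evenIso k p n (Matrix.single i j 1)}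

/-- The subspace `n₀⁻` of `g₀`: the block `A` is strictly lower triangular. -/
def nMinus : Submodule k ((periplectic k p n).part 0) :=
  Submodule.span k {x | ∃ i j : Fin n, j < i ∧ x = evenIso k p n (Matrix.single i j 1)}

variable {n}

/-- The element `Hᵢ = E_{i,i} - E_{n+i,n+i}` of `h ⊆ g₀`. -/
def cartanElt (i : Fin n) : (periplectic k p n).part 0 := evenIso k p n (Matrix.single i i 1)

variable {k}

/-- The block matrix `diag(g, g^{-t})`. -/
def barMat (g : GL (Fin n) k) : BlockMat k n :=
  Matrix.fromBlocks g.1 0 0 (g⁻¹).1.transpose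

/-- The adjoint action of `GL(n)` on `g₀`, by conjugation with `diag(g, g^{-t})`. -/
def adAction (g : GL (Fin n) k) :
    (periplectic k p n).part 0 →ₗ[k] (periplectic k p n).part 0 where
  toFun x := ⟨barMat g * x.1 * barMat g⁻¹, by
    obtain ⟨A, hA⟩ := (mem_even_iff x.1).1 x.2
    refine (mem_even_iff _).2 ⟨g.1 * A * (g⁻¹).1, ?_⟩
    rw [hA]
    simp [barMat, evenMat, Matrix.fromBlocks_multiply, Matrix.transpose_mul, Matrix.mul_assoc]⟩
  map_add' x y := by
    apply Subtype.ext
    simp [mul_add, add_mul]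
  map_smul' c x := by
    apply Subtype.ext
    simp

/-- The coadjoint action of `GL(n)` on `g₀*`: `(Ad(g)χ)(x) = χ(Ad(g⁻¹)x)`. -/
def coadAction (g : GL (Fin n) k) (χ : Module.Dual k ((periplectic k p n).part 0)) :
    Module.Dual k ((periplectic k p n).part 0) :=
  χ.comp (adAction p g⁻¹)

/-- `χ ∈ g₀*` is regular semisimple if some conjugate `Ad(g)χ` vanishes on `n₀⁺` and `n₀⁻` and
takes pairwise different values at `H₁, …, Hₙ`. -/
def IsRegularSemisimple (χ : Module.Dual k ((periplectic k p n).part 0)) : Prop :=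
  ∃ g : GL (Fin n) k,
    (∀ x ∈ nPlus k p n, coadAction p g χ x = 0) ∧
    (∀ x ∈ nMinus k p n, coadAction p g χ x = 0) ∧
    ∀ i j : Fin n, i < j → coadAction p g χ (cartanElt k p i - cartanElt k p j) ≠ 0

/-- The set `Λ(χ)` of all `μ ∈ h*` with `μ(H)^p - μ(H^{[p]}) = χ(H)^p` for all `H ∈ h`. -/
def weights (χ : Module.Dual k ((periplectic k p n).part 0)) :
    Set (Module.Dual k ((cartanSub k p n).part 0)) :=
  {μ | ∀ H : (cartanSub k p n).part 0,
    μ H ^ p - μ ((cartanSub k p n).pmap H) = χ (Submodule.inclusion (cartanSub_le k p n 0) H) ^ p}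

/-- The projection `B = h ⊕ N⁺ → h`, where `N⁺ = n₀⁺ ⊕ g₁`, on the component of parity `i`. It keeps
the diagonal entries, so that it vanishes on odd elements. -/
def borelProj (i : ZMod 2) : (borelSub k p n).part i →ₗ[k] (cartanSub k p n).part 0 where
  toFun x := ⟨Matrix.diagonal x.1.diag, by
    have key : ∀ i : ZMod 2, i = 0 ∨ i = 1 := by decide
    refine ⟨(mem_even_iff _).2 ?_, fun i j hij => Matrix.diagonal_apply_ne _ hij⟩
    rcases key i with rfl | rfl
    · obtain ⟨A, hA⟩ := (mem_even_iff x.1).1 x.2.1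
      refine ⟨Matrix.diagonal A.diag, ?_⟩
      rw [hA]
      ext (i | i) (j | j) <;> simp [evenMat, Matrix.diagonal_apply, eq_comm]
    · obtain ⟨B, C, -, -, hx⟩ := (mem_odd_iff x.1).1 x.2.1
      refine ⟨0, ?_⟩
      rw [hx]
      ext (i | i) (j | j) <;> simp [evenMat, Matrix.diagonal_apply]⟩
  map_add' x y := by
    apply Subtype.ext
    simp [Matrix.diagonal_add]
  map_smul' c x := by
    apply Subtype.ext
    simp [Matrix.diagonal_smul]

theorem borelProj_apply_inl (i : ZMod 2) (x : (borelSub k p n).part i) (a : Fin n) :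
    (borelProj p i x).1 (Sum.inl a) (Sum.inl a) = x.1 (Sum.inl a) (Sum.inl a) := by
  change Matrix.diagonal x.1.diag (Sum.inl a) (Sum.inl a) = _
  rw [Matrix.diagonal_apply_eq, Matrix.diag_apply]

/-- An element of `h` is determined by its first `n` diagonal entries. -/
theorem cartanSub_ext {x y : (cartanSub k p n).part 0}
    (h : ∀ i : Fin n, x.1 (Sum.inl i) (Sum.inl i) = y.1 (Sum.inl i) (Sum.inl i)) : x = y := by
  apply Subtype.ext
  obtain ⟨A, hA⟩ := (mem_even_iff x.1).1 x.2.1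
  obtain ⟨B, hB⟩ := (mem_even_iff y.1).1 y.2.1
  have hx := x.2.2
  have hy := y.2.2
  have hAB : A = B := by
    ext i j
    by_cases hij : i = j
    · subst hij
      have := h i
      rw [hA, hB] at this
      simpa [evenMat] using this
    · have h1 := hx (Sum.inl i) (Sum.inl j) (by simpa using hij)
      have h2 := hy (Sum.inl i) (Sum.inl j) (by simpa using hij)
      rw [hA] at h1
      rw [hB] at h2
      simp only [evenMat, Matrix.fromBlocks_apply₁₁] at h1 h2
      rw [h1, h2]
  rw [hA, hB, hAB]

/-- Diagonal entries are multiplicative on upper triangular blocks. -/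
theorem upper_mul_diag {X Y : BlockMat k n} (hX : X ∈ upperAlgebra k n) (hY : Y ∈ upperAlgebra k n)
    (i : Fin n) : (X * Y) (Sum.inl i) (Sum.inl i) =
      X (Sum.inl i) (Sum.inl i) * Y (Sum.inl i) (Sum.inl i) := by
  rw [Matrix.mul_apply, Fintype.sum_sum_type]
  simp only [hY.2, mul_zero, Finset.sum_const_zero, add_zero]
  refine Finset.sum_eq_single i (fun l _ hl => ?_) (by simp)
  rcases lt_or_gt_of_ne hl with h | h
  · rw [hX.1 i l h, zero_mul]
  · rw [hY.1 l i h, mul_zero]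

theorem upper_pow_diag {X : BlockMat k n} (hX : X ∈ upperAlgebra k n) (i : Fin n) (m : ℕ) :
    (X ^ m) (Sum.inl i) (Sum.inl i) = X (Sum.inl i) (Sum.inl i) ^ m := by
  induction m with
  | zero => simp
  | succ m ih => rw [pow_succ, upper_mul_diag (Subalgebra.pow_mem _ hX m) hX, ih, pow_succ]

theorem borelProj_pmap (x : (borelSub k p n).part 0) :
    borelProj p 0 ((borelSub k p n).pmap x) = (cartanSub k p n).pmap (borelProj p 0 x) := by
  refine cartanSub_ext p fun i => ?_
  rw [borelProj_apply_inl]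
  have h : (borelProj p 0 x).1 ∈ upperAlgebra k n :=
    ⟨fun i j hij => (borelProj p 0 x).2.2 _ _ (by simpa using hij.ne'),
      fun i j => (borelProj p 0 x).2.2 _ _ (by simp)⟩
  refine (upper_pow_diag x.2.2 i p).trans (Eq.trans ?_ (upper_pow_diag h i p).symm)
  rw [borelProj_apply_inl]

theorem borelProj_odd (x : (borelSub k p n).part 1) : borelProj p 1 x = 0 := by
  refine cartanSub_ext p fun a => ?_
  rw [borelProj_apply_inl]
  exact x.2.1.2 _ _ (by simp [idxParity])

theorem borelProj_bracket (i j : ZMod 2) (x : (borelSub k p n).part i)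
    (y : (borelSub k p n).part j) :
    borelProj p (i + j) ((borelSub k p n).bracket x y) = 0 := by
  refine cartanSub_ext p fun a => ?_
  rw [borelProj_apply_inl]
  change (x.1 * y.1 - superSign k i j • (y.1 * x.1)) (Sum.inl a) (Sum.inl a) = 0
  rw [Matrix.sub_apply, Matrix.smul_apply, upper_mul_diag x.2.2 y.2.2, upper_mul_diag y.2.2 x.2.2]
  by_cases h : i = 1 ∧ j = 1
  · obtain ⟨rfl, rfl⟩ := h
    have hz : ∀ z : (borelSub k p n).part 1, z.1 (Sum.inl a) (Sum.inl a) = 0 := fun z =>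
      z.2.1.2 _ _ (by simp [idxParity])
    rw [hz x, hz y]
    simp
  · simp [superSign, h, mul_comm]

/-- If `χ` vanishes on `n₀⁺`, then on `b₀` it only depends on the projection to `h`. -/
theorem restrict_eq_borelProj (χ : Module.Dual k ((periplectic k p n).part 0))
    (hχ : ∀ x ∈ nPlus k p n, χ x = 0) (x : (borelSub k p n).part 0) :
    χ (Submodule.inclusion (borelSub_le k p n 0) x) =
      χ (Submodule.inclusion (cartanSub_le k p n 0) (borelProj p 0 x)) := by
  rw [← sub_eq_zero, ← map_sub]
  apply hχ
  obtain ⟨A, hA⟩ := (mem_even_iff x.1).1 x.2.1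
  have hx := x.2.2.1
  have key : Submodule.inclusion (borelSub_le k p n 0) x -
      Submodule.inclusion (cartanSub_le k p n 0) (borelProj p 0 x) =
      ∑ i : Fin n, ∑ j : Fin n, if i < j then A i j • evenIso k p n (Matrix.single i j 1) else 0 := by
    have h1 : Submodule.inclusion (borelSub_le k p n 0) x = evenIso k p n A := Subtype.ext hA
    have h2 : Submodule.inclusion (cartanSub_le k p n 0) (borelProj p 0 x) =
        evenIso k p n (Matrix.diagonal A.diag) := by
      apply Subtype.ext
      change Matrix.diagonal x.1.diag = evenMat _
      rw [hA]
      ext (i | i) (j | j) <;> simp [evenMat, Matrix.diagonal_apply, eq_comm]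
    rw [h1, h2, ← map_sub]
    have h3 : A - Matrix.diagonal A.diag =
        ∑ i : Fin n, ∑ j : Fin n, if i < j then A i j • Matrix.single i j (1 : k) else 0 := by
      conv_lhs => rw [Matrix.matrix_eq_sum_single (A - Matrix.diagonal A.diag)]
      refine Finset.sum_congr rfl fun i _ => Finset.sum_congr rfl fun j _ => ?_
      rw [Matrix.smul_single, smul_eq_mul, mul_one, Matrix.sub_apply]
      rcases lt_trichotomy i j with h | h | h
      · rw [if_pos h, Matrix.diagonal_apply_ne _ h.ne, sub_zero]
      · subst h
        simp
      · rw [if_neg h.not_gt, Matrix.diagonal_apply_ne _ h.ne']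
        have := hx i j h
        rw [hA] at this
        simp only [evenMat, Matrix.fromBlocks_apply₁₁] at this
        rw [this]
        simp
    rw [h3, map_sum]
    refine Finset.sum_congr rfl fun i _ => ?_
    rw [map_sum]
    refine Finset.sum_congr rfl fun j _ => ?_
    split_ifs
    · rw [map_smul]
    · rw [map_zero]
  rw [key]
  refine Submodule.sum_mem _ fun i _ => Submodule.sum_mem _ fun j _ => ?_
  split_ifs with h
  · exact Submodule.smul_mem _ _ (Submodule.subset_span ⟨i, j, h, rfl⟩)
  · exact Submodule.zero_mem _

/-- The one-dimensional representation `U_χ(B) → k` of weight `μ ∈ Λ(χ)`, where `χ(n₀⁺) = 0`: an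
element of `B = h ⊕ N⁺` acts by the value of `μ` at its component in `h`. -/
def borelChar (χ : Module.Dual k ((periplectic k p n).part 0))
    (hχ : ∀ x ∈ nPlus k p n, χ x = 0)
    (μ : Module.Dual k ((cartanSub k p n).part 0)) (hμ : μ ∈ weights p χ) :
    RedEnv (borelSub k p n) (restrict (borelSub_le k p n) χ) →ₐ[k] k :=
  redLift _ _ (fun i => μ.comp (borelProj p i))
    (by
      intro i j x y
      simp only [LinearMap.comp_apply]
      rw [borelProj_bracket, map_zero]
      by_cases h : i = 1 ∧ j = 1
      · obtain ⟨rfl, rfl⟩ := h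
        rw [borelProj_odd, borelProj_odd]
        simp
      · simp [superSign, h, mul_comm])
    (by
      intro x
      simp only [LinearMap.comp_apply]
      rw [borelProj_pmap]
      refine (hμ (borelProj p 0 x)).trans ?_
      rw [← restrict_eq_borelProj p χ hχ]
      rfl)

/-- The one-dimensional `U_χ(B)`-module `k_μ`. -/
def WeightModule (χ : Module.Dual k ((periplectic k p n).part 0))
    (_hχ : ∀ x ∈ nPlus k p n, χ x = 0)
    (μ : Module.Dual k ((cartanSub k p n).part 0)) (_hμ : μ ∈ weights p χ) : Type u := k

section WeightModule

variable (χ : Module.Dual k ((periplectic k p n).part 0)) (hχ : ∀ x ∈ nPlus k p n, χ x = 0)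
  (μ : Module.Dual k ((cartanSub k p n).part 0)) (hμ : μ ∈ weights p χ)

instance : AddCommGroup (WeightModule p χ hχ μ hμ) := inferInstanceAs (AddCommGroup k)

instance : Module k (WeightModule p χ hχ μ hμ) := inferInstanceAs (Module k k)

instance : Module (RedEnv (borelSub k p n) (restrict (borelSub_le k p n) χ))
    (WeightModule p χ hχ μ hμ) :=
  Module.compHom k (borelChar p χ hχ μ hμ).toRingHom

/-- The basis vector of `k_μ`. -/
def weightVector : WeightModule p χ hχ μ hμ := (1 : k)

/-- The generalized baby Verma module `Z_χ(μ) = U_χ(g) ⊗_{U_χ(B)} k_μ`. -/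
abbrev BabyVerma : Type u :=
  InducedModule (redMap (borelSub_le k p n) χ) (WeightModule p χ hχ μ hμ)

/-- The `ℤ/2`-grading of `Z_χ(μ)`, with `k_μ` even: the component of parity `i` consists of all
`w ⊗ 1` with `w` of parity `i` in `U_χ(g)`. -/
def babyVermaPart (i : ZMod 2) : Submodule k (BabyVerma p χ hχ μ hμ) where
  carrier := {z | ∃ w ∈ redPart (periplectic k p n) χ i,
    z = (inducedRel (redMap (borelSub_le k p n) χ) (WeightModule p χ hχ μ hμ)).mkQ
      (w ⊗ₜ[k] weightVector p χ hχ μ hμ)}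
  add_mem' := by
    rintro _ _ ⟨w, hw, rfl⟩ ⟨w', hw', rfl⟩
    exact ⟨w + w', add_mem hw hw', by rw [TensorProduct.add_tmul, map_add]⟩
  zero_mem' := ⟨0, zero_mem _, by rw [TensorProduct.zero_tmul, map_zero]⟩
  smul_mem' := by
    rintro c _ ⟨w, hw, rfl⟩
    exact ⟨c • w, Submodule.smul_mem _ _ hw, by rw [← TensorProduct.smul_tmul']; rfl⟩

end WeightModule

end Periplectic

end

/-!
Write `g = g₀ ⊕ g₁ ⊕ g₋₁`, where `g₁` is the space of symmetric blocks `B` and `g₋₁` the space of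
skew blocks `C`.

*Irreducible modules are quotients.* On any nonzero `U_χ(g)`-module the odd operators of `g₁`
anticommute and have square zero, so they have a common kernel. This kernel is stable under `b₀`; as
`χ` vanishes on `n₀⁺`, the strictly upper triangular matrix units act nilpotently, and the columns
`E_{a,t}` (`a < t`) can be killed one after the other, starting with the last. Finally the commuting
operators `H_a` satisfy `X^p - X = χ(H_a)^p`, and have a common eigenvector. This is
`PeriplecticRep.exists_isHighestWeight`. The homogeneous components of a highest weight vector are
highest weight vectors, and the universal property of the baby Verma module
(`Periplectic.exists_verma_hom`) gives `Periplectic.irreducible_is_quotient`.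

*Irreducibility.* Regarded as a matrix through the trace form, `χ` is upper triangular, and if it is
regular semisimple then it has pairwise different diagonal entries and is conjugate to a diagonal
matrix by a unitriangular matrix `u`. After twisting by `u`, which changes neither the Borel
subalgebra nor the highest weight vector, all the off-diagonal matrix units act nilpotently, and the
differences of the coordinates of the weight stay outside of the prime field. A nonzero submodule is
then shown to contain the highest weight vector `v` in `n + 1` similar steps, along the chain
`h ⊆ gl(1) + h ⊆ ⋯ ⊆ gl(n) ⊆ g`. Each step adjoins lowering operators `f_i`, which commute up to a
common sign: the entries of the row `E_{m,j}` with `j < m`, and in the last step those of the skew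
blocks. The vectors of the bigger module are combinations of words in the `f_i` applied to the
smaller one, and a nonzero vector can be multiplied by further `f_i` until only the longest word
`T`, where each `f_i` has its maximal power, is left (`EveryVectorReaches.extend`). As `T` commutes
with the smaller algebra up to scalars, `T v` is reached, and from `T v` one comes back to `v` by
raising operators: each of them undoes a power of `f_i` at the cost of a scalar, a product of
differences of weight coordinates plus integers, which is nonzero by regularity. The result is
`PeriplecticRep.eq_top_of_isHighestWeight`.

*The baby Verma modules are nonzero.* Instead of a Poincaré–Birkhoff–Witt theorem, an explicit module
is used. The superalgebra `gl(n|n)` acts by the operators `∑ z_{α,l} w_{β,l}`, where `z_{α,l}` are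
multiplications by even and odd variables and `w_{β,l}` the corresponding derivatives
(`SuperOscillator`). The even variables are the coordinates `x_{i,l}` of the Frobenius kernel of
`GL(n)`, so that `x_{i,l}^p = δ_{i,l}`, and the derivatives with respect to them are shifted by scalars
in such a way that the `p`-character of the module is `χ`: by Jacobson's formula
(`pow_sub_map_pow_add`) this has to be checked for the matrix units only, where it follows from
`(x ∂)^p - x ∂ = x^p ∂^p`. This module has a highest weight vector, and multiplication with the leading
minors of the matrix of the `x_{i,l}`, whose `p`-th powers are `1`, changes its weight by the
fundamental weights. So all the weights in `Λ(χ)` occur, and all the baby Verma modules have nonzero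
images (`Periplectic.nontrivial_babyVerma`).
-/

/-! ### Words in operators that commute up to a scalar -/

section Words

variable {k V ι : Type*} [Field k] [AddCommGroup V] [Module k V]

/-- The product of the operators `f i` along a word in the index set. -/
def wordOp (f : ι → Module.End k V) (w : List ι) : Module.End k V := (w.map f).prod

@[simp] theorem wordOp_nil (f : ι → Module.End k V) : wordOp f [] = 1 := rfl

@[simp] theorem wordOp_cons (f : ι → Module.End k V) (i : ι) (w : List ι) :
    wordOp f (i :: w) = f i * wordOp f w := by simp [wordOp]

theorem wordOp_append (f : ι → Module.End k V) (w w' : List ι) :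
    wordOp f (w ++ w') = wordOp f w * wordOp f w' := by simp [wordOp]

theorem wordOp_replicate (f : ι → Module.End k V) (i : ι) (m : ℕ) :
    wordOp f (List.replicate m i) = f i ^ m := by simp [wordOp]

/-- The word in which every letter of `l` is repeated `q - 1` times. -/
def topWord (q : ℕ) (l : List ι) : List ι := l.flatMap (List.replicate (q - 1))

theorem topWord_cons (q : ℕ) (i : ι) (l : List ι) :
    topWord q (i :: l) = List.replicate (q - 1) i ++ topWord q l := rfl

theorem mem_of_mem_topWord {q : ℕ} {l : List ι} {i : ι} (h : i ∈ topWord q l) : i ∈ l := by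
  obtain ⟨j, hj, hi⟩ := List.mem_flatMap.1 h
  rwa [List.eq_of_mem_replicate hi]

theorem count_topWord [DecidableEq ι] (q : ℕ) (l : List ι) (i : ι) :
    (topWord q l).count i = l.count i * (q - 1) := by
  induction l with
  | nil => simp [topWord]
  | cons j l ih =>
    rw [topWord_cons, List.count_append, ih, List.count_replicate, List.count_cons, add_mul]
    by_cases h : j = i <;> simp [h, add_comm]

variable {f : ι → Module.End k V} {ε : k} {q : ℕ}

theorem mul_pow_of_skewComm {a b : Module.End k V} (h : a * b = ε • (b * a)) (n : ℕ) :
    a * b ^ n = ε ^ n • (b ^ n * a) := by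
  induction n with
  | zero => simp
  | succ n ih =>
    rw [pow_succ, ← mul_assoc, ih, smul_mul_assoc, mul_assoc, h, mul_smul_comm, smul_smul,
      ← pow_succ, mul_assoc]

/-- All occurrences of a letter can be moved to the front of a word. -/
theorem exists_wordOp_eq_smul [DecidableEq ι]
    (hc : ∀ i j, i ≠ j → f i * f j = ε • (f j * f i)) (i : ι) (w : List ι) :
    ∃ (c : k) (g : Module.End k V), wordOp f w = c • (f i ^ w.count i * g) := by
  induction w with
  | nil => exact ⟨1, 1, by simp⟩
  | cons s w ih =>
    obtain ⟨c, g, h⟩ := ih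
    by_cases hs : s = i
    · subst hs
      refine ⟨c, g, ?_⟩
      rw [wordOp_cons, h, List.count_cons_self, pow_succ', mul_smul_comm, mul_assoc]
    · refine ⟨c * ε ^ w.count i, f s * g, ?_⟩
      rw [wordOp_cons, h, List.count_cons_of_ne hs, mul_smul_comm, ← mul_assoc,
        mul_pow_of_skewComm (hc s i hs), smul_mul_assoc, smul_smul, mul_assoc]

theorem wordOp_eq_zero_of_le_count [DecidableEq ι]
    (hc : ∀ i j, i ≠ j → f i * f j = ε • (f j * f i)) (hq : ∀ i, f i ^ q = 0)
    {i : ι} {w : List ι} (h : q ≤ w.count i) : wordOp f w = 0 := by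
  obtain ⟨c, g, hg⟩ := exists_wordOp_eq_smul hc i w
  rw [hg, pow_eq_zero_of_le h (hq i), zero_mul, smul_zero]

/-- The commutator with an operator that sends letters to combinations of letters is a combination
of words in which one letter has been replaced. -/
theorem commutator_wordOp_mem (f : ι → Module.End k V) (o : Module.End k V) (R : ι → ι → Prop)
    (ho : ∀ i, o * f i - f i * o ∈ Submodule.span k (f '' {j | R i j})) (w : List ι) :
    o * wordOp f w - wordOp f w * o ∈
      Submodule.span k {x | ∃ u i u' j, w = u ++ i :: u' ∧ R i j ∧ x = wordOp f (u ++ j :: u')} := by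
  induction w with
  | nil => simp
  | cons s w ih =>
    have key : o * wordOp f (s :: w) - wordOp f (s :: w) * o =
        (o * f s - f s * o) * wordOp f w + f s * (o * wordOp f w - wordOp f w * o) := by
      rw [wordOp_cons]; noncomm_ring
    rw [key]
    refine add_mem ?_ ?_
    · have := Submodule.mem_map_of_mem (f := LinearMap.mulRight k (wordOp f w)) (ho s)
      rw [Submodule.map_span] at this
      refine Submodule.span_mono ?_ this
      rintro _ ⟨_, ⟨j, hj, rfl⟩, rfl⟩
      exact ⟨[], s, w, j, rfl, hj, by simp⟩
    · have := Submodule.mem_map_of_mem (f := LinearMap.mulLeft k (f s)) ih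
      rw [Submodule.map_span] at this
      refine Submodule.span_mono ?_ this
      rintro _ ⟨_, ⟨u, i, u', j, rfl, hj, rfl⟩, rfl⟩
      exact ⟨s :: u, i, u', j, rfl, hj, by simp⟩

/-- An operator that sends letters to combinations of letters preserves the line through the
product of all top powers: replacing a letter by another one produces a `q`-th power. -/
theorem commutator_topWord_mem [DecidableEq ι] (hq0 : 0 < q)
    (hc : ∀ i j, i ≠ j → f i * f j = ε • (f j * f i)) (hq : ∀ i, f i ^ q = 0)
    {l : List ι} (hl : l.Nodup) (hall : ∀ i, i ∈ l) {o : Module.End k V}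
    (ho : ∀ i, o * f i - f i * o ∈ Submodule.span k (Set.range f)) :
    o * wordOp f (topWord q l) - wordOp f (topWord q l) * o ∈
      Submodule.span k {wordOp f (topWord q l)} := by
  refine Submodule.span_le.2 ?_ (commutator_wordOp_mem f o (fun _ _ => True)
    (by simpa [Set.image_univ] using ho) (topWord q l))
  rintro _ ⟨u, i, u', j, hw, -, rfl⟩
  by_cases hij : i = j
  · subst hij
    rw [← hw]
    exact Submodule.mem_span_singleton_self _
  · have h1 : (topWord q l).count j = q - 1 := by
      rw [count_topWord, List.count_eq_one_of_mem hl (hall j), one_mul]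
    have h2 : q ≤ (u ++ j :: u').count j := by
      rw [hw, List.count_append, List.count_cons_of_ne hij] at h1
      rw [List.count_append, List.count_cons_self]
      omega
    rw [wordOp_eq_zero_of_le_count hc hq h2]
    exact zero_mem _

/-- Every letter of the word is followed by at least `q - 1` copies of each larger letter. -/
def IsSaturated [DecidableEq ι] [LT ι] (q : ℕ) : List ι → Prop
  | [] => True
  | s :: w => IsSaturated q w ∧ ∀ j, s < j → q - 1 ≤ w.count j

theorem IsSaturated.le_count [DecidableEq ι] [LT ι] {u u' : List ι} {i j : ι}
    (h : IsSaturated q (u ++ i :: u')) (hij : i < j) : q - 1 ≤ u'.count j := by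
  induction u with
  | nil => exact h.2 j hij
  | cons s u ih => exact ih h.1

/-- Operators that raise letters commute with saturated words. -/
theorem commute_wordOp_of_isSaturated [DecidableEq ι] [LinearOrder ι]
    (hc : ∀ i j, i ≠ j → f i * f j = ε • (f j * f i)) (hq : ∀ i, f i ^ q = 0)
    {w : List ι} (hw : IsSaturated q w) {o : Module.End k V}
    (ho : ∀ i, o * f i - f i * o ∈ Submodule.span k (f '' {j | i < j})) :
    o * wordOp f w = wordOp f w * o := by
  rw [← sub_eq_zero, ← Submodule.mem_bot k]
  refine Submodule.span_le.2 ?_ (commutator_wordOp_mem f o (· < ·) ho w)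
  rintro _ ⟨u, i, u', j, rfl, hij, rfl⟩
  have h1 := hw.le_count hij
  refine wordOp_eq_zero_of_le_count hc hq (i := j) ?_
  rw [List.count_append, List.count_cons_self]
  omega

theorem IsSaturated.replicate_append [DecidableEq ι] [LinearOrder ι] {w : List ι} {r : ι}
    (hw : IsSaturated q w) (hr : ∀ j, r < j → q - 1 ≤ w.count j) (m : ℕ) :
    IsSaturated q (List.replicate m r ++ w) := by
  induction m with
  | zero => exact hw
  | succ m ih =>
    refine ⟨ih, fun j hj => (hr j hj).trans ?_⟩
    change _ ≤ List.count j (List.replicate m r ++ w)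
    rw [List.count_append]
    exact Nat.le_add_left _ _

/-- A list that is strictly increasing and contains everything above its elements. -/
def IsUpperList [LT ι] (l : List ι) : Prop :=
  l.Pairwise (· < ·) ∧ ∀ i ∈ l, ∀ j, i < j → j ∈ l

theorem IsUpperList.of_cons [LinearOrder ι] {r : ι} {l : List ι} (h : IsUpperList (r :: l)) :
    IsUpperList l := by
  refine ⟨h.1.of_cons, fun i hi j hij => ?_⟩
  rcases List.mem_cons.1 (h.2 i (List.mem_cons_of_mem _ hi) j hij) with rfl | h'
  · exact absurd hij (List.rel_of_pairwise_cons h.1 hi).asymm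
  · exact h'

theorem IsUpperList.le_count [DecidableEq ι] [LinearOrder ι] {r : ι} {l : List ι}
    (h : IsUpperList (r :: l)) (q : ℕ) {j : ι} (hj : r < j) : q - 1 ≤ (topWord q l).count j := by
  rw [count_topWord]
  have h1 : j ∈ l := (List.mem_cons.1 (h.2 r List.mem_cons_self j hj)).resolve_left hj.ne'
  exact Nat.le_mul_of_pos_left _ (List.count_pos_iff.2 h1)

theorem isSaturated_topWord [DecidableEq ι] [LinearOrder ι] {l : List ι}
    (hl : IsUpperList l) : IsSaturated q (topWord q l) := by
  induction l with
  | nil => trivial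
  | cons r l ih =>
    rw [topWord_cons]
    exact (ih hl.of_cons).replicate_append (fun j hj => hl.le_count q hj) _

/-- The combinations of monomials in the operators `f i`, `i ∈ l`, with exponents below `q`, applied
to vectors of `Y`. -/
def monomialSpan (f : ι → Module.End k V) (q : ℕ) (Y : Submodule k V) : List ι → Submodule k V
  | [] => Y
  | r :: l =>
    { carrier := {x | ∃ g : ℕ → V, (∀ a, g a ∈ monomialSpan f q Y l) ∧
        x = ∑ a ∈ Finset.range q, (f r ^ a) (g a)}
      add_mem' := by
        rintro _ _ ⟨g, hg, rfl⟩ ⟨g', hg', rfl⟩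
        exact ⟨g + g', fun a => add_mem (hg a) (hg' a), by simp [Finset.sum_add_distrib]⟩
      zero_mem' := ⟨0, fun _ => zero_mem _, by simp⟩
      smul_mem' := by
        rintro c _ ⟨g, hg, rfl⟩
        exact ⟨c • g, fun a => Submodule.smul_mem _ _ (hg a), by simp [Finset.smul_sum]⟩ }

theorem monomialSpan_le_cons (hq0 : 0 < q) (Y : Submodule k V) (r : ι) (l : List ι) :
    monomialSpan f q Y l ≤ monomialSpan f q Y (r :: l) := by
  intro x hx
  refine ⟨fun a => if a = 0 then x else 0, fun a => ?_, ?_⟩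
  · dsimp only
    split_ifs
    · exact hx
    · exact zero_mem _
  · rw [Finset.sum_eq_single 0]
    · simp
    · intro a _ ha
      simp [ha]
    · intro h
      simp at h
      omega

theorem le_monomialSpan (hq0 : 0 < q) (Y : Submodule k V) (l : List ι) :
    Y ≤ monomialSpan f q Y l := by
  induction l with
  | nil => exact le_rfl
  | cons r l ih => exact ih.trans (monomialSpan_le_cons hq0 Y r l)

theorem monomialSpan_stable (hc : ∀ i j, i ≠ j → f i * f j = ε • (f j * f i))
    (hq : ∀ i, f i ^ q = 0) (Y : Submodule k V) {l : List ι} {i : ι} (hi : i ∈ l) {x : V}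
    (hx : x ∈ monomialSpan f q Y l) : f i x ∈ monomialSpan f q Y l := by
  induction l generalizing x with
  | nil => simp at hi
  | cons r l ih =>
    obtain ⟨g, hg, rfl⟩ := hx
    by_cases hir : i = r
    · subst hir
      refine ⟨fun a => if a = 0 then 0 else g (a - 1), fun a => ?_, ?_⟩
      · dsimp only
        split_ifs
        · exact zero_mem _
        · exact hg _
      · rw [map_sum]
        rcases q with _ | q
        · simp
        · rw [Finset.sum_range_succ, Finset.sum_range_succ']
          simp only [← Module.End.mul_apply, ← pow_succ', hq]
          simp
    · have hil : i ∈ l := (List.mem_cons.1 hi).resolve_left hir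
      refine ⟨fun a => ε ^ a • f i (g a), fun a => Submodule.smul_mem _ _ (ih hil (hg a)), ?_⟩
      rw [map_sum]
      refine Finset.sum_congr rfl fun a _ => ?_
      rw [← Module.End.mul_apply, mul_pow_of_skewComm (hc i r hir)]
      simp

theorem monomialSpan_le {Y Q : Submodule k V} (hY : Y ≤ Q) (hQ : ∀ i, ∀ x ∈ Q, f i x ∈ Q)
    (l : List ι) : monomialSpan f q Y l ≤ Q := by
  induction l with
  | nil => exact hY
  | cons r l ih =>
    rintro _ ⟨g, hg, rfl⟩
    refine sum_mem fun a _ => ?_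
    have : ∀ (m : ℕ) (x : V), x ∈ Q → (f r ^ m) x ∈ Q := by
      intro m
      induction m with
      | zero => intro x hx; simpa using hx
      | succ m ihm =>
        intro x hx
        rw [pow_succ', Module.End.mul_apply]
        exact hQ _ _ (ihm x hx)
    exact this a _ (ih (hg a))

theorem pow_mul_of_skewComm {a b : Module.End k V} (h : a * b = ε • (b * a)) (n : ℕ) :
    a ^ n * b = ε ^ n • (b * a ^ n) := by
  induction n with
  | zero => simp
  | succ n ih =>
    rw [pow_succ', mul_assoc, ih, mul_smul_comm, ← mul_assoc, h, smul_mul_assoc, smul_smul,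
      ← pow_succ, mul_assoc]

/-- A subspace stable under the `f i` that meets the span of the monomials contains the product of
all top powers, applied to some nonzero vector of `Y`: multiply an element by the complement of its
lowest exponent. -/
theorem exists_topWord_mem [DecidableEq ι] (hc : ∀ i j, i ≠ j → f i * f j = ε • (f j * f i))
    (hq : ∀ i, f i ^ q = 0) (Y : Submodule k V) {l : List ι} (hl : l.Nodup)
    (W : Submodule k V) (hW : ∀ i ∈ l, ∀ x ∈ W, f i x ∈ W) {x : V} (hxW : x ∈ W)
    (hx : x ∈ monomialSpan f q Y l) (hx0 : x ≠ 0) :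
    ∃ y ∈ Y, y ≠ 0 ∧ wordOp f (topWord q l) y ∈ W := by
  induction l generalizing W x with
  | nil => exact ⟨x, hx, hx0, by simpa [topWord] using hxW⟩
  | cons r l ih =>
    obtain ⟨g, hg, rfl⟩ := hx
    have hex : ∃ a, a < q ∧ g a ≠ 0 := by
      by_contra! h
      exact hx0 (Finset.sum_eq_zero fun a ha => by rw [h a (Finset.mem_range.1 ha), map_zero])
    classical
    obtain ⟨haq, ha0⟩ := Nat.find_spec hex
    have hmin : ∀ b < Nat.find hex, g b = 0 := fun b hb => by
      by_contra h
      exact Nat.find_min hex hb ⟨hb.trans haq, h⟩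
    generalize Nat.find hex = a at *
    have hpow : ∀ (m : ℕ) (x : V), x ∈ W → (f r ^ m) x ∈ W := by
      intro m
      induction m with
      | zero => intro x hx; simpa using hx
      | succ m ihm =>
        intro x hx
        rw [pow_succ', Module.End.mul_apply]
        exact hW r List.mem_cons_self _ (ihm x hx)
    have htop : (f r ^ (q - 1)) (g a) ∈ W := by
      have h := hpow (q - 1 - a) _ hxW
      rw [map_sum, Finset.sum_eq_single a] at h
      · rwa [← Module.End.mul_apply, ← pow_add, Nat.sub_add_cancel (by omega)] at h
      · intro b hb hba
        rcases lt_or_gt_of_ne hba with h' | h'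
        · rw [hmin b h', map_zero, map_zero]
        · rw [← Module.End.mul_apply, ← pow_add, pow_eq_zero_of_le _ (hq r), LinearMap.zero_apply]
          omega
      · intro h'
        exact absurd (Finset.mem_range.2 haq) h'
    obtain ⟨y, hy, hy0, hyW⟩ := ih (List.nodup_cons.1 hl).2 (W.comap (f r ^ (q - 1)))
      (by
        intro i hi x hx
        have hri : r ≠ i := fun h => (List.nodup_cons.1 hl).1 (h ▸ hi)
        rw [Submodule.mem_comap, ← Module.End.mul_apply, pow_mul_of_skewComm (hc r i hri)]
        exact Submodule.smul_mem _ _ (hW i (List.mem_cons_of_mem _ hi) _ hx))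
      htop (hg a) ha0
    refine ⟨y, hy, hy0, ?_⟩
    rwa [topWord_cons, wordOp_append, wordOp_replicate]

/-- Every subspace that is stable under `O` and meets `Y` contains `v`. -/
def EveryVectorReaches (O : Set (Module.End k V)) (Y : Submodule k V) (v : V) : Prop :=
  ∀ W : Submodule k V, (∀ o ∈ O, ∀ x ∈ W, o x ∈ W) → ∀ x ∈ W, x ∈ Y → x ≠ 0 → v ∈ W

/-- If the lowering operators `f r` can be undone one at a time by raising operators `e r`, then
the vector `v` is recovered from the product of all top powers applied to it. -/
theorem mem_of_topWord_mem [DecidableEq ι] [LinearOrder ι]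
    (hc : ∀ i j, i ≠ j → f i * f j = ε • (f j * f i)) (hq : ∀ i, f i ^ q = 0)
    {v : V} {e : ι → Module.End k V} (hev : ∀ r, e r v = 0)
    (hef : ∀ r s, r < s → ∃ o : Module.End k V, o v = 0 ∧
      (∀ i, o * f i - f i * o ∈ Submodule.span k (f '' {j | i < j})) ∧
      e r * f s = ε • (f s * e r) + o)
    (Wt : V → Prop) (hWt : Wt v) (hfWt : ∀ i x, Wt x → Wt (f i x))
    (hret : ∀ r x, Wt x → e r x = 0 → ∀ W : Submodule k V, (∀ y ∈ W, e r y ∈ W) →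
      (f r ^ (q - 1)) x ∈ W → x ∈ W)
    {l : List ι} (hl : IsUpperList l)
    (W : Submodule k V) (hW : ∀ r, ∀ y ∈ W, e r y ∈ W)
    (h : wordOp f (topWord q l) v ∈ W) : v ∈ W := by
  have wt : ∀ w : List ι, Wt (wordOp f w v) := by
    intro w
    induction w with
    | nil => simpa using hWt
    | cons s w ih =>
      rw [wordOp_cons]
      exact hfWt s _ ih
  -- raising operators annihilate saturated words with larger letters
  have kill : ∀ (r : ι) (w : List ι), IsSaturated q w → (∀ s ∈ w, r < s) →
      e r (wordOp f w v) = 0 := by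
    intro r w
    induction w with
    | nil => intro _ _; simpa using hev r
    | cons s w ih =>
      intro hw hrs
      obtain ⟨o, hov, hof, ho⟩ := hef r s (hrs s List.mem_cons_self)
      rw [wordOp_cons, Module.End.mul_apply, ← Module.End.mul_apply, ho, LinearMap.add_apply,
        LinearMap.smul_apply, Module.End.mul_apply,
        ih hw.1 fun s hs => hrs s (List.mem_cons_of_mem _ hs), map_zero, smul_zero, zero_add,
        ← Module.End.mul_apply, commute_wordOp_of_isSaturated hc hq hw.1 hof, Module.End.mul_apply,
        hov, map_zero]
  induction l with
  | nil => simpa [topWord] using h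
  | cons r l ih =>
    refine ih hl.of_cons ?_
    rw [topWord_cons, wordOp_append, wordOp_replicate] at h
    refine hret r _ (wt _) (kill r _ (isSaturated_topWord hl.of_cons) fun s hs => ?_) W (hW r) h
    exact List.rel_of_pairwise_cons hl.1 (mem_of_mem_topWord hs)

/-- The passage from a Levi part `O`, acting on `Y`, to the algebra generated by `O`, lowering
operators `f i` and raising operators `e i`. A nonzero vector of a submodule `W` is first lowered to
`F y` with `0 ≠ y ∈ Y` and `F` the product of all `f i ^ (q - 1)`. Since `F` commutes with `O` up to
multiples of `F`, the vectors `y` with `F y ∈ W` form an `O`-submodule of `Y`, so `F v ∈ W`, and the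
raising operators lead back to `v`. -/
theorem EveryVectorReaches.extend [DecidableEq ι] [LinearOrder ι] (hq0 : 0 < q)
    (hc : ∀ i j, i ≠ j → f i * f j = ε • (f j * f i)) (hq : ∀ i, f i ^ q = 0)
    {v : V} {e : ι → Module.End k V} (hev : ∀ r, e r v = 0)
    (hef : ∀ r s, r < s → ∃ o : Module.End k V, o v = 0 ∧
      (∀ i, o * f i - f i * o ∈ Submodule.span k (f '' {j | i < j})) ∧
      e r * f s = ε • (f s * e r) + o)
    (Wt : V → Prop) (hWt : Wt v) (hfWt : ∀ i x, Wt x → Wt (f i x))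
    (hret : ∀ r x, Wt x → e r x = 0 → ∀ W : Submodule k V, (∀ y ∈ W, e r y ∈ W) →
      (f r ^ (q - 1)) x ∈ W → x ∈ W)
    {l : List ι} (hl : IsUpperList l) (hall : ∀ i, i ∈ l)
    {Y : Submodule k V} {O O' : Set (Module.End k V)} (hYO : ∀ o ∈ O, ∀ y ∈ Y, o y ∈ Y)
    (hof : ∀ o ∈ O, ∀ i, o * f i - f i * o ∈ Submodule.span k (Set.range f))
    (hOO' : O ⊆ O') (hfO' : ∀ i, f i ∈ O') (heO' : ∀ i, e i ∈ O')
    (hY : EveryVectorReaches O Y v) : EveryVectorReaches O' (monomialSpan f q Y l) v := by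
  intro W hW x hxW hx hx0
  have hnd : l.Nodup := hl.1.imp ne_of_lt
  obtain ⟨y, hy, hy0, hyW⟩ := exists_topWord_mem hc hq Y hnd W
    (fun i _ => hW _ (hfO' i)) hxW hx hx0
  refine mem_of_topWord_mem hc hq hev hef Wt hWt hfWt hret hl W (fun r => hW _ (heO' r)) ?_
  refine (hY (W.comap (wordOp f (topWord q l)) ⊓ Y) (fun o ho z hz => ⟨?_, hYO o ho z hz.2⟩)
    y ⟨hyW, hy⟩ hy hy0).1
  obtain ⟨c, hc'⟩ := Submodule.mem_span_singleton.1
    (commutator_topWord_mem hq0 hc hq hnd hall (hof o ho))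
  have h1 := congrArg (fun T : Module.End k V => T z) hc'
  simp only [LinearMap.smul_apply, LinearMap.sub_apply, Module.End.mul_apply] at h1
  have h2 : wordOp f (topWord q l) (o z) =
      o (wordOp f (topWord q l) z) - c • wordOp f (topWord q l) z := by
    rw [h1]; abel
  rw [SetLike.mem_coe, Submodule.mem_comap, h2]
  exact sub_mem (hW o (hOO' ho) _ hz.1) (Submodule.smul_mem _ _ hz.1)

/-- The span of the monomials is stable under operators that preserve `Y` and the span of the
`f i`. -/
theorem monomialSpan_stable_of_commutator (hq0 : 0 < q)
    (hc : ∀ i j, i ≠ j → f i * f j = ε • (f j * f i))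
    (hq : ∀ i, f i ^ q = 0) {Y : Submodule k V} {l : List ι} (hall : ∀ i, i ∈ l)
    {o : Module.End k V} (hY : ∀ y ∈ Y, o y ∈ Y)
    (ho : ∀ i, o * f i - f i * o ∈ Submodule.span k (Set.range f)) {x : V}
    (hx : x ∈ monomialSpan f q Y l) : o x ∈ monomialSpan f q Y l := by
  have hspan : ∀ T ∈ Submodule.span k (Set.range f), ∀ x ∈ monomialSpan f q Y l,
      T x ∈ monomialSpan f q Y l := by
    intro T hT x hx
    induction hT using Submodule.span_induction with
    | mem T hT =>
      obtain ⟨i, rfl⟩ := hT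
      exact monomialSpan_stable hc hq Y (hall i) hx
    | zero => exact zero_mem _
    | add T T' _ _ h h' => exact add_mem h h'
    | smul c T _ h => exact Submodule.smul_mem _ _ h
  refine (monomialSpan_le (Q := monomialSpan f q Y l ⊓ (monomialSpan f q Y l).comap o)
    (fun y hy => ⟨le_monomialSpan hq0 Y l hy, le_monomialSpan hq0 Y l (hY y hy)⟩)
    (fun i x hx => ⟨monomialSpan_stable hc hq Y (hall i) hx.1, ?_⟩) l hx).2
  have h1 : o (f i x) = (o * f i - f i * o) x + f i (o x) := by simp
  rw [SetLike.mem_coe, Submodule.mem_comap, h1]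
  exact add_mem (hspan _ (ho i) x hx.1) (monomialSpan_stable hc hq Y (hall i) hx.2)

/-- The span of the monomials is stable under an operator that annihilates `Y` and whose
commutators (up to the scalar) with the `f i` preserve it. -/
theorem monomialSpan_stable_of_annihilates (hq0 : 0 < q)
    (hc : ∀ i j, i ≠ j → f i * f j = ε • (f j * f i))
    (hq : ∀ i, f i ^ q = 0) {Y : Submodule k V} {l : List ι} (hall : ∀ i, i ∈ l)
    {e : Module.End k V} (hY : ∀ y ∈ Y, e y = 0)
    (he : ∀ i, ∀ x ∈ monomialSpan f q Y l, (e * f i - ε • (f i * e)) x ∈ monomialSpan f q Y l)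
    {x : V} (hx : x ∈ monomialSpan f q Y l) : e x ∈ monomialSpan f q Y l := by
  refine (monomialSpan_le (Q := monomialSpan f q Y l ⊓ (monomialSpan f q Y l).comap e)
    (fun y hy => ⟨le_monomialSpan hq0 Y l hy, ?_⟩)
    (fun i x hx => ⟨monomialSpan_stable hc hq Y (hall i) hx.1, ?_⟩) l hx).2
  · rw [SetLike.mem_coe, Submodule.mem_comap, hY y hy]
    exact zero_mem _
  · have h1 : e (f i x) = (e * f i - ε • (f i * e)) x + ε • f i (e x) := by simp
    rw [SetLike.mem_coe, Submodule.mem_comap, h1]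
    exact add_mem (he i x hx.1)
      (Submodule.smul_mem _ _ (monomialSpan_stable hc hq Y (hall i) hx.2))

end Words

/-! ### Representations of the periplectic Lie superalgebra on the standard basis -/

/-- A representation of the periplectic Lie superalgebra on a vector space, as operators depending
linearly on matrices: `even A` is the action of `diag(A, -Aᵀ)`, while `sym B` and `skew C` are the
actions of the odd elements with upper right block `B + Bᵀ` and lower left block `C - Cᵀ`. -/
structure PeriplecticRep (k : Type*) [Field k] (n : ℕ) (V : Type*) [AddCommGroup V]
    [Module k V] where
  even : Matrix (Fin n) (Fin n) k →ₗ[k] Module.End k V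
  sym : Matrix (Fin n) (Fin n) k →ₗ[k] Module.End k V
  skew : Matrix (Fin n) (Fin n) k →ₗ[k] Module.End k V
  skew_transpose : ∀ C, skew C.transpose = -skew C
  even_even : ∀ A A', even A * even A' - even A' * even A = even (A * A' - A' * A)
  even_sym : ∀ A B, even A * sym B - sym B * even A = sym (A * B + B * A.transpose)
  even_skew : ∀ A C, even A * skew C - skew C * even A = -skew (A.transpose * C + C * A)
  sym_sym : ∀ B B', sym B * sym B' + sym B' * sym B = 0
  skew_skew : ∀ C C', skew C * skew C' + skew C' * skew C = 0
  sym_skew : ∀ B C, sym B * skew C + skew C * sym B =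
    even ((B + B.transpose) * (C - C.transpose))

namespace PeriplecticRep

variable {k : Type*} [Field k] {n : ℕ} {V : Type*} [AddCommGroup V] [Module k V]

/-- The representation twisted by the conjugation with `diag(u, u⁻ᵀ)`. -/
def twist (ρ : PeriplecticRep k n V) (u w : Matrix (Fin n) (Fin n) k) (hwu : w * u = 1) :
    PeriplecticRep k n V where
  even := ρ.even ∘ₗ LinearMap.mulLeftRight k (u, w)
  sym := ρ.sym ∘ₗ LinearMap.mulLeftRight k (u, u.transpose)
  skew := ρ.skew ∘ₗ LinearMap.mulLeftRight k (w.transpose, w)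
  skew_transpose C := by
    simp only [LinearMap.comp_apply, LinearMap.mulLeftRight_apply, ← ρ.skew_transpose]
    simp [Matrix.mul_assoc]
  even_even A A' := by
    simp only [LinearMap.comp_apply, LinearMap.mulLeftRight_apply, ρ.even_even]
    congr 1
    have h : ∀ X Y : Matrix (Fin n) (Fin n) k, u * X * w * (u * Y * w) = u * (X * Y) * w := by
      intro X Y
      calc _ = u * X * (w * u) * Y * w := by simp only [Matrix.mul_assoc]
        _ = _ := by rw [hwu]; simp only [Matrix.mul_assoc, Matrix.one_mul]
    rw [h, h, mul_sub, sub_mul]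
  even_sym A B := by
    simp only [LinearMap.comp_apply, LinearMap.mulLeftRight_apply, ρ.even_sym]
    congr 1
    have hwu' : u.transpose * w.transpose = 1 := by
      rw [← Matrix.transpose_mul, hwu, Matrix.transpose_one]
    have h1 : u * A * w * (u * B * u.transpose) = u * (A * B) * u.transpose := by
      calc _ = u * A * (w * u) * B * u.transpose := by simp only [Matrix.mul_assoc]
        _ = _ := by rw [hwu]; simp only [Matrix.mul_assoc, Matrix.one_mul]
    have h2 : u * B * u.transpose * (u * A * w).transpose =
        u * (B * A.transpose) * u.transpose := by
      rw [Matrix.transpose_mul, Matrix.transpose_mul]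
      calc _ = u * B * (u.transpose * w.transpose) * A.transpose * u.transpose := by
            simp only [Matrix.mul_assoc]
        _ = _ := by rw [hwu']; simp only [Matrix.mul_assoc, Matrix.one_mul]
    rw [h1, h2, mul_add, add_mul]
  even_skew A C := by
    simp only [LinearMap.comp_apply, LinearMap.mulLeftRight_apply, ρ.even_skew]
    congr 2
    have hwu' : u.transpose * w.transpose = 1 := by
      rw [← Matrix.transpose_mul, hwu, Matrix.transpose_one]
    have h1 : w.transpose * C * w * (u * A * w) = w.transpose * (C * A) * w := by
      calc _ = w.transpose * C * (w * u) * A * w := by simp only [Matrix.mul_assoc]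
        _ = _ := by rw [hwu]; simp only [Matrix.mul_assoc, Matrix.one_mul]
    have h2 : (u * A * w).transpose * (w.transpose * C * w) =
        w.transpose * (A.transpose * C) * w := by
      rw [Matrix.transpose_mul, Matrix.transpose_mul]
      calc _ = w.transpose * A.transpose * (u.transpose * w.transpose) * C * w := by
            simp only [Matrix.mul_assoc]
        _ = _ := by rw [hwu']; simp only [Matrix.mul_assoc, Matrix.one_mul]
    rw [h1, h2, mul_add, add_mul]
  sym_sym B B' := ρ.sym_sym _ _
  skew_skew C C' := ρ.skew_skew _ _
  sym_skew B C := by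
    simp only [LinearMap.comp_apply, LinearMap.mulLeftRight_apply, ρ.sym_skew]
    congr 1
    have hwu' : u.transpose * w.transpose = 1 := by
      rw [← Matrix.transpose_mul, hwu, Matrix.transpose_one]
    have h1 : u * B * u.transpose + (u * B * u.transpose).transpose =
        u * (B + B.transpose) * u.transpose := by
      simp [Matrix.mul_assoc, mul_add, add_mul]
    have h2 : w.transpose * C * w - (w.transpose * C * w).transpose =
        w.transpose * (C - C.transpose) * w := by
      simp [Matrix.mul_assoc, mul_sub, sub_mul]
    rw [h1, h2]
    calc _ = u * (B + B.transpose) * (u.transpose * w.transpose) * (C - C.transpose) * w := by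
          simp only [Matrix.mul_assoc]
      _ = _ := by rw [hwu']; simp only [Matrix.mul_assoc, Matrix.one_mul]

variable (ρ : PeriplecticRep k n V)

/-- The action of the matrix unit `E_{a,b}` of `gl(n)`. -/
def E (a b : Fin n) : Module.End k V := ρ.even (Matrix.single a b 1)

/-- The action of the odd element with upper right block `E_{a,b} + E_{b,a}`. -/
def S (a b : Fin n) : Module.End k V := ρ.sym (Matrix.single a b 1)

/-- The action of the odd element with lower left block `E_{a,b} - E_{b,a}`. -/
def C (a b : Fin n) : Module.End k V := ρ.skew (Matrix.single a b 1)

theorem single_one_mul_single_one (a b c d : Fin n) :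
    Matrix.single a b (1 : k) * Matrix.single c d 1 =
      if b = c then Matrix.single a d 1 else 0 := by
  split_ifs with h
  · subst h
    rw [Matrix.single_mul_single_same, one_mul]
  · exact Matrix.single_mul_single_of_ne _ _ _ _ h _

theorem E_commutator (a b c d : Fin n) :
    ρ.E a b * ρ.E c d - ρ.E c d * ρ.E a b =
      (if b = c then ρ.E a d else 0) - (if d = a then ρ.E c b else 0) := by
  rw [E, E, ρ.even_even, single_one_mul_single_one, single_one_mul_single_one, map_sub]
  congr 1 <;> split_ifs <;> simp [E]

theorem E_C_commutator (a b c d : Fin n) :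
    ρ.E a b * ρ.C c d - ρ.C c d * ρ.E a b =
      -(if a = c then ρ.C b d else 0) - (if d = a then ρ.C c b else 0) := by
  rw [E, C, ρ.even_skew, Matrix.transpose_single, single_one_mul_single_one,
    single_one_mul_single_one, map_add, neg_add, sub_eq_add_neg]
  congr 2 <;> split_ifs <;> simp [C]

theorem E_S_commutator (a b c d : Fin n) :
    ρ.E a b * ρ.S c d - ρ.S c d * ρ.E a b =
      (if b = c then ρ.S a d else 0) + (if d = b then ρ.S c a else 0) := by
  rw [E, S, ρ.even_sym, Matrix.transpose_single, single_one_mul_single_one,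
    single_one_mul_single_one, map_add]
  congr 1 <;> split_ifs <;> simp [S]

theorem S_C_anticommutator (a b c d : Fin n) :
    ρ.S a b * ρ.C c d + ρ.C c d * ρ.S a b =
      ((if b = c then ρ.E a d else 0) - (if b = d then ρ.E a c else 0)) +
      ((if a = c then ρ.E b d else 0) - (if a = d then ρ.E b c else 0)) := by
  rw [S, C, ρ.sym_skew, Matrix.transpose_single, Matrix.transpose_single, add_mul, mul_sub, mul_sub,
    single_one_mul_single_one, single_one_mul_single_one, single_one_mul_single_one,
    single_one_mul_single_one, map_add, map_sub, map_sub]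
  congr 2 <;> split_ifs <;> simp [E]

theorem C_swap (a b : Fin n) : ρ.C b a = -ρ.C a b := by
  rw [C, C, ← ρ.skew_transpose, Matrix.transpose_single]

theorem even_eq_sum (A : Matrix (Fin n) (Fin n) k) :
    ρ.even A = ∑ a, ∑ b, A a b • ρ.E a b := by
  conv_lhs => rw [Matrix.matrix_eq_sum_single A]
  simp only [map_sum]
  refine Finset.sum_congr rfl fun a _ => Finset.sum_congr rfl fun b _ => ?_
  rw [E, ← map_smul, Matrix.smul_single, smul_eq_mul, mul_one]

theorem sym_eq_sum (A : Matrix (Fin n) (Fin n) k) :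
    ρ.sym A = ∑ a, ∑ b, A a b • ρ.S a b := by
  conv_lhs => rw [Matrix.matrix_eq_sum_single A]
  simp only [map_sum]
  refine Finset.sum_congr rfl fun a _ => Finset.sum_congr rfl fun b _ => ?_
  rw [S, ← map_smul, Matrix.smul_single, smul_eq_mul, mul_one]

theorem skew_eq_sum (A : Matrix (Fin n) (Fin n) k) :
    ρ.skew A = ∑ a, ∑ b, A a b • ρ.C a b := by
  conv_lhs => rw [Matrix.matrix_eq_sum_single A]
  simp only [map_sum]
  refine Finset.sum_congr rfl fun a _ => Finset.sum_congr rfl fun b _ => ?_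
  rw [C, ← map_smul, Matrix.smul_single, smul_eq_mul, mul_one]

/-- In an `sl₂`-triple, `e f^{m+1} x = (m+1)(c-m) f^m x` if `e x = 0` and `h x = c x`. -/
theorem raise_pow_lower {e f h : Module.End k V} (hef : e * f - f * e = h)
    (hhf : h * f - f * h = -(2 : k) • f) {x : V} {c : k} (hx : e x = 0) (hc : h x = c • x) (m : ℕ) :
    e ((f ^ (m + 1)) x) = (((m : k) + 1) * (c - m)) • (f ^ m) x := by
  have hw : ∀ m : ℕ, h ((f ^ m) x) = (c - 2 * m) • (f ^ m) x := by
    intro m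
    induction m with
    | zero => simp [hc]
    | succ m ih =>
      have h1 : h (f ((f ^ m) x)) = f (h ((f ^ m) x)) - (2 : k) • f ((f ^ m) x) := by
        have := congrArg (fun T : Module.End k V => T ((f ^ m) x)) hhf
        simp only [LinearMap.sub_apply, Module.End.mul_apply, LinearMap.smul_apply, neg_smul,
          LinearMap.neg_apply] at this
        rw [sub_eq_iff_eq_add.1 this]; abel
      rw [pow_succ', Module.End.mul_apply, h1, ih, map_smul, ← sub_smul]
      push_cast
      congr 1
      ring
  have hstep : ∀ y, e (f y) = f (e y) + h y := by
    intro y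
    rw [← hef]; simp
  induction m with
  | zero => simp [hstep, hx, hc]
  | succ m ih =>
    rw [pow_succ', Module.End.mul_apply, hstep, ih, map_smul, hw, ← Module.End.mul_apply, ← pow_succ',
      ← add_smul]
    push_cast
    congr 1
    ring

/-- The `sl₂`-argument: if the scalars `(j + 1) (c - j)` do not vanish, a vector `x` killed by `e`
is recovered from `f ^ m x` by applying `e`. -/
theorem mem_of_pow_lower_mem {e f h : Module.End k V} (hef : e * f - f * e = h)
    (hhf : h * f - f * h = -(2 : k) • f) {x : V} {c : k} (hx : e x = 0) (hc : h x = c • x)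
    {W : Submodule k V} (hW : ∀ y ∈ W, e y ∈ W) {m : ℕ}
    (hm : ∀ j < m, ((j : k) + 1) * (c - j) ≠ 0) (h' : (f ^ m) x ∈ W) : x ∈ W := by
  induction m with
  | zero => simpa using h'
  | succ m ih =>
    refine ih (fun j hj => hm j (hj.trans (Nat.lt_succ_self m))) ?_
    have h1 := hW _ h'
    rw [raise_pow_lower hef hhf hx hc] at h1
    exact (Submodule.smul_mem_iff _ (hm m (Nat.lt_succ_self m))).1 h1

end PeriplecticRep

/-! ### Highest weight vectors and irreducibility -/

namespace PeriplecticRep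

variable {k : Type*} [Field k] {n : ℕ} {V : Type*} [AddCommGroup V] [Module k V]
variable (ρ : PeriplecticRep k n V)

/-- The vector `v` is annihilated by all strictly upper triangular matrices and by the odd elements
with vanishing lower left block, and it has weight `μ`. -/
structure IsHighestWeight (v : V) (μ : Fin n → k) : Prop where
  raise : ∀ a b, a < b → ρ.E a b v = 0
  weight : ∀ a, ρ.E a a v = μ a • v
  sym : ∀ B, ρ.sym B v = 0

/-- The matrix units spanning `gl(m) + h`, where `gl(m)` is the upper left block. -/
def leviOps (m : ℕ) : Set (Module.End k V) :=
  {o | ∃ a b : Fin n, (a = b ∨ (a.1 < m ∧ b.1 < m)) ∧ o = ρ.E a b}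

/-- The vector `x` is a weight vector whose weight differs from `μ` by integers. -/
def IsShiftedWeight (μ : Fin n → k) (x : V) : Prop :=
  ∀ a, ∃ z : ℤ, ρ.E a a x = (μ a + z) • x

variable {ρ}

theorem IsHighestWeight.isShiftedWeight {v : V} {μ : Fin n → k} (hv : ρ.IsHighestWeight v μ) :
    ρ.IsShiftedWeight μ v := fun a => ⟨0, by simp [hv.weight]⟩

theorem IsShiftedWeight.apply {μ : Fin n → k} {x : V} (hx : ρ.IsShiftedWeight μ x)
    {T : Module.End k V} (hT : ∀ a, ∃ z : ℤ, ρ.E a a * T - T * ρ.E a a = (z : k) • T) :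
    ρ.IsShiftedWeight μ (T x) := by
  intro a
  obtain ⟨z, hz⟩ := hx a
  obtain ⟨z', hz'⟩ := hT a
  refine ⟨z + z', ?_⟩
  have h1 : ρ.E a a (T x) = (ρ.E a a * T - T * ρ.E a a) x + T (ρ.E a a x) := by simp
  rw [h1, hz', hz, map_smul, LinearMap.smul_apply, ← add_smul]
  push_cast
  congr 1
  ring

/-- A `gl(m)`-submodule `Y` generated by `v`, annihilated by all `E_{a,b}` with `a < b`, `m ≤ b`,
in which every nonzero vector generates `v`. By induction on `m`: the new `Y` is spanned by the
truncated monomials in the lowering operators `E_{t,j}`, `j < t`, where `t` is the last index of the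
larger block, applied to the old one. -/
theorem exists_levi_submodule {p : ℕ} [Fact p.Prime] [CharP k p] {v : V} {μ : Fin n → k}
    (hv : ρ.IsHighestWeight v μ) (hnil : ∀ a b, a ≠ b → ρ.E a b ^ p = 0)
    (hμ : ∀ a b, a ≠ b → ∀ z : ℤ, μ a - μ b + z ≠ 0) (m : ℕ) (hm : m ≤ n) :
    ∃ Y : Submodule k V, v ∈ Y ∧
      (∀ Q : Submodule k V, v ∈ Q → (∀ a b, ∀ x ∈ Q, ρ.E a b x ∈ Q) → Y ≤ Q) ∧
      (∀ o ∈ ρ.leviOps m, ∀ y ∈ Y, o y ∈ Y) ∧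
      (∀ a b : Fin n, a < b → m ≤ b.1 → ∀ y ∈ Y, ρ.E a b y = 0) ∧
      EveryVectorReaches (ρ.leviOps m) Y v := by
  have hp : p.Prime := Fact.out
  induction m with
  | zero =>
    refine ⟨Submodule.span k {v}, Submodule.mem_span_singleton_self v, ?_, ?_, ?_, ?_⟩
    · intro Q hv _
      exact (Submodule.span_singleton_le_iff_mem _ _).2 hv
    · rintro _ ⟨a, b, h | h, rfl⟩ y hy
      · subst h
        obtain ⟨c, rfl⟩ := Submodule.mem_span_singleton.1 hy
        rw [map_smul, hv.weight]
        exact Submodule.smul_mem _ _ (Submodule.smul_mem _ _ (Submodule.mem_span_singleton_self v))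
      · omega
    · intro a b hab _ y hy
      obtain ⟨c, rfl⟩ := Submodule.mem_span_singleton.1 hy
      rw [map_smul, hv.raise a b hab, smul_zero]
    · intro W _ x hxW hx hx0
      obtain ⟨c, rfl⟩ := Submodule.mem_span_singleton.1 hx
      exact (Submodule.smul_mem_iff _ (left_ne_zero_of_smul hx0)).1 hxW
  | succ m ih =>
    obtain ⟨Y, hvY, hgen, hst, hkill, hreach⟩ := ih (by omega)
    let t : Fin n := ⟨m, by omega⟩
    let f : {j : Fin n // j < t} → Module.End k V := fun j => ρ.E t j.1
    let e : {j : Fin n // j < t} → Module.End k V := fun j => ρ.E j.1 t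
    let l : List {j : Fin n // j < t} := Finset.univ.sort (· ≤ ·)
    have hl : IsUpperList l := ⟨(Finset.sortedLT_sort _).pairwise, fun _ _ j _ => by simp [l]⟩
    have hall : ∀ i, i ∈ l := fun i => by simp [l]
    have hc : ∀ i j, i ≠ j → f i * f j = (1 : k) • (f j * f i) := by
      intro i j _
      have := ρ.E_commutator t i.1 t j.1
      rw [if_neg i.2.ne, if_neg j.2.ne, sub_zero, sub_eq_zero] at this
      rw [one_smul]
      exact this
    have hq : ∀ i, f i ^ p = 0 := fun i => hnil _ _ i.2.ne'
    have hfmem : ∀ i, f i ∈ ρ.leviOps (m + 1) := fun i =>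
      ⟨t, i.1, Or.inr ⟨Nat.lt_succ_self m, Nat.lt_succ_of_lt (Fin.lt_def.1 i.2)⟩, rfl⟩
    have hemem : ∀ i, e i ∈ ρ.leviOps (m + 1) := fun i =>
      ⟨i.1, t, Or.inr ⟨Nat.lt_succ_of_lt (Fin.lt_def.1 i.2), Nat.lt_succ_self m⟩, rfl⟩
    have hOO : ρ.leviOps m ⊆ ρ.leviOps (m + 1) := by
      rintro _ ⟨a, b, h | h, rfl⟩
      · exact ⟨a, b, Or.inl h, rfl⟩
      · exact ⟨a, b, Or.inr ⟨by omega, by omega⟩, rfl⟩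
    have hof : ∀ o ∈ ρ.leviOps m, ∀ i, o * f i - f i * o ∈ Submodule.span k (Set.range f) := by
      rintro _ ⟨a, b, hab, rfl⟩ i
      have hlow : ∀ b : Fin n, b < t → ρ.E t b ∈ Submodule.span k (Set.range f) := fun b hb =>
        Submodule.subset_span ⟨⟨b, hb⟩, rfl⟩
      rw [ρ.E_commutator]
      refine sub_mem ?_ ?_
      · split_ifs with h
        · rcases hab with hab | hab
          · rw [hab, h]
            exact hlow _ i.2
          · rw [h] at hab
            exact absurd hab.2 (lt_irrefl m)
        · exact zero_mem _
      · split_ifs with h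
        · refine hlow _ ?_
          rcases hab with hab | hab
          · rw [← hab, ← h]
            exact i.2
          · exact Fin.lt_def.2 hab.2
        · exact zero_mem _
    have hev : ∀ r, e r v = 0 := fun r => hv.raise _ _ r.2
    have hef : ∀ r s, r < s → ∃ o : Module.End k V, o v = 0 ∧
        (∀ i, o * f i - f i * o ∈ Submodule.span k (f '' {j | i < j})) ∧
        e r * f s = (1 : k) • (f s * e r) + o := by
      intro r s hrs
      refine ⟨ρ.E r.1 s.1, hv.raise _ _ hrs, fun i => ?_, ?_⟩
      · rw [ρ.E_commutator, if_neg s.2.ne, zero_sub]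
        split_ifs with h
        · refine neg_mem (Submodule.subset_span ⟨s, ?_, rfl⟩)
          rw [Set.mem_ofPred_eq, Subtype.ext h]
          exact hrs
        · simp
      · have := ρ.E_commutator r.1 t t s.1
        rw [if_pos rfl, if_neg (fun h => hrs.ne' (Subtype.ext h)), sub_zero] at this
        rw [one_smul, ← this]
        simp only [e, f]
        abel
    have hfWt : ∀ i x, ρ.IsShiftedWeight μ x → ρ.IsShiftedWeight μ (f i x) := by
      intro i x hx
      refine hx.apply fun a => ?_
      refine ⟨(if a = t then 1 else 0) - (if i.1 = a then 1 else 0), ?_⟩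
      rw [ρ.E_commutator]
      have h1 : (if a = t then ρ.E a i.1 else 0) = if a = t then f i else 0 := by
        split_ifs with h
        · rw [h]
        · rfl
      have h2 : (if i.1 = a then ρ.E t a else 0) = if i.1 = a then f i else 0 := by
        split_ifs with h
        · rw [← h]
        · rfl
      change (if a = t then ρ.E a i.1 else 0) - (if i.1 = a then ρ.E t a else 0) = _
      rw [h1, h2]
      split_ifs <;> simp
    -- `E_{r,t}`, `E_{t,r}` and `E_{r,r} - E_{t,t}` form an `sl₂`-triple, and the weight of `x` on the
    -- last one is not an integer
    have hret : ∀ r x, ρ.IsShiftedWeight μ x → e r x = 0 → ∀ W : Submodule k V,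
        (∀ y ∈ W, e r y ∈ W) → (f r ^ (p - 1)) x ∈ W → x ∈ W := by
      intro r x hx hex W hW hmem
      obtain ⟨z, hz⟩ := hx r.1
      obtain ⟨z', hz'⟩ := hx t
      have h1 : e r * f r - f r * e r = ρ.E r.1 r.1 - ρ.E t t := by
        have := ρ.E_commutator r.1 t t r.1
        rwa [if_pos rfl, if_pos rfl] at this
      refine mem_of_pow_lower_mem (c := μ r.1 - μ t + ((z - z' : ℤ) : k)) h1 ?_ hex ?_ hW ?_ hmem
      · have h2 := ρ.E_commutator r.1 r.1 t r.1
        have h3 := ρ.E_commutator t t t r.1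
        rw [if_neg r.2.ne, if_pos rfl] at h2
        rw [if_pos rfl, if_neg r.2.ne] at h3
        have : (ρ.E r.1 r.1 - ρ.E t t) * f r - f r * (ρ.E r.1 r.1 - ρ.E t t) =
            (ρ.E r.1 r.1 * ρ.E t r.1 - ρ.E t r.1 * ρ.E r.1 r.1) -
            (ρ.E t t * ρ.E t r.1 - ρ.E t r.1 * ρ.E t t) := by
          simp only [f]; noncomm_ring
        rw [this, h2, h3]
        simp only [f]
        rw [neg_smul, two_smul]
        abel
      · rw [LinearMap.sub_apply, hz, hz', ← sub_smul]
        push_cast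
        congr 1
        ring
      · intro j hj
        refine mul_ne_zero ?_ ?_
        · have := (CharP.cast_eq_zero_iff k p (j + 1)).not.2
            (Nat.not_dvd_of_pos_of_lt (Nat.succ_pos j) (by have := hp.pos; omega))
          simpa using this
        · have := hμ r.1 t r.2.ne (z - z' - j)
          intro h
          apply this
          rw [← h]
          push_cast
          ring
    have hY0 : ∀ i, ∀ y ∈ Y, e i y = 0 := fun i y hy => hkill _ _ i.2 le_rfl y hy
    have hstable : ∀ o ∈ ρ.leviOps m, ∀ x ∈ monomialSpan f p Y l, o x ∈ monomialSpan f p Y l :=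
      fun o ho x hx => monomialSpan_stable_of_commutator hp.pos hc hq hall (hst o ho) (hof o ho) hx
    refine ⟨monomialSpan f p Y l, le_monomialSpan hp.pos Y l hvY, ?_, ?_, ?_, ?_⟩
    · intro Q hvQ hQ
      exact monomialSpan_le (hgen Q hvQ hQ) (fun i x hx => hQ _ _ x hx) l
    · have hraise : ∀ i, ∀ x ∈ monomialSpan f p Y l, e i x ∈ monomialSpan f p Y l := by
        intro i x hx
        refine monomialSpan_stable_of_annihilates hp.pos hc hq hall (hY0 i) (fun s x hx => ?_) hx
        have := ρ.E_commutator i.1 t t s.1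
        rw [if_pos rfl] at this
        rw [one_smul]
        change (ρ.E i.1 t * ρ.E t s.1 - ρ.E t s.1 * ρ.E i.1 t) x ∈ _
        rw [this, LinearMap.sub_apply]
        refine sub_mem (hstable _ ⟨_, _, Or.inr ⟨i.2, s.2⟩, rfl⟩ x hx) ?_
        split_ifs
        · exact hstable _ ⟨_, _, Or.inl rfl, rfl⟩ x hx
        · simp
      rintro _ ⟨a, b, hab, rfl⟩ x hx
      by_cases h : a = b ∨ (a.1 < m ∧ b.1 < m)
      · exact hstable _ ⟨a, b, h, rfl⟩ x hx
      · push Not at h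
        have hab' := hab.resolve_left h.1
        rcases Nat.lt_or_ge a.1 m with ha | ha
        · have hb : b = t := Fin.ext (by have := h.2 ha; simp only [t]; omega)
          rw [hb]
          exact hraise ⟨a, ha⟩ x hx
        · have ha' : a = t := Fin.ext (by simp only [t]; omega)
          have hb : b < t := by
            refine Fin.lt_def.2 ?_
            have : b.1 ≠ a.1 := fun h' => h.1 (Fin.ext h'.symm)
            simp only [t]
            omega
          rw [ha']
          exact monomialSpan_stable hc hq Y (hall ⟨b, hb⟩) hx
    · have := monomialSpan_le (f := f) (q := p)
        (Q := ⨅ a : Fin n, ⨅ b : Fin n, ⨅ _ : a < b ∧ m + 1 ≤ b.1, LinearMap.ker (ρ.E a b)) (Y := Y)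
        (by
          intro y hy
          simp only [Submodule.mem_iInf, LinearMap.mem_ker]
          intro a b hab
          exact hkill a b hab.1 (by omega) y hy)
        (by
          intro i x hx
          simp only [Submodule.mem_iInf, LinearMap.mem_ker] at hx ⊢
          intro a b hab
          have h1 := congrArg (fun T : Module.End k V => T x) (ρ.E_commutator a b t i.1)
          have hbt : b ≠ t := fun h => by rw [h] at hab; simp only [t] at hab; omega
          simp only [if_neg hbt, LinearMap.sub_apply, Module.End.mul_apply, hx a b hab, map_zero,
            sub_zero, zero_sub] at h1
          change ρ.E a b (ρ.E t i.1 x) = 0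
          rw [h1]
          split_ifs
          · rw [LinearMap.neg_apply, hx t b ⟨Fin.lt_def.2 (by simp only [t]; omega), hab.2⟩, neg_zero]
          · simp) l
      intro a b hab hmb y hy
      have := this hy
      simp only [Submodule.mem_iInf, LinearMap.mem_ker] at this
      exact this a b ⟨hab, hmb⟩
    · exact hreach.extend hp.pos hc hq hev hef (ρ.IsShiftedWeight μ) hv.isShiftedWeight hfWt hret hl
        hall hst hof hOO hfmem hemem

/-- By antisymmetry, `C a b` lies in the span of those basis vectors `C c d`, `c < d`, to which it is
proportional. -/
theorem C_mem_span (ρ : PeriplecticRep k n V) (h2 : (2 : k) ≠ 0)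
    (P : {x : Fin n ×ₗ Fin n // (ofLex x).1 < (ofLex x).2} → Prop) (a b : Fin n)
    (hab : ∀ h : a < b, P ⟨toLex (a, b), h⟩) (hba : ∀ h : b < a, P ⟨toLex (b, a), h⟩) :
    ρ.C a b ∈ Submodule.span k
      ((fun i : {x : Fin n ×ₗ Fin n // (ofLex x).1 < (ofLex x).2} =>
        ρ.C (ofLex i.1).1 (ofLex i.1).2) '' {j | P j}) := by
  rcases lt_trichotomy a b with h | h | h
  · exact Submodule.subset_span ⟨⟨toLex (a, b), h⟩, hab h, rfl⟩
  · subst h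
    have h1 : (2 : k) • ρ.C a a = 0 := by
      rw [two_smul]
      nth_rewrite 1 [ρ.C_swap a a]
      exact neg_add_cancel _
    rw [(smul_eq_zero.1 h1).resolve_left h2]
    exact zero_mem _
  · rw [ρ.C_swap b a]
    exact neg_mem (Submodule.subset_span ⟨⟨toLex (b, a), h⟩, hba h, rfl⟩)

/-- A highest weight module of generic weight on which the root vectors `E_{a,b}` act nilpotently
is irreducible: the odd operators `C a b` lower and the `S a b` raise, starting from the
`gl(n)`-submodule generated by `v`. -/
theorem eq_top_of_isHighestWeight {p : ℕ} [Fact p.Prime] [CharP k p] (h2 : (2 : k) ≠ 0) {v : V}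
    {μ : Fin n → k} (hv : ρ.IsHighestWeight v μ) (hnil : ∀ a b, a ≠ b → ρ.E a b ^ p = 0)
    (hμ : ∀ a b, a ≠ b → ∀ z : ℤ, μ a - μ b + z ≠ 0)
    (hgen : ∀ Q : Submodule k V, v ∈ Q → (∀ A, ∀ x ∈ Q, ρ.even A x ∈ Q) →
      (∀ A, ∀ x ∈ Q, ρ.sym A x ∈ Q) → (∀ A, ∀ x ∈ Q, ρ.skew A x ∈ Q) → Q = ⊤)
    (W : Submodule k V) (hW0 : W ≠ ⊥) (hWE : ∀ A, ∀ x ∈ W, ρ.even A x ∈ W)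
    (hWS : ∀ A, ∀ x ∈ W, ρ.sym A x ∈ W) (hWC : ∀ A, ∀ x ∈ W, ρ.skew A x ∈ W) : W = ⊤ := by
  refine hgen W ?_ hWE hWS hWC
  obtain ⟨Y, hvY, hYgen, hst, -, hreach⟩ := exists_levi_submodule hv hnil hμ n le_rfl
  have hstE : ∀ a b, ∀ y ∈ Y, ρ.E a b y ∈ Y := fun a b =>
    hst _ ⟨a, b, Or.inr ⟨a.2, b.2⟩, rfl⟩
  have hYS : ∀ a b, ∀ y ∈ Y, ρ.S a b y = 0 := by
    have h1 : Y ≤ ⨅ a : Fin n, ⨅ b : Fin n, LinearMap.ker (ρ.S a b) := by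
      refine hYgen _ ?_ ?_
      · simp only [Submodule.mem_iInf, LinearMap.mem_ker]
        exact fun a b => hv.sym _
      · intro a b x hx
        simp only [Submodule.mem_iInf, LinearMap.mem_ker] at hx ⊢
        intro c d
        have h1 := congrArg (fun T : Module.End k V => T x) (ρ.E_S_commutator a b c d)
        simp only [LinearMap.sub_apply, Module.End.mul_apply, hx c d, map_zero, zero_sub] at h1
        rw [neg_eq_iff_eq_neg.1 h1]
        split_ifs <;> simp [hx]
    intro a b y hy
    have h2 := h1 hy
    simp only [Submodule.mem_iInf, LinearMap.mem_ker] at h2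
    exact h2 a b
  let ι := {x : Fin n ×ₗ Fin n // (ofLex x).1 < (ofLex x).2}
  let f : ι → Module.End k V := fun i => ρ.C (ofLex i.1).1 (ofLex i.1).2
  let e : ι → Module.End k V := fun i => ρ.S (ofLex i.1).1 (ofLex i.1).2
  let l : List ι := Finset.univ.sort (· ≤ ·)
  have hl : IsUpperList l := ⟨(Finset.sortedLT_sort _).pairwise, fun _ _ j _ => by simp [l]⟩
  have hall : ∀ i, i ∈ l := fun i => by simp [l]
  have hcc : ∀ i j, f i * f j = (-1 : k) • (f j * f i) := by
    intro i j
    rw [neg_one_smul]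
    exact eq_neg_of_add_eq_zero_left (ρ.skew_skew _ _)
  have hc : ∀ i j, i ≠ j → f i * f j = (-1 : k) • (f j * f i) := fun i j _ => hcc i j
  have hq : ∀ i, f i ^ 2 = 0 := by
    intro i
    have h1 : (2 : k) • f i ^ 2 = 0 := by
      rw [two_smul, pow_two]
      exact ρ.skew_skew _ _
    exact (smul_eq_zero.1 h1).resolve_left h2
  have hCf : ∀ a b, ρ.C a b ∈ Submodule.span k (Set.range f) := by
    intro a b
    rw [← Set.image_univ]
    exact C_mem_span ρ h2 (fun _ => True) a b (fun _ => trivial) (fun _ => trivial)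
  have hof : ∀ o ∈ ρ.leviOps n, ∀ i, o * f i - f i * o ∈ Submodule.span k (Set.range f) := by
    rintro _ ⟨a, b, -, rfl⟩ i
    rw [ρ.E_C_commutator]
    refine sub_mem (neg_mem ?_) ?_
    · split_ifs
      · exact hCf _ _
      · exact zero_mem _
    · split_ifs
      · exact hCf _ _
      · exact zero_mem _
  have hef : ∀ r s, r < s → ∃ o : Module.End k V, o v = 0 ∧
      (∀ i, o * f i - f i * o ∈ Submodule.span k (f '' {j | i < j})) ∧
      e r * f s = (-1 : k) • (f s * e r) + o := by
    let P : Module.End k V → Prop := fun o => o v = 0 ∧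
      ∀ i, o * f i - f i * o ∈ Submodule.span k (f '' {j | i < j})
    have hP0 : P 0 := ⟨rfl, fun i => by simp⟩
    have hPadd : ∀ o o', P o → P o' → P (o + o') := fun o o' h h' =>
      ⟨by rw [LinearMap.add_apply, h.1, h'.1, add_zero], fun i => by
        rw [add_mul, mul_add, add_sub_add_comm]
        exact add_mem (h.2 i) (h'.2 i)⟩
    have hPsub : ∀ o o', P o → P o' → P (o - o') := fun o o' h h' =>
      ⟨by rw [LinearMap.sub_apply, h.1, h'.1, sub_zero], fun i => by
        rw [sub_mul, mul_sub, sub_sub_sub_comm]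
        exact sub_mem (h.2 i) (h'.2 i)⟩
    -- raising a letter of `C i j` gives a larger element in the lexicographic order
    have hPE : ∀ a b, a < b → P (ρ.E a b) := by
      refine fun a b hab => ⟨hv.raise a b hab, ?_⟩
      rintro ⟨i, hi⟩
      obtain ⟨⟨c, d⟩, rfl⟩ := toLex.surjective i
      change c < d at hi
      change ρ.E a b * ρ.C c d - ρ.C c d * ρ.E a b ∈ _
      rw [ρ.E_C_commutator]
      refine sub_mem (neg_mem ?_) ?_
      · split_ifs with h
        · refine C_mem_span ρ h2 _ _ _ (fun h' => ?_) (fun h' => ?_)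
          · exact Subtype.mk_lt_mk.2 (Prod.Lex.toLex_lt_toLex.2 (Or.inl (h ▸ hab)))
          · exact Subtype.mk_lt_mk.2 (Prod.Lex.toLex_lt_toLex.2 (Or.inl hi))
        · exact zero_mem _
      · split_ifs with h
        · refine C_mem_span ρ h2 _ _ _ (fun h' => ?_) (fun h' => ?_)
          · exact Subtype.mk_lt_mk.2 (Prod.Lex.toLex_lt_toLex.2 (Or.inr ⟨rfl, h ▸ hab⟩))
          · exact absurd (hi.trans (h ▸ hab)) h'.asymm
        · exact zero_mem _
    have hPite : ∀ (q : Prop) [Decidable q] (a b : Fin n), (q → a < b) →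
        P (if q then ρ.E a b else 0) := by
      intro q _ a b h
      split_ifs with hq'
      · exact hPE a b (h hq')
      · exact hP0
    rintro ⟨r, hr⟩ ⟨s, hs⟩ hrs
    obtain ⟨⟨a, b⟩, rfl⟩ := toLex.surjective r
    obtain ⟨⟨c, d⟩, rfl⟩ := toLex.surjective s
    change a < b at hr
    change c < d at hs
    have hlt : a < c ∨ a = c ∧ b < d := Prod.Lex.toLex_lt_toLex.1 hrs
    refine ⟨ρ.S a b * ρ.C c d + ρ.C c d * ρ.S a b, ?_⟩
    rw [← and_assoc]
    refine ⟨?_, ?_⟩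
    · rw [ρ.S_C_anticommutator]
      refine hPadd _ _ (hPsub _ _ (hPite _ _ _ fun h => ?_) (hPite _ _ _ fun h => ?_))
        (hPsub _ _ (hPite _ _ _ fun h => ?_) (hPite _ _ _ fun h => ?_)) <;> omega
    · change ρ.S a b * ρ.C c d = (-1 : k) • (ρ.C c d * ρ.S a b) + _
      rw [neg_one_smul]
      abel
  have hfWt : ∀ i x, ρ.IsShiftedWeight μ x → ρ.IsShiftedWeight μ (f i x) := by
    rintro ⟨i, hi⟩ x hx
    refine hx.apply fun a => ?_
    obtain ⟨⟨c, d⟩, rfl⟩ := toLex.surjective i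
    refine ⟨-(if a = c then 1 else 0) - (if d = a then 1 else 0), ?_⟩
    have h1 : (if a = c then ρ.C a d else 0) = if a = c then ρ.C c d else 0 := by
      split_ifs with h
      · rw [h]
      · rfl
    have h2 : (if d = a then ρ.C c a else 0) = if d = a then ρ.C c d else 0 := by
      split_ifs with h
      · rw [← h]
      · rfl
    change ρ.E a a * ρ.C c d - ρ.C c d * ρ.E a a = _ • ρ.C c d
    rw [ρ.E_C_commutator, h1, h2]
    split_ifs with h3 h4
    · exact absurd (h3.symm.trans h4.symm) hi.ne
    all_goals simp
  -- the anticommutator of `S a b` and `C a b` is `E_{b,b} - E_{a,a}` up to sign, which acts on `x`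
  -- by a nonzero scalar
  have hret : ∀ r x, ρ.IsShiftedWeight μ x → e r x = 0 → ∀ W : Submodule k V,
      (∀ y ∈ W, e r y ∈ W) → (f r ^ (2 - 1)) x ∈ W → x ∈ W := by
    rintro ⟨r, hr⟩ x hx hex W hW hmem
    obtain ⟨⟨a, b⟩, rfl⟩ := toLex.surjective r
    change a < b at hr
    change ρ.S a b x = 0 at hex
    obtain ⟨z, hz⟩ := hx a
    obtain ⟨z', hz'⟩ := hx b
    have h1 := congrArg (fun T : Module.End k V => T x) (ρ.S_C_anticommutator a b a b)
    rw [if_neg hr.ne', if_pos (rfl : b = b), if_pos (rfl : a = a), if_neg hr.ne] at h1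
    simp only [LinearMap.add_apply, LinearMap.neg_apply,
      Module.End.mul_apply, hex, map_zero, add_zero, sub_zero, zero_sub, hz, hz',
      ← neg_smul, ← add_smul] at h1
    have h3 : ρ.S a b (ρ.C a b x) ∈ W := hW _ (by simpa [f] using hmem)
    rw [h1] at h3
    refine (Submodule.smul_mem_iff _ ?_).1 h3
    have := hμ b a hr.ne' (z' - z)
    intro h
    apply this
    rw [← h]
    push_cast
    ring
  have hEX : ∀ a b, ∀ x ∈ monomialSpan f 2 Y l, ρ.E a b x ∈ monomialSpan f 2 Y l :=
    fun a b x hx => monomialSpan_stable_of_commutator two_pos hc hq hall (hstE a b)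
      (hof _ ⟨a, b, Or.inr ⟨a.2, b.2⟩, rfl⟩) hx
  have hite : ∀ (q : Prop) [Decidable q] (a b : Fin n), ∀ x ∈ monomialSpan f 2 Y l,
      (if q then ρ.E a b else 0) x ∈ monomialSpan f 2 Y l := by
    intro q _ a b x hx
    split_ifs
    · exact hEX a b x hx
    · exact zero_mem _
  have hSX : ∀ a b, ∀ x ∈ monomialSpan f 2 Y l, ρ.S a b x ∈ monomialSpan f 2 Y l := by
    intro a b x hx
    refine monomialSpan_stable_of_annihilates two_pos hc hq hall (hYS a b) (fun i x hx => ?_) hx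
    rw [neg_one_smul, sub_neg_eq_add]
    change (ρ.S a b * ρ.C _ _ + ρ.C _ _ * ρ.S a b) x ∈ _
    rw [ρ.S_C_anticommutator]
    exact add_mem (sub_mem (hite _ _ _ x hx) (hite _ _ _ x hx))
      (sub_mem (hite _ _ _ x hx) (hite _ _ _ x hx))
  have hCX : ∀ a b, ∀ x ∈ monomialSpan f 2 Y l, ρ.C a b x ∈ monomialSpan f 2 Y l := by
    intro a b x hx
    have hspan : ∀ T ∈ Submodule.span k (Set.range f), T x ∈ monomialSpan f 2 Y l := by
      intro T hT
      induction hT using Submodule.span_induction with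
      | mem T hT =>
        obtain ⟨i, rfl⟩ := hT
        exact monomialSpan_stable hc hq Y (hall i) hx
      | zero => exact zero_mem _
      | add T T' _ _ h h' => exact add_mem h h'
      | smul c T _ h => exact Submodule.smul_mem _ _ h
    exact hspan _ (hCf a b)
  have htop : monomialSpan f 2 Y l = ⊤ := by
    have hsum : ∀ (A : Matrix (Fin n) (Fin n) k) (g : Fin n → Fin n → Module.End k V),
        (∀ a b, ∀ x ∈ monomialSpan f 2 Y l, g a b x ∈ monomialSpan f 2 Y l) →
        ∀ x ∈ monomialSpan f 2 Y l,
          (∑ a, ∑ b, A a b • g a b) x ∈ monomialSpan f 2 Y l := by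
      intro A g hg x hx
      simp only [LinearMap.sum_apply, LinearMap.smul_apply]
      exact sum_mem fun a _ => sum_mem fun b _ => Submodule.smul_mem _ _ (hg a b x hx)
    refine hgen _ (le_monomialSpan two_pos Y l hvY) (fun A => ?_) (fun A => ?_) (fun A => ?_)
    · rw [ρ.even_eq_sum]; exact hsum A _ hEX
    · rw [ρ.sym_eq_sum]; exact hsum A _ hSX
    · rw [ρ.skew_eq_sum]; exact hsum A _ hCX
  obtain ⟨x, hxW, hx0⟩ := W.ne_bot_iff.1 hW0
  refine hreach.extend (O' := {o | (∃ A, o = ρ.even A) ∨ (∃ A, o = ρ.sym A) ∨ ∃ A, o = ρ.skew A})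
    two_pos hc hq (fun r => hv.sym _) hef (ρ.IsShiftedWeight μ)
    hv.isShiftedWeight hfWt hret hl hall hst hof ?_ (fun i => Or.inr (Or.inr ⟨_, rfl⟩))
    (fun i => Or.inr (Or.inl ⟨_, rfl⟩)) W ?_ x hxW (htop ▸ Submodule.mem_top) hx0
  · rintro _ ⟨a, b, -, rfl⟩
    exact Or.inl ⟨_, rfl⟩
  · rintro _ (⟨A, rfl⟩ | ⟨A, rfl⟩ | ⟨A, rfl⟩)
    · exact hWE A
    · exact hWS A
    · exact hWC A

end PeriplecticRep

noncomputable section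

/-! ### Generators and parity of the reduced enveloping algebra -/

namespace RestrictedSubalgebra

variable {k : Type u} [Field k] {p n : ℕ}

theorem redGen_congr (L : RestrictedSubalgebra k p n) (χ : Module.Dual k (L.part 0))
    {i j : ZMod 2} (h : i = j) {x : L.part i} {y : L.part j} (hxy : x.1 = y.1) :
    L.redGen χ i x = L.redGen χ j y := by
  subst h
  rw [Subtype.ext hxy]

/-- The reduced enveloping algebra is generated by the Lie superalgebra. -/
theorem redEnv_induction (L : RestrictedSubalgebra k p n) (χ : Module.Dual k (L.part 0))
    {P : RedEnv L χ → Prop} (hgen : ∀ i x, P (L.redGen χ i x))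
    (hscalar : ∀ c, P (algebraMap k _ c)) (hadd : ∀ a b, P a → P b → P (a + b))
    (hmul : ∀ a b, P a → P b → P (a * b)) (w : RedEnv L χ) : P w := by
  obtain ⟨w, rfl⟩ := RingQuot.mkAlgHom_surjective k (RedRel L χ) w
  obtain ⟨w, rfl⟩ := RingQuot.mkAlgHom_surjective k (EnvRel L) w
  induction w using TensorAlgebra.induction with
  | algebraMap c =>
    rw [AlgHom.commutes]
    exact (AlgHom.commutes (RingQuot.mkAlgHom k (RedRel L χ)) c).symm ▸ hscalar c
  | ι x =>
    induction x using DirectSum.induction_on with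
    | zero =>
      rw [map_zero, map_zero]
      have := hscalar 0
      rw [map_zero] at this
      exact (map_zero (RingQuot.mkAlgHom k (RedRel L χ))).symm ▸ this
    | of i x => exact hgen i x
    | add x y hx hy =>
      rw [map_add, map_add]
      exact (map_add (RingQuot.mkAlgHom k (RedRel L χ)) _ _).symm ▸ hadd _ _ hx hy
  | mul a b ha hb =>
    rw [map_mul]
    exact (map_mul (RingQuot.mkAlgHom k (RedRel L χ)) _ _).symm ▸ hmul _ _ ha hb
  | add a b ha hb =>
    rw [map_add]
    exact (map_add (RingQuot.mkAlgHom k (RedRel L χ)) _ _).symm ▸ hadd _ _ ha hb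

/-- The sign `(-1)^i`. -/
def paritySign (k : Type u) [Field k] (i : ZMod 2) : k := if i = 1 then -1 else 1

theorem paritySign_add (i j : ZMod 2) :
    paritySign k (i + j) = paritySign k i * paritySign k j := by
  have key : ∀ i : ZMod 2, i = 0 ∨ i = 1 := by decide
  have h11 : (1 + 1 : ZMod 2) = 0 := by decide
  rcases key i with rfl | rfl <;> rcases key j with rfl | rfl <;> simp [paritySign, h11]

/-- The parity automorphism of `U_χ(L)`, which multiplies elements of parity `i` by `(-1)^i`. -/
def parityHom (L : RestrictedSubalgebra k p n) (χ : Module.Dual k (L.part 0)) :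
    RedEnv L χ →ₐ[k] RedEnv L χ :=
  redLift L χ (fun i => paritySign k i • L.redGen χ i)
    (by
      intro i j x y
      simp only [LinearMap.smul_apply, ← redGen_bracket, paritySign_add, smul_mul_smul_comm]
      rw [smul_sub, smul_comm (superSign k i j), mul_comm (paritySign k j)])
    (by
      intro x
      have h : paritySign k 0 = 1 := by simp [paritySign]
      simp only [h, one_smul]
      exact redGen_pcenter L χ x)

theorem parityHom_redGen (L : RestrictedSubalgebra k p n) (χ : Module.Dual k (L.part 0))
    (i : ZMod 2) (x : L.part i) :
    parityHom L χ (L.redGen χ i x) = paritySign k i • L.redGen χ i x :=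
  redLift_redGen _ _ _ _ _ _ _

theorem parityHom_of_mem_redPart (L : RestrictedSubalgebra k p n) (χ : Module.Dual k (L.part 0))
    {i : ZMod 2} {w : RedEnv L χ} (hw : w ∈ redPart L χ i) :
    parityHom L χ w = paritySign k i • w := by
  induction hw using Submodule.span_induction with
  | mem w h =>
    obtain ⟨l, rfl, rfl⟩ := h
    induction l with
    | nil => simp [paritySign]
    | cons x l ih =>
      rw [List.map_cons, List.prod_cons, map_mul, ih, parityHom_redGen, List.map_cons,
        List.sum_cons, paritySign_add, smul_mul_smul_comm]
  | zero => simp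
  | add a b _ _ ha hb => rw [map_add, ha, hb, smul_add]
  | smul c a _ ha => rw [map_smul, ha, smul_comm]

theorem redGen_mem_redPart (L : RestrictedSubalgebra k p n) (χ : Module.Dual k (L.part 0))
    (i : ZMod 2) (x : L.part i) : L.redGen χ i x ∈ redPart L χ i :=
  Submodule.subset_span ⟨[⟨i, x⟩], by simp, by simp⟩

theorem algebraMap_mem_redPart (L : RestrictedSubalgebra k p n) (χ : Module.Dual k (L.part 0))
    (c : k) : algebraMap k (RedEnv L χ) c ∈ redPart L χ 0 := by
  rw [Algebra.algebraMap_eq_smul_one]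
  exact Submodule.smul_mem _ _ (Submodule.subset_span ⟨[], by simp, by simp⟩)

theorem mul_mem_redPart (L : RestrictedSubalgebra k p n) (χ : Module.Dual k (L.part 0))
    {i j : ZMod 2} {a b : RedEnv L χ} (ha : a ∈ redPart L χ i) (hb : b ∈ redPart L χ j) :
    a * b ∈ redPart L χ (i + j) := by
  have := Submodule.mul_mem_mul ha hb
  rw [redPart, redPart, Submodule.span_mul_span] at this
  refine Submodule.span_mono ?_ this
  rintro _ ⟨_, ⟨l, rfl, rfl⟩, _, ⟨l', rfl, rfl⟩, rfl⟩
  exact ⟨l ++ l', by simp, by simp⟩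

theorem exists_redPart_add (L : RestrictedSubalgebra k p n) (χ : Module.Dual k (L.part 0))
    (w : RedEnv L χ) : ∃ w₀ ∈ redPart L χ 0, ∃ w₁ ∈ redPart L χ 1, w = w₀ + w₁ := by
  have key : ∀ i : ZMod 2, i = 0 ∨ i = 1 := by decide
  induction w using redEnv_induction with
  | hgen i x =>
    rcases key i with rfl | rfl
    · exact ⟨_, redGen_mem_redPart L χ 0 x, 0, zero_mem _, (add_zero _).symm⟩
    · exact ⟨0, zero_mem _, _, redGen_mem_redPart L χ 1 x, (zero_add _).symm⟩
  | hscalar c => exact ⟨_, algebraMap_mem_redPart L χ c, 0, zero_mem _, (add_zero _).symm⟩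
  | hadd a b ha hb =>
    obtain ⟨a₀, ha₀, a₁, ha₁, rfl⟩ := ha
    obtain ⟨b₀, hb₀, b₁, hb₁, rfl⟩ := hb
    exact ⟨_, add_mem ha₀ hb₀, _, add_mem ha₁ hb₁, by abel⟩
  | hmul a b ha hb =>
    obtain ⟨a₀, ha₀, a₁, ha₁, rfl⟩ := ha
    obtain ⟨b₀, hb₀, b₁, hb₁, rfl⟩ := hb
    have h11 := mul_mem_redPart L χ ha₁ hb₁
    rw [show (1 + 1 : ZMod 2) = 0 by decide] at h11
    have h01 := mul_mem_redPart L χ ha₀ hb₁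
    have h10 := mul_mem_redPart L χ ha₁ hb₀
    have h00 := mul_mem_redPart L χ ha₀ hb₀
    rw [add_zero] at h10 h00
    rw [zero_add] at h01
    exact ⟨_, add_mem h00 h11, _, add_mem h01 h10, by noncomm_ring⟩

end RestrictedSubalgebra

namespace Periplectic

open RestrictedSubalgebra

variable {k : Type u} [Field k] {p n : ℕ} [Fact p.Prime] [CharP k p]

/-! ### Modules over the reduced enveloping algebra as periplectic representations -/

variable (k p n) in
/-- The odd element with upper right block `B + Bᵀ`. -/
def symIso : Matrix (Fin n) (Fin n) k →ₗ[k] (periplectic k p n).part 1 where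
  toFun B := ⟨Matrix.fromBlocks 0 (B + B.transpose) 0 0, (mem_odd_iff _).2
    ⟨B + B.transpose, 0, by rw [Matrix.transpose_add, Matrix.transpose_transpose, add_comm],
      by simp, rfl⟩⟩
  map_add' B B' := by
    apply Subtype.ext
    simp [Matrix.fromBlocks_add, add_add_add_comm]
  map_smul' c B := by
    apply Subtype.ext
    simp [Matrix.fromBlocks_smul]

variable (k p n) in
/-- The odd element with lower left block `C - Cᵀ`. -/
def skewIso : Matrix (Fin n) (Fin n) k →ₗ[k] (periplectic k p n).part 1 where
  toFun C := ⟨Matrix.fromBlocks 0 0 (C - C.transpose) 0, (mem_odd_iff _).2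
    ⟨0, C - C.transpose, by simp, by simp, rfl⟩⟩
  map_add' B B' := by
    apply Subtype.ext
    simp [Matrix.fromBlocks_add, add_sub_add_comm]
  map_smul' c B := by
    apply Subtype.ext
    simp [Matrix.fromBlocks_smul, smul_sub]

variable {χ : Module.Dual k ((periplectic k p n).part 0)}

/-- Even elements of the periplectic superalgebra come from `gl(n)`. -/
theorem exists_evenIso (x : (periplectic k p n).part 0) : ∃ A, x = evenIso k p n A := by
  obtain ⟨A, hA⟩ := (mem_even_iff x.1).1 x.2
  exact ⟨A, Subtype.ext hA⟩

/-- If `2` is invertible, odd elements are sums of the elements `symIso B` and `skewIso C`. -/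
theorem exists_symIso_add_skewIso (h2 : (2 : k) ≠ 0) (x : (periplectic k p n).part 1) :
    ∃ B C, x = symIso k p n B + skewIso k p n C := by
  obtain ⟨B, C, hB, hC, hx⟩ := (mem_odd_iff x.1).1 x.2
  refine ⟨(2 : k)⁻¹ • B, (2 : k)⁻¹ • C, Subtype.ext ?_⟩
  have hhalf : ∀ X : Matrix (Fin n) (Fin n) k, (2 : k)⁻¹ • X + (2 : k)⁻¹ • X = X := by
    intro X
    rw [← two_smul k, smul_smul, mul_inv_cancel₀ h2, one_smul]
  have hC' : C.transpose = -C := (neg_eq_iff_eq_neg.2 hC).symm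
  rw [hx]
  simp [symIso, skewIso, Matrix.fromBlocks_add, Matrix.fromBlocks_smul, ← hB, hC', smul_add, hhalf]

variable {V : Type v} [AddCommGroup V] [Module k V]

/-- The periplectic representation on a vector space on which `U_χ(g)` acts. -/
def repOfHom (φ : RedEnv (periplectic k p n) χ →ₐ[k] Module.End k V) : PeriplecticRep k n V where
  even := φ.toLinearMap ∘ₗ (periplectic k p n).redGen χ 0 ∘ₗ evenIso k p n
  sym := φ.toLinearMap ∘ₗ (periplectic k p n).redGen χ 1 ∘ₗ symIso k p n
  skew := φ.toLinearMap ∘ₗ (periplectic k p n).redGen χ 1 ∘ₗ skewIso k p n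
  skew_transpose C := by
    simp only [LinearMap.comp_apply, ← map_neg]
    congr 2
    apply Subtype.ext
    simp [skewIso, neg_add_eq_sub]
  even_even A A' := by
    simp only [LinearMap.comp_apply, AlgHom.toLinearMap_apply, ← map_mul]
    rw [← map_sub φ]
    congr 1
    have h := redGen_bracket (periplectic k p n) χ (evenIso k p n A) (evenIso k p n A')
    simp only [superSign, zero_ne_one, and_self, if_false, one_smul] at h
    rw [h]
    refine redGen_congr _ _ (by decide) ?_
    simp [bracket, evenIso, evenMat, Matrix.fromBlocks_multiply, superSign, sub_eq_add_neg,
      Matrix.fromBlocks_neg, Matrix.fromBlocks_add, add_comm]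
  even_sym A B := by
    simp only [LinearMap.comp_apply, AlgHom.toLinearMap_apply, ← map_mul]
    rw [← map_sub φ]
    congr 1
    have h := redGen_bracket (periplectic k p n) χ (evenIso k p n A) (symIso k p n B)
    simp only [superSign, zero_ne_one, false_and, if_false, one_smul] at h
    rw [h]
    refine redGen_congr _ _ (by decide) ?_
    simp [bracket, evenIso, symIso, evenMat, Matrix.fromBlocks_multiply, superSign, sub_eq_add_neg,
      Matrix.fromBlocks_neg, Matrix.fromBlocks_add, mul_add, add_mul]
    abel
  even_skew A C := by
    simp only [LinearMap.comp_apply, AlgHom.toLinearMap_apply, ← map_mul, ← map_neg]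
    rw [← map_sub φ]
    congr 1
    have h := redGen_bracket (periplectic k p n) χ (evenIso k p n A) (skewIso k p n C)
    simp only [superSign, zero_ne_one, false_and, if_false, one_smul] at h
    rw [h]
    refine redGen_congr _ _ (by decide) ?_
    simp [bracket, evenIso, skewIso, evenMat, Matrix.fromBlocks_multiply, superSign,
      sub_eq_add_neg, Matrix.fromBlocks_neg, Matrix.fromBlocks_add, mul_add, add_mul]
    abel
  sym_sym B B' := by
    simp only [LinearMap.comp_apply, AlgHom.toLinearMap_apply, ← map_mul]
    rw [← map_add φ]
    have h := redGen_bracket (periplectic k p n) χ (symIso k p n B) (symIso k p n B')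
    simp only [superSign, and_self, if_true, neg_one_smul, sub_neg_eq_add] at h
    rw [h, redGen_congr (j := 0) (y := 0) _ _ (by decide), map_zero, map_zero]
    simp [bracket, symIso, Matrix.fromBlocks_multiply]
  skew_skew B B' := by
    simp only [LinearMap.comp_apply, AlgHom.toLinearMap_apply, ← map_mul]
    rw [← map_add φ]
    have h := redGen_bracket (periplectic k p n) χ (skewIso k p n B) (skewIso k p n B')
    simp only [superSign, and_self, if_true, neg_one_smul, sub_neg_eq_add] at h
    rw [h, redGen_congr (j := 0) (y := 0) _ _ (by decide), map_zero, map_zero]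
    simp [bracket, skewIso, Matrix.fromBlocks_multiply]
  sym_skew B C := by
    simp only [LinearMap.comp_apply, AlgHom.toLinearMap_apply, ← map_mul]
    rw [← map_add φ]
    congr 1
    have h := redGen_bracket (periplectic k p n) χ (symIso k p n B) (skewIso k p n C)
    simp only [superSign, and_self, if_true, neg_one_smul, sub_neg_eq_add] at h
    rw [h]
    refine redGen_congr _ _ (by decide) ?_
    simp only [bracket, evenIso, symIso, skewIso, evenMat, superSign, LinearMap.coe_mk,
      AddHom.coe_mk, Matrix.fromBlocks_multiply, and_self, if_true, neg_one_smul, sub_neg_eq_add,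
      Matrix.fromBlocks_add]
    have h3 : C - C.transpose = -(C.transpose - C) := (neg_sub _ _).symm
    simp only [add_zero, zero_add, Matrix.mul_zero, Matrix.zero_mul, Matrix.transpose_mul,
      Matrix.transpose_add, Matrix.transpose_sub, Matrix.transpose_transpose]
    rw [add_comm B.transpose B, ← Matrix.neg_mul, neg_sub]

end Periplectic
end

noncomputable section

namespace Periplectic

open RestrictedSubalgebra

variable {k : Type u} [Field k] {p n : ℕ} [Fact p.Prime] [CharP k p]

/-! ### Generators and grading of the baby Verma modules -/

section BabyVerma

variable (χ : Module.Dual k ((periplectic k p n).part 0)) (hχ : ∀ x ∈ nPlus k p n, χ x = 0)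
  (μ : Module.Dual k ((cartanSub k p n).part 0)) (hμ : μ ∈ weights p χ)

/-- The coordinate on `k_μ`. -/
def weightCoord : WeightModule p χ hχ μ hμ →ₗ[k] k := (LinearMap.id : k →ₗ[k] k)

theorem weightCoord_smul_weightVector (c : WeightModule p χ hχ μ hμ) :
    weightCoord χ hχ μ hμ c • weightVector p χ hχ μ hμ = c :=
  mul_one (M := k) c

theorem smul_weightModule
    (s : RedEnv (borelSub k p n) (restrict (borelSub_le k p n) χ))
    (c : WeightModule p χ hχ μ hμ) : s • c = borelChar p χ hχ μ hμ s • c := rfl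

/-- The image of `w ⊗ 1` in `Z_χ(μ)`. -/
def vermaMk (w : RedEnv (periplectic k p n) χ) : BabyVerma p χ hχ μ hμ :=
  (inducedRel (redMap (borelSub_le k p n) χ) (WeightModule p χ hχ μ hμ)).mkQ
      (w ⊗ₜ[k] weightVector p χ hχ μ hμ)

theorem smul_vermaMk (a w : RedEnv (periplectic k p n) χ) :
    a • vermaMk χ hχ μ hμ w = vermaMk χ hχ μ hμ (a * w) := by
  rw [vermaMk, ← map_smul, TensorProduct.smul_tmul', smul_eq_mul]
  rfl

theorem vermaMk_add (a b : RedEnv (periplectic k p n) χ) :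
    vermaMk χ hχ μ hμ (a + b) = vermaMk χ hχ μ hμ a + vermaMk χ hχ μ hμ b := by
  rw [vermaMk, TensorProduct.add_tmul, map_add]
  rfl

theorem vermaMk_surjective : Function.Surjective (vermaMk χ hχ μ hμ) := by
  intro z
  obtain ⟨t, rfl⟩ := Submodule.mkQ_surjective _ z
  induction t using TensorProduct.induction_on with
  | zero => exact ⟨0, by rw [vermaMk, TensorProduct.zero_tmul]⟩
  | tmul w c =>
    refine ⟨weightCoord χ hχ μ hμ c • w, ?_⟩
    rw [vermaMk, TensorProduct.smul_tmul, weightCoord_smul_weightVector]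
  | add a b ha hb =>
    obtain ⟨a', ha'⟩ := ha
    obtain ⟨b', hb'⟩ := hb
    exact ⟨a' + b', by rw [vermaMk_add, ha', hb', map_add]⟩

theorem vermaMk_mul_redMap (w : RedEnv (periplectic k p n) χ)
    (s : RedEnv (borelSub k p n) (restrict (borelSub_le k p n) χ)) :
    vermaMk χ hχ μ hμ (w * redMap (borelSub_le k p n) χ s) =
      borelChar p χ hχ μ hμ s • vermaMk χ hχ μ hμ w := by
  have h : (w * redMap (borelSub_le k p n) χ s) ⊗ₜ[k] weightVector p χ hχ μ hμ -
      w ⊗ₜ[k] (s • weightVector p χ hχ μ hμ) ∈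
        inducedRel (redMap (borelSub_le k p n) χ) (WeightModule p χ hχ μ hμ) :=
    Submodule.subset_span ⟨w, s, _, rfl⟩
  rw [smul_weightModule, TensorProduct.tmul_smul] at h
  exact (Submodule.Quotient.eq _).2 h

theorem redMap_redGen (i : ZMod 2) (x : (borelSub k p n).part i) :
    redMap (borelSub_le k p n) χ ((borelSub k p n).redGen _ i x) =
      (periplectic k p n).redGen χ i (Submodule.inclusion (borelSub_le k p n i) x) :=
  redLift_redGen _ _ _ _ _ _ _

theorem borelChar_redGen (i : ZMod 2) (x : (borelSub k p n).part i) :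
    borelChar p χ hχ μ hμ ((borelSub k p n).redGen _ i x) = μ (borelProj p i x) :=
  redLift_redGen _ _ _ _ _ _ _

/-- The universal property of `Z_χ(μ)`. -/
theorem exists_verma_hom {M : Type v} [AddCommGroup M] [Module k M]
    [Module (RedEnv (periplectic k p n) χ) M] [IsScalarTower k (RedEnv (periplectic k p n) χ) M]
    (v : M) (hv : ∀ i (x : (borelSub k p n).part i),
      (periplectic k p n).redGen χ i (Submodule.inclusion (borelSub_le k p n i) x) • v =
        μ (borelProj p i x) • v) :
    ∃ f : BabyVerma p χ hχ μ hμ →ₗ[RedEnv (periplectic k p n) χ] M,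
      ∀ w, f (vermaMk χ hχ μ hμ w) = w • v := by
  have key : ∀ s, redMap (borelSub_le k p n) χ s • v = borelChar p χ hχ μ hμ s • v := by
    intro s
    induction s using redEnv_induction with
    | hgen i x => rw [redMap_redGen, borelChar_redGen, hv]
    | hscalar c => rw [AlgHom.commutes, AlgHom.commutes, algebraMap_smul, algebraMap_smul]
    | hadd a b ha hb => rw [map_add, map_add, add_smul, add_smul, ha, hb]
    | hmul a b ha hb =>
      rw [map_mul, map_mul, mul_smul, hb, smul_comm, ha, smul_smul, mul_comm]
  let F : RedEnv (periplectic k p n) χ ⊗[k] WeightModule p χ hχ μ hμ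
      →ₗ[RedEnv (periplectic k p n) χ] M :=
    (LinearMap.toSpanSingleton (RedEnv (periplectic k p n) χ) M v) ∘ₗ
      (TensorProduct.AlgebraTensorModule.rid k (RedEnv (periplectic k p n) χ)
        (RedEnv (periplectic k p n) χ)).toLinearMap ∘ₗ
      (TensorProduct.AlgebraTensorModule.map LinearMap.id (weightCoord χ hχ μ hμ))
  have hF : ∀ w c, F (w ⊗ₜ c) = weightCoord χ hχ μ hμ c • w • v := by
    intro w c
    simp [F]
  refine ⟨Submodule.liftQ _ F (Submodule.span_le.2 ?_), fun w => ?_⟩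
  · rintro _ ⟨r, s, c, rfl⟩
    rw [SetLike.mem_coe, LinearMap.mem_ker, map_sub, hF, hF, smul_weightModule, map_smul,
      mul_smul, key, smul_assoc, smul_comm r (borelChar p χ hχ μ hμ s) v,
      smul_comm (weightCoord χ hχ μ hμ c) (borelChar p χ hχ μ hμ s)]
    exact sub_self _
  · refine (Submodule.liftQ_apply _ _ _).trans ((hF _ _).trans ?_)
    exact one_smul k _

/-- The parity involution of `Z_χ(μ)`. -/
theorem exists_verma_parity : ∃ σ : BabyVerma p χ hχ μ hμ →+ BabyVerma p χ hχ μ hμ,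
    ∀ w, σ (vermaMk χ hχ μ hμ w) = vermaMk χ hχ μ hμ (parityHom _ χ w) := by
  have hmap : ∀ s, parityHom _ χ (redMap (borelSub_le k p n) χ s) =
      redMap (borelSub_le k p n) χ (parityHom _ _ s) := by
    intro s
    induction s using redEnv_induction with
    | hgen i x => rw [redMap_redGen, parityHom_redGen, parityHom_redGen, map_smul, redMap_redGen]
    | hscalar c => simp only [AlgHom.commutes]
    | hadd a b ha hb => simp only [map_add, ha, hb]
    | hmul a b ha hb => simp only [map_mul, ha, hb]
  have hchar : ∀ s, borelChar p χ hχ μ hμ (parityHom _ _ s) = borelChar p χ hχ μ hμ s := by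
    have key : ∀ i : ZMod 2, i = 0 ∨ i = 1 := by decide
    intro s
    induction s using redEnv_induction with
    | hgen i x =>
      rw [parityHom_redGen, map_smul, borelChar_redGen]
      rcases key i with rfl | rfl
      · simp [paritySign]
      · rw [borelProj_odd, map_zero, smul_zero]
    | hscalar c => simp only [AlgHom.commutes]
    | hadd a b ha hb => simp only [map_add, ha, hb]
    | hmul a b ha hb => simp only [map_mul, ha, hb]
  let τ : RedEnv (periplectic k p n) χ ⊗[k] WeightModule p χ hχ μ hμ →ₗ[k]
      RedEnv (periplectic k p n) χ ⊗[k] WeightModule p χ hχ μ hμ :=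
    LinearMap.rTensor _ (parityHom _ χ).toLinearMap
  let F : RedEnv (periplectic k p n) χ ⊗[k] WeightModule p χ hχ μ hμ
      →ₛₗ[(parityHom (periplectic k p n) χ).toRingHom] BabyVerma p χ hχ μ hμ :=
    { toFun := fun t => (inducedRel (redMap (borelSub_le k p n) χ)
        (WeightModule p χ hχ μ hμ)).mkQ (τ t)
      map_add' := fun a b => by rw [map_add, map_add]
      map_smul' := fun a t => by
        induction t using TensorProduct.induction_on with
        | zero => simp
        | tmul w c =>
          rw [← map_smul]
          congr 1
          rw [TensorProduct.smul_tmul']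
          change LinearMap.rTensor _ _ _ = _ • LinearMap.rTensor _ _ _
          rw [LinearMap.rTensor_tmul, LinearMap.rTensor_tmul, TensorProduct.smul_tmul', smul_eq_mul,
            smul_eq_mul]
          congr 1
          exact map_mul (parityHom (periplectic k p n) χ) a w
        | add t t' h h' => rw [smul_add, map_add, map_add, h, h', map_add, map_add, smul_add] }
  have hF : ∀ w c, F (w ⊗ₜ c) = (inducedRel (redMap (borelSub_le k p n) χ)
      (WeightModule p χ hχ μ hμ)).mkQ (parityHom _ χ w ⊗ₜ c) := fun w c => rfl
  refine ⟨(Submodule.liftQ _ F (Submodule.span_le.2 ?_)).toAddMonoidHom, fun w => hF w _⟩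
  rintro _ ⟨r, s, c, rfl⟩
  rw [SetLike.mem_coe, LinearMap.mem_ker, map_sub, hF, hF, ← map_sub, ← LinearMap.mem_ker,
    Submodule.ker_mkQ, map_mul, hmap, smul_weightModule, ← hchar, ← smul_weightModule]
  exact Submodule.subset_span ⟨_, _, c, rfl⟩

/-- The even and odd parts of `Z_χ(μ)` are the eigenspaces of an involution induced by the parity
automorphism, so they are complementary. -/
theorem babyVerma_isSupermodule (h2 : (2 : k) ≠ 0) :
    IsSupermodule (periplectic k p n) χ (babyVermaPart p χ hχ μ hμ) := by
  have hsmul : ∀ (c : k) w, vermaMk χ hχ μ hμ (c • w) = c • vermaMk χ hχ μ hμ w := by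
    intro c w
    rw [vermaMk, ← TensorProduct.smul_tmul']
    rfl
  refine ⟨?_, ?_⟩
  · rw [DirectSum.isInternal_submodule_iff_isCompl _ (i := 0) (j := 1) (by decide)
      (by ext i; revert i; decide)]
    obtain ⟨σ, hσ⟩ := exists_verma_parity χ hχ μ hμ
    have hpart : ∀ i, ∀ z ∈ babyVermaPart p χ hχ μ hμ i, σ z = paritySign k i • z := by
      rintro i _ ⟨w, hw, rfl⟩
      refine (hσ w).trans ?_
      rw [parityHom_of_mem_redPart _ _ hw]
      exact hsmul _ _
    constructor
    · rw [Submodule.disjoint_def]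
      intro z h0 h1
      have e0 := hpart 0 z h0
      have e1 := hpart 1 z h1
      rw [e0] at e1
      simp only [paritySign, zero_ne_one, if_false, if_true, one_smul, neg_smul] at e1
      have : (2 : k) • z = 0 := by
        rw [two_smul]
        nth_rewrite 1 [e1]
        exact neg_add_cancel z
      exact (smul_eq_zero.1 this).resolve_left h2
    · rw [codisjoint_iff, eq_top_iff]
      intro z _
      obtain ⟨w, rfl⟩ := vermaMk_surjective χ hχ μ hμ z
      obtain ⟨w₀, h₀, w₁, h₁, rfl⟩ := exists_redPart_add _ χ w
      rw [vermaMk_add]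
      exact Submodule.add_mem_sup ⟨w₀, h₀, rfl⟩ ⟨w₁, h₁, rfl⟩
  · rintro i j a _ ha ⟨w, hw, rfl⟩
    exact ⟨a * w, mul_mem_redPart _ χ ha hw, smul_vermaMk χ hχ μ hμ a w⟩

end BabyVerma

end Periplectic
end

/-! ### Common eigenvectors -/

section Eigenvectors

open Polynomial

variable {k V ι : Type*} [Field k] [IsAlgClosed k] [AddCommGroup V] [Module k V]

/-- An operator that is annihilated by a nonzero polynomial has an eigenvector in every nonzero
stable subspace. -/
theorem exists_eigenvector_mem {T : Module.End k V} {P : k[X]} (hP : P ≠ 0)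
    (hT : aeval T P = 0) {W : Submodule k V} (hW : ∀ x ∈ W, T x ∈ W) (hW0 : W ≠ ⊥) :
    ∃ x ∈ W, x ≠ 0 ∧ ∃ c : k, T x = c • x := by
  obtain ⟨x, hxW, hx0⟩ := W.ne_bot_iff.1 hW0
  have key : ∀ (s : Multiset k) (x : V), x ∈ W → x ≠ 0 →
      aeval T (s.map fun a => X - C a).prod x = 0 → ∃ x ∈ W, x ≠ 0 ∧ ∃ c : k, T x = c • x := by
    intro s
    induction s using Multiset.induction with
    | empty =>
      intro x _ hx0 h
      simp at h
      exact absurd h hx0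
    | cons a s ih =>
      intro x hxW hx0 h
      by_cases h0 : T x - a • x = 0
      · exact ⟨x, hxW, hx0, a, sub_eq_zero.1 h0⟩
      · refine ih (T x - a • x) (sub_mem (hW x hxW) (Submodule.smul_mem _ _ hxW)) h0 ?_
        rw [Multiset.map_cons, Multiset.prod_cons, mul_comm, map_mul, Module.End.mul_apply] at h
        simpa [Algebra.algebraMap_eq_smul_one] using h
  refine key P.roots x hxW hx0 ?_
  have h1 := (IsAlgClosed.splits P).eq_prod_roots
  rw [h1, map_mul, aeval_C, Algebra.algebraMap_eq_smul_one, smul_mul_assoc, one_mul,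
    smul_eq_zero] at hT
  rw [hT.resolve_left (leadingCoeff_ne_zero.2 hP), LinearMap.zero_apply]

/-- Operators annihilated by nonzero polynomials, which preserve the eigenvectors of each other,
have a common eigenvector in every nonzero stable subspace. -/
theorem exists_common_eigenvector_mem [DecidableEq ι] (T : ι → Module.End k V) (P : ι → k[X])
    (hP : ∀ i, P i ≠ 0) (hT : ∀ i, aeval (T i) (P i) = 0) {W : Submodule k V}
    (hW : ∀ i, ∀ x ∈ W, T i x ∈ W) (hW0 : W ≠ ⊥)
    (hcomm : ∀ i j, i ≠ j → ∀ (c : k) (x : V), T j x = c • x → T j (T i x) = c • T i x)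
    (s : Finset ι) : ∃ x ∈ W, x ≠ 0 ∧ ∃ c : ι → k, ∀ i ∈ s, T i x = c i • x := by
  induction s using Finset.induction_on with
  | empty =>
    obtain ⟨x, hxW, hx0⟩ := W.ne_bot_iff.1 hW0
    exact ⟨x, hxW, hx0, 0, by simp⟩
  | insert i s his ih =>
    obtain ⟨x, hxW, hx0, c, hc⟩ := ih
    let W' : Submodule k V := W ⊓ ⨅ j : s, LinearMap.ker (T j - c j • LinearMap.id)
    have hmem : ∀ y, y ∈ W' ↔ y ∈ W ∧ ∀ j ∈ s, T j y = c j • y := by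
      intro y
      simp [W', sub_eq_zero]
    obtain ⟨y, hyW', hy0, d, hd⟩ := exists_eigenvector_mem (hP i) (hT i) (W := W')
      (by
        intro y hy
        rw [hmem] at hy ⊢
        refine ⟨hW i y hy.1, fun j hj => hcomm i j (fun h => his (by rwa [h])) _ _ (hy.2 j hj)⟩)
      ((Submodule.ne_bot_iff _).2 ⟨x, (hmem x).2 ⟨hxW, hc⟩, hx0⟩)
    rw [hmem] at hyW'
    refine ⟨y, hyW'.1, hy0, Function.update c i d, fun j hj => ?_⟩
    rcases Finset.mem_insert.1 hj with rfl | hj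
    · rw [Function.update_self, hd]
    · rw [Function.update_of_ne (fun h => his (by rwa [← h])), hyW'.2 j hj]

/-- Nilpotent operators that commute up to a scalar have a common kernel in every nonzero stable
subspace. -/
theorem exists_mem_forall_apply_eq_zero [DecidableEq ι] [Fintype ι] (T : ι → Module.End k V) (N : ℕ)
    (hT : ∀ i, T i ^ N = 0) {W : Submodule k V} (hW : ∀ i, ∀ x ∈ W, T i x ∈ W) (hW0 : W ≠ ⊥)
    (ε : k) (hcomm : ∀ i j, T i * T j = ε • (T j * T i)) :
    ∃ x ∈ W, x ≠ 0 ∧ ∀ i, T i x = 0 := by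
  have hzero : ∀ i (c : k) (x : V), T i x = c • x → x ≠ 0 → c = 0 := by
    intro i c x hx hx0
    have h1 : ∀ m : ℕ, (T i ^ m) x = c ^ m • x := by
      intro m
      induction m with
      | zero => simp
      | succ m ih => rw [pow_succ', Module.End.mul_apply, ih, map_smul, hx, smul_smul, pow_succ]
    have h2 := h1 N
    rw [hT, LinearMap.zero_apply] at h2
    exact eq_zero_of_pow_eq_zero ((smul_eq_zero.1 h2.symm).resolve_right hx0)
  obtain ⟨x, hxW, hx0, c, hc⟩ := exists_common_eigenvector_mem T (fun _ => X ^ N)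
    (fun _ => pow_ne_zero _ X_ne_zero) (fun i => by simp [hT]) hW hW0
    (by
      intro i j _ c x hx
      by_cases hx0 : x = 0
      · simp [hx0]
      · obtain rfl := hzero j c x hx hx0
        rw [zero_smul] at hx ⊢
        rw [← Module.End.mul_apply, hcomm, LinearMap.smul_apply, Module.End.mul_apply, hx, map_zero,
          smul_zero])
    Finset.univ
  refine ⟨x, hxW, hx0, fun i => ?_⟩
  have h1 := hc i (Finset.mem_univ i)
  rw [h1, hzero i _ x h1 hx0, zero_smul]

end Eigenvectors

namespace PeriplecticRep

section

variable {k : Type*} [Field k] {n : ℕ} {V : Type*} [AddCommGroup V] [Module k V]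
variable {ρ : PeriplecticRep k n V}

/-- Upper triangular matrices act on a highest weight vector through their diagonal entries. -/
theorem IsHighestWeight.even_apply {v : V} {μ : Fin n → k} (hv : ρ.IsHighestWeight v μ)
    {A : Matrix (Fin n) (Fin n) k} (hA : ∀ a b, b < a → A a b = 0) :
    ρ.even A v = (∑ a, μ a * A a a) • v := by
  rw [PeriplecticRep.even_eq_sum, LinearMap.sum_apply, Finset.sum_smul]
  refine Finset.sum_congr rfl fun a _ => ?_
  rw [LinearMap.sum_apply, Finset.sum_eq_single a]
  · rw [LinearMap.smul_apply, hv.weight, smul_smul, mul_comm]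
  · intro b _ hba
    rcases lt_or_gt_of_ne hba with h | h
    · rw [hA a b h, zero_smul, LinearMap.zero_apply]
    · rw [LinearMap.smul_apply, hv.raise a b h, smul_zero]
  · intro h
    exact absurd (Finset.mem_univ a) h

end

variable {k : Type*} [Field k] [IsAlgClosed k] {n : ℕ} {V : Type*} [AddCommGroup V] [Module k V]
variable {ρ : PeriplecticRep k n V}

/-- A nonzero subspace annihilated by the elements `sym B` and stable under upper triangular
matrices contains a highest weight vector. -/
theorem exists_isHighestWeight_mem {p : ℕ} (hp : 1 < p) {c : Fin n → k}
    (hnil : ∀ a b, a < b → ρ.E a b ^ p = 0)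
    (hss : ∀ a, ρ.E a a ^ p - ρ.E a a = algebraMap k _ (c a)) {W : Submodule k V} (hW0 : W ≠ ⊥)
    (hW : ∀ a b, a ≤ b → ∀ x ∈ W, ρ.E a b x ∈ W) (hsym : ∀ B, ∀ x ∈ W, ρ.sym B x = 0) :
    ∃ v ∈ W, v ≠ 0 ∧ ∃ μ, ρ.IsHighestWeight v μ := by
  have key : ∀ m ≤ n, ∃ W' ≤ W, W' ≠ ⊥ ∧ (∀ a b, a ≤ b → ∀ x ∈ W', ρ.E a b x ∈ W') ∧
      ∀ a b : Fin n, a < b → n ≤ b.1 + m → ∀ x ∈ W', ρ.E a b x = 0 := by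
    intro m
    induction m with
    | zero => exact fun _ => ⟨W, le_rfl, hW0, hW, fun a b _ h => absurd b.2 (by omega)⟩
    | succ m ih =>
      intro hm
      obtain ⟨W', hW'W, hW'0, hst, hkill⟩ := ih (by omega)
      let t : Fin n := ⟨n - (m + 1), by omega⟩
      obtain ⟨x, hxW', hx0, hx⟩ := exists_mem_forall_apply_eq_zero
        (fun a : {a : Fin n // a < t} => ρ.E a.1 t) p (fun a => hnil _ _ a.2)
        (fun a => hst _ _ a.2.le) hW'0 1
        (fun a b => by
          have := ρ.E_commutator a.1 t b.1 t
          rw [if_neg b.2.ne', if_neg a.2.ne', sub_zero, sub_eq_zero] at this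
          rw [one_smul, this])
      let W'' : Submodule k V := W' ⊓ ⨅ a : {a : Fin n // a < t}, LinearMap.ker (ρ.E a.1 t)
      have hmem : ∀ y, y ∈ W'' ↔ y ∈ W' ∧ ∀ a, a < t → ρ.E a t y = 0 := by
        intro y
        simp [W'']
      refine ⟨W'', inf_le_left.trans hW'W,
        (Submodule.ne_bot_iff _).2 ⟨x, (hmem x).2 ⟨hxW', fun a ha => hx ⟨a, ha⟩⟩, hx0⟩, ?_, ?_⟩
      · intro e d hed y hy
        rw [hmem] at hy ⊢
        refine ⟨hst _ _ hed y hy.1, fun a ha => ?_⟩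
        have h1 := congrArg (fun T : Module.End k V => T y) (ρ.E_commutator a t e d)
        simp only [LinearMap.sub_apply, Module.End.mul_apply, hy.2 a ha, map_zero, sub_zero] at h1
        rw [h1]
        have h2 : (if t = e then ρ.E a d else 0) y = 0 := by
          split_ifs with h
          · rcases (h ▸ hed : t ≤ d).eq_or_lt with h' | h'
            · rw [← h']
              exact hy.2 a ha
            · refine hkill a d (ha.trans h') ?_ y hy.1
              have := Fin.lt_def.1 h'
              simp only [t] at this
              omega
          · rfl
        have h3 : (if d = a then ρ.E e t else 0) y = 0 := by
          split_ifs with h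
          · exact hy.2 e (lt_of_le_of_lt hed (h ▸ ha))
          · rfl
        rw [h2, h3, sub_zero]
      · intro a b hab hb y hy
        rw [hmem] at hy
        by_cases h : n ≤ b.1 + m
        · exact hkill a b hab h y hy.1
        · have hbt : b = t := Fin.ext (by simp only [t]; omega)
          rw [hbt] at hab ⊢
          exact hy.2 a hab
  obtain ⟨W', hW'W, hW'0, hst, hkill⟩ := key n le_rfl
  obtain ⟨v, hvW, hv0, μ, hμ⟩ := exists_common_eigenvector_mem (fun a => ρ.E a a)
    (fun a => Polynomial.X ^ p - (Polynomial.X + Polynomial.C (c a)))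
    (fun a => (Polynomial.monic_X_pow_sub
      (by rw [Polynomial.degree_X_add_C]; exact_mod_cast hp)).ne_zero)
    (fun a => by
      rw [map_sub, map_add, map_pow, Polynomial.aeval_X, Polynomial.aeval_C, ← hss]
      abel) (fun a => hst a a le_rfl) hW'0
    (by
      intro a b _ d x hx
      have h1 := congrArg (fun T : Module.End k V => T x) (ρ.E_commutator b b a a)
      have h2 : ((if b = a then ρ.E b a else 0) - if a = b then ρ.E a b else 0) = 0 := by
        by_cases h : a = b
        · rw [if_pos h, if_pos h.symm, h, sub_self]
        · rw [if_neg h, if_neg (Ne.symm h), sub_zero]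
      rw [h2] at h1
      simp only [LinearMap.sub_apply, Module.End.mul_apply, LinearMap.zero_apply, hx, map_smul] at h1
      exact sub_eq_zero.1 h1)
    Finset.univ
  exact ⟨v, hW'W hvW, hv0, μ, fun a b hab => hkill a b hab (by omega) v hvW,
    fun a => hμ a (Finset.mem_univ a), fun B => hsym B v (hW'W hvW)⟩

/-- If in addition the odd elements `sym B` act on the whole space, they have a nonzero common
kernel, so that every nonzero representation contains a highest weight vector. -/
theorem exists_isHighestWeight [Nontrivial V] (h2 : (2 : k) ≠ 0) {p : ℕ} (hp : 1 < p)
    {c : Fin n → k} (hnil : ∀ a b, a < b → ρ.E a b ^ p = 0)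
    (hss : ∀ a, ρ.E a a ^ p - ρ.E a a = algebraMap k _ (c a)) :
    ∃ v, v ≠ 0 ∧ ∃ μ, ρ.IsHighestWeight v μ := by
  let K : Submodule k V := ⨅ a : Fin n, ⨅ b : Fin n, LinearMap.ker (ρ.S a b)
  have hmem : ∀ x, x ∈ K ↔ ∀ a b, ρ.S a b x = 0 := by simp [K]
  obtain ⟨x, -, hx0, hx⟩ := exists_mem_forall_apply_eq_zero
    (fun a : Fin n × Fin n => ρ.S a.1 a.2) 2
    (fun a => by
      have h1 : (2 : k) • ρ.S a.1 a.2 ^ 2 = 0 := by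
        rw [two_smul, pow_two]
        exact ρ.sym_sym _ _
      exact (smul_eq_zero.1 h1).resolve_left h2)
    (W := ⊤) (fun _ _ _ => Submodule.mem_top) top_ne_bot (-1)
    (fun a b => by
      rw [neg_one_smul]
      exact eq_neg_of_add_eq_zero_left (ρ.sym_sym _ _))
  obtain ⟨v, -, hv0, μ, hv⟩ := exists_isHighestWeight_mem hp hnil hss (W := K)
    ((Submodule.ne_bot_iff _).2 ⟨x, (hmem x).2 fun a b => hx (a, b), hx0⟩)
    (by
      intro a b _ x hx
      rw [hmem] at hx ⊢
      intro c d
      have h1 := congrArg (fun T : Module.End k V => T x) (ρ.E_S_commutator a b c d)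
      simp only [LinearMap.sub_apply, Module.End.mul_apply, hx c d, map_zero, zero_sub] at h1
      rw [neg_eq_iff_eq_neg.1 h1]
      split_ifs <;> simp [hx])
    (by
      intro B x hx
      rw [hmem] at hx
      rw [ρ.sym_eq_sum]
      simp [hx])
  exact ⟨v, hv0, μ, hv⟩

end PeriplecticRep

noncomputable section

namespace Periplectic

open RestrictedSubalgebra

theorem evenMat_pow {k : Type u} [Field k] {p n : ℕ} (hp : Odd p) (A : Matrix (Fin n) (Fin n) k) :
    evenMat A ^ p = evenMat (A ^ p) := by
  rw [evenMat, evenMat, Matrix.fromBlocks_diagonal_pow, hp.neg_pow, Matrix.transpose_pow]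

variable {k : Type u} [Field k] {p n : ℕ} [Fact p.Prime] [CharP k p]

/-! ### Highest weight vectors and characters of the Borel subalgebra -/

section Rep

variable {χ : Module.Dual k ((periplectic k p n).part 0)}
variable {V : Type v} [AddCommGroup V] [Module k V]
variable (φ : RedEnv (periplectic k p n) χ →ₐ[k] Module.End k V)

theorem repOfHom_even_apply (A : Matrix (Fin n) (Fin n) k) :
    (repOfHom φ).even A = φ ((periplectic k p n).redGen χ 0 (evenIso k p n A)) := rfl

theorem repOfHom_sym_apply (A : Matrix (Fin n) (Fin n) k) :
    (repOfHom φ).sym A = φ ((periplectic k p n).redGen χ 1 (symIso k p n A)) := rfl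

theorem repOfHom_even_pow (hp : Odd p) (A : Matrix (Fin n) (Fin n) k) :
    (repOfHom φ).even A ^ p =
      (repOfHom φ).even (A ^ p) + algebraMap k _ (χ (evenIso k p n A) ^ p) := by
  have h := congrArg φ (redGen_pcenter (periplectic k p n) χ (evenIso k p n A))
  have h1 : (periplectic k p n).pmap (evenIso k p n A) = evenIso k p n (A ^ p) :=
    Subtype.ext (evenMat_pow hp A)
  rw [AlgHom.commutes, map_sub, map_pow, h1] at h
  rw [repOfHom_even_apply, repOfHom_even_apply, ← h]
  abel

theorem repOfHom_E_pow (hp : Odd p) (hp1 : 1 < p) {a b : Fin n} (hab : a ≠ b)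
    (h : χ (evenIso k p n (Matrix.single a b 1)) = 0) : (repOfHom φ).E a b ^ p = 0 := by
  have h0 : (Matrix.single a b (1 : k)) ^ p = 0 := by
    refine pow_eq_zero_of_le hp1 ?_
    rw [pow_two, Matrix.single_mul_single_of_ne _ _ _ _ hab.symm]
  rw [PeriplecticRep.E, repOfHom_even_pow φ hp, h0, h, map_zero, zero_pow hp.pos.ne', map_zero,
    add_zero]

theorem single_diag_pow (a : Fin n) {m : ℕ} (hm : 0 < m) :
    (Matrix.single a a (1 : k)) ^ m = Matrix.single a a 1 := by
  obtain ⟨m, rfl⟩ := Nat.exists_eq_succ_of_ne_zero hm.ne'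
  induction m with
  | zero => simp
  | succ m ih => rw [pow_succ, ih (Nat.succ_pos m), Matrix.single_mul_single_same, one_mul]

theorem repOfHom_E_pow_sub (hp : Odd p) (a : Fin n) :
    (repOfHom φ).E a a ^ p - (repOfHom φ).E a a = algebraMap k _ (χ (cartanElt k p a) ^ p) := by
  rw [PeriplecticRep.E, repOfHom_even_pow φ hp, single_diag_pow a hp.pos]
  exact add_sub_cancel_left _ _

variable (k p) in
/-- The weight in `h*` with value `c a` at the `a`-th diagonal coordinate. -/
def weightOfCoords (c : Fin n → k) : Module.Dual k ((cartanSub k p n).part 0) where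
  toFun x := ∑ a, c a * x.1 (Sum.inl a) (Sum.inl a)
  map_add' x y := by simp [mul_add, Finset.sum_add_distrib]
  map_smul' r x := by simp [Finset.mul_sum, mul_left_comm]

theorem repOfHom_borel_apply (h2 : (2 : k) ≠ 0) {v : V} {c : Fin n → k}
    (hv : (repOfHom φ).IsHighestWeight v c) (i : ZMod 2) (x : (borelSub k p n).part i) :
    φ ((periplectic k p n).redGen χ i (Submodule.inclusion (borelSub_le k p n i) x)) v =
      weightOfCoords k p c (borelProj p i x) • v := by
  have key : ∀ i : ZMod 2, i = 0 ∨ i = 1 := by decide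
  rcases key i with rfl | rfl
  · obtain ⟨A, hA⟩ := exists_evenIso (Submodule.inclusion (borelSub_le k p n 0) x)
    have hx : x.1 = evenMat A := congrArg Subtype.val hA
    have hup : ∀ a b, b < a → A a b = 0 := by
      intro a b h
      have := x.2.2.1 a b h
      rwa [hx] at this
    rw [hA, ← repOfHom_even_apply, hv.even_apply hup]
    simp only [weightOfCoords, LinearMap.coe_mk, AddHom.coe_mk, borelProj_apply_inl, hx]
    rfl
  · obtain ⟨B, C, hBC⟩ := exists_symIso_add_skewIso h2
      (Submodule.inclusion (borelSub_le k p n 1) x)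
    have hC : skewIso k p n C = 0 := by
      have h1 : ∀ i j, (C - C.transpose) i j = 0 := by
        intro i j
        have h2 := x.2.2.2 i j
        have h3 : x.1 = (symIso k p n B).1 + (skewIso k p n C).1 := congrArg Subtype.val hBC
        rw [h3] at h2
        simpa [symIso, skewIso] using h2
      apply Subtype.ext
      have h4 : C - C.transpose = 0 := Matrix.ext h1
      simp [skewIso, h4]
    rw [borelProj_odd, map_zero, zero_smul, hBC, hC, add_zero, ← repOfHom_sym_apply, hv.sym]

theorem weightOfCoords_mem_weights (h2 : (2 : k) ≠ 0) {v : V} (hv0 : v ≠ 0)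
    {c : Fin n → k} (hv : (repOfHom φ).IsHighestWeight v c) :
    weightOfCoords k p c ∈ weights p χ := by
  have hcart : ∀ H : (cartanSub k p n).part 0,
      φ ((periplectic k p n).redGen χ 0 (Submodule.inclusion (cartanSub_le k p n 0) H)) v =
        weightOfCoords k p c H • v := by
    intro H
    have hH : H.1 ∈ (borelSub k p n).part 0 :=
      ⟨H.2.1, fun i j hij => H.2.2 _ _ (by simpa using hij.ne'), fun i j => H.2.2 _ _ (by simp)⟩
    have h1 := repOfHom_borel_apply φ h2 hv 0 ⟨H.1, hH⟩
    have h3 : borelProj p 0 ⟨H.1, hH⟩ = H := by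
      refine cartanSub_ext p fun i => ?_
      rw [borelProj_apply_inl]
    rw [h3] at h1
    exact h1
  intro H
  have h := congrArg (fun a => φ a v)
    (redGen_pcenter (periplectic k p n) χ (Submodule.inclusion (cartanSub_le k p n 0) H))
  simp only [map_sub, map_pow, AlgHom.commutes] at h
  have hpow : ∀ m : ℕ, ((φ ((periplectic k p n).redGen χ 0
      (Submodule.inclusion (cartanSub_le k p n 0) H))) ^ m) v =
        weightOfCoords k p c H ^ m • v := by
    intro m
    induction m with
    | zero => simp
    | succ m ih => rw [pow_succ', Module.End.mul_apply, ih, map_smul, hcart, smul_smul, pow_succ]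
  have hpm := hcart ((cartanSub k p n).pmap H)
  rw [LinearMap.sub_apply, hpow, ← map_pow (algebraMap k (Module.End k V)),
    Module.algebraMap_end_apply] at h
  have h5 : (periplectic k p n).pmap (Submodule.inclusion (cartanSub_le k p n 0) H) =
      Submodule.inclusion (cartanSub_le k p n 0) ((cartanSub k p n).pmap H) := rfl
  rw [h5, hpm, ← sub_smul, ← sub_eq_zero, ← sub_smul] at h
  exact sub_eq_zero.1 ((smul_eq_zero.1 h).resolve_right hv0)

end Rep

/-! ### Irreducible modules are quotients of baby Verma modules -/

/-- The homogeneous components of an eigenvector of the Borel subalgebra are eigenvectors. -/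
theorem homogeneous_of_borel_eigen {χ : Module.Dual k ((periplectic k p n).part 0)}
    {μ : Module.Dual k ((cartanSub k p n).part 0)}
    {M : Type v} [AddCommGroup M] [Module k M] [Module (RedEnv (periplectic k p n) χ) M]
    {ℳ : ZMod 2 → Submodule k M} (hℳ : IsSupermodule (periplectic k p n) χ ℳ)
    (hdisj : ∀ x ∈ ℳ 0, x ∈ ℳ 1 → x = 0) {v₀ v₁ : M} (h₀ : v₀ ∈ ℳ 0) (h₁ : v₁ ∈ ℳ 1)
    (hv : ∀ i (x : (borelSub k p n).part i),
      (periplectic k p n).redGen χ i (Submodule.inclusion (borelSub_le k p n i) x) • (v₀ + v₁) =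
        μ (borelProj p i x) • (v₀ + v₁)) (i : ZMod 2) (x : (borelSub k p n).part i) :
    (periplectic k p n).redGen χ i (Submodule.inclusion (borelSub_le k p n i) x) • v₀ =
        μ (borelProj p i x) • v₀ ∧
    (periplectic k p n).redGen χ i (Submodule.inclusion (borelSub_le k p n i) x) • v₁ =
        μ (borelProj p i x) • v₁ := by
  have key : ∀ i : ZMod 2, i = 0 ∨ i = 1 := by decide
  have h := hv i x
  have m₀ := hℳ.smul_mem i 0 _ _ (redGen_mem_redPart _ χ i
    (Submodule.inclusion (borelSub_le k p n i) x)) h₀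
  have m₁ := hℳ.smul_mem i 1 _ _ (redGen_mem_redPart _ χ i
    (Submodule.inclusion (borelSub_le k p n i) x)) h₁
  rw [smul_add, smul_add] at h
  rcases key i with rfl | rfl
  · rw [zero_add] at m₀ m₁
    generalize (periplectic k p n).redGen χ 0
      (Submodule.inclusion (borelSub_le k p n 0) x) = T at *
    generalize μ (borelProj p 0 x) = c at *
    have h3 : T • v₀ - c • v₀ = c • v₁ - T • v₁ := by
      rw [sub_eq_sub_iff_add_eq_add, h, add_comm]
    have h4 := hdisj _ (sub_mem m₀ (Submodule.smul_mem _ c h₀))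
      (h3 ▸ sub_mem (Submodule.smul_mem _ c h₁) m₁)
    rw [h4] at h3
    exact ⟨sub_eq_zero.1 h4, (sub_eq_zero.1 h3.symm).symm⟩
  · rw [show (1 + 1 : ZMod 2) = 0 by decide] at m₁
    rw [add_zero] at m₀
    rw [borelProj_odd, map_zero, zero_smul, zero_smul, zero_add] at h
    generalize (periplectic k p n).redGen χ 1
      (Submodule.inclusion (borelSub_le k p n 1) x) = T at *
    rw [borelProj_odd, map_zero, zero_smul, zero_smul]
    have h3 := eq_neg_of_add_eq_zero_left h
    have h4 := hdisj _ (h3 ▸ neg_mem m₁) m₀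
    exact ⟨h4, by rw [h4] at h3; exact neg_eq_zero.1 h3.symm⟩

theorem irreducible_is_quotient [IsAlgClosed k] (hp : 2 < p)
    (χ : Module.Dual k ((periplectic k p n).part 0)) (hχ : ∀ x ∈ nPlus k p n, χ x = 0)
    (M : Type v) [AddCommGroup M] [Module k M] [Module (RedEnv (periplectic k p n) χ) M]
    [IsScalarTower k (RedEnv (periplectic k p n) χ) M] (ℳ : ZMod 2 → Submodule k M)
    (hM : IsIrreducible (periplectic k p n) χ ℳ) :
    ∃ (μ : Module.Dual k ((cartanSub k p n).part 0)) (hμ : μ ∈ weights p χ)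
      (f : BabyVerma p χ hχ μ hμ →ₗ[RedEnv (periplectic k p n) χ] M) (d : ZMod 2),
        Function.Surjective f ∧
        ∀ (i : ZMod 2), ∀ z ∈ babyVermaPart p χ hχ μ hμ i, f z ∈ ℳ (i + d) := by
  have hodd : Odd p := (Fact.out : p.Prime).odd_of_ne_two hp.ne'
  have h2 : (2 : k) ≠ 0 := by
    have := (CharP.cast_eq_zero_iff k p 2).not.2 (Nat.not_dvd_of_pos_of_lt two_pos hp)
    simpa using this
  have := hM.nontrivial
  have hcompl := (DirectSum.isInternal_submodule_iff_isCompl ℳ (i := 0) (j := 1) (by decide)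
      (by ext i; revert i; decide)).1 hM.isInternal
  have hdisj : ∀ x ∈ ℳ 0, x ∈ ℳ 1 → x = 0 := Submodule.disjoint_def.1 hcompl.disjoint
  let φ : RedEnv (periplectic k p n) χ →ₐ[k] Module.End k M := Algebra.lsmul k k M
  obtain ⟨v, hv0, c, hv⟩ := (repOfHom φ).exists_isHighestWeight h2 (by omega : 1 < p)
    (fun a b hab => repOfHom_E_pow φ hodd (by omega) hab.ne
      (hχ _ (Submodule.subset_span ⟨a, b, hab, rfl⟩)))
    (fun a => repOfHom_E_pow_sub φ hodd a)
  have hμ := weightOfCoords_mem_weights φ h2 hv0 hv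
  have hvB : ∀ i (x : (borelSub k p n).part i),
      (periplectic k p n).redGen χ i (Submodule.inclusion (borelSub_le k p n i) x) • v =
        weightOfCoords k p c (borelProj p i x) • v := repOfHom_borel_apply φ h2 hv
  obtain ⟨v₀, h₀, v₁, h₁, rfl⟩ := Submodule.mem_sup.1
    (hcompl.sup_eq_top ▸ Submodule.mem_top : v ∈ ℳ 0 ⊔ ℳ 1)
  have hvB' := homogeneous_of_borel_eigen hM.toIsSupermodule hdisj h₀ h₁ hvB
  obtain ⟨d, v, hvd, hv0, hvB⟩ : ∃ (d : ZMod 2) (v : M), v ∈ ℳ d ∧ v ≠ 0 ∧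
      ∀ i (x : (borelSub k p n).part i),
        (periplectic k p n).redGen χ i (Submodule.inclusion (borelSub_le k p n i) x) • v =
          weightOfCoords k p c (borelProj p i x) • v := by
    by_cases h : v₀ = 0
    · refine ⟨1, v₁, h₁, ?_, fun i x => (hvB' i x).2⟩
      rintro rfl
      exact hv0 (by rw [h, add_zero])
    · exact ⟨0, v₀, h₀, h, fun i x => (hvB' i x).1⟩
  obtain ⟨f, hf⟩ := exists_verma_hom χ hχ (weightOfCoords k p c) hμ v hvB
  have hfpart : ∀ (i : ZMod 2), ∀ z ∈ babyVermaPart p χ hχ _ hμ i, f z ∈ ℳ (i + d) := by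
    rintro i _ ⟨w, hw, rfl⟩
    have := hf w
    rw [vermaMk] at this
    rw [this]
    exact hM.smul_mem i d w v hw hvd
  refine ⟨_, hμ, f, d, ?_, hfpart⟩
  rw [← LinearMap.range_eq_top]
  refine (hM.eq_bot_or_eq_top _ ?_).resolve_left ?_
  · rintro _ ⟨z, rfl⟩
    obtain ⟨w, rfl⟩ := vermaMk_surjective χ hχ _ hμ z
    obtain ⟨w₀, hw₀, w₁, hw₁, rfl⟩ := exists_redPart_add _ χ w
    have e₀ := hfpart 0 (vermaMk χ hχ _ hμ w₀) ⟨w₀, hw₀, rfl⟩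
    have e₁ := hfpart 1 (vermaMk χ hχ _ hμ w₁) ⟨w₁, hw₁, rfl⟩
    have key : ∀ i : ZMod 2, i = 0 ∨ i = 1 := by decide
    rw [vermaMk_add, map_add]
    rcases key d with rfl | rfl
    · exact ⟨_, ⟨_, rfl⟩, _, ⟨_, rfl⟩, e₀, e₁, rfl⟩
    · exact ⟨_, ⟨_, rfl⟩, _, ⟨_, rfl⟩, e₁, e₀, add_comm _ _⟩
  · intro h
    apply hv0
    have h1 : f (vermaMk χ hχ _ hμ 1) ∈ LinearMap.range f := ⟨_, rfl⟩
    rw [h, Submodule.mem_bot, hf, one_smul] at h1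
    exact h1

end Periplectic
end

noncomputable section

/-! ### Triangular matrices with distinct diagonal entries -/

section Triangular

variable {k : Type*} [Field k] {n : ℕ}

theorem mul_diag_of_upper {A B : Matrix (Fin n) (Fin n) k} (hA : ∀ a b, b < a → A a b = 0)
    (hB : ∀ a b, b < a → B a b = 0) (i : Fin n) : (A * B) i i = A i i * B i i := by
  rw [Matrix.mul_apply]
  refine Finset.sum_eq_single i (fun l _ hl => ?_) (by simp)
  rcases lt_or_gt_of_ne hl with h | h
  · rw [hA i l h, zero_mul]
  · rw [hB l i h, mul_zero]

/-- An upper triangular matrix with distinct diagonal entries is diagonalized by an upper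
unitriangular matrix. -/
theorem exists_unitriangular_diagonalization {D : Matrix (Fin n) (Fin n) k}
    (hD : ∀ a b, b < a → D a b = 0) (hinj : Function.Injective fun a => D a a) :
    ∃ u w : Matrix (Fin n) (Fin n) k, (∀ a b, b < a → u a b = 0) ∧ (∀ a b, b < a → w a b = 0) ∧
      (∀ a, u a a = 1) ∧ (∀ a, w a a = 1) ∧ w * u = 1 ∧ u * w = 1 ∧
      w * D * u = Matrix.diagonal fun a => D a a := by
  classical
  -- an eigenvector for `D j j` is the solution of `N j y = e_j`
  let N : Fin n → Matrix (Fin n) (Fin n) k := fun j =>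
    D - Matrix.scalar (Fin n) (D j j) + Matrix.single j j 1
  have hNup : ∀ j a b, b < a → N j a b = 0 := by
    intro j a b hab
    simp only [N, Matrix.add_apply, Matrix.sub_apply, hD a b hab, Matrix.scalar_apply,
      Matrix.diagonal_apply_ne _ hab.ne', Matrix.single_apply]
    rw [if_neg (by rintro ⟨rfl, rfl⟩; exact lt_irrefl _ hab)]
    simp
  have hNd : ∀ j a, N j a a ≠ 0 := by
    intro j a
    simp only [N, Matrix.add_apply, Matrix.sub_apply, Matrix.scalar_apply,
      Matrix.diagonal_apply_eq, Matrix.single_apply]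
    by_cases h : j = a
    · subst h; simp
    · simp only [h, false_and, if_false, add_zero]
      exact sub_ne_zero.2 fun h' => h (hinj h').symm
  have hNdet : ∀ j, IsUnit (N j).det := by
    intro j
    rw [Matrix.det_of_isUpperTriangular (fun a b h => hNup j a b h)]
    exact (Finset.prod_ne_zero_iff.2 fun a _ => hNd j a).isUnit
  have hinv : ∀ M : Matrix (Fin n) (Fin n) k, IsUnit M.det → (∀ a b, b < a → M a b = 0) →
      ∀ a b, b < a → M⁻¹ a b = 0 := by
    intro M hM hup a b hab
    let _ := Matrix.invertibleOfIsUnitDet M hM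
    exact Matrix.blockTriangular_inv_of_blockTriangular (b := id) (fun a b h => hup a b h) hab
  let u : Matrix (Fin n) (Fin n) k := Matrix.of fun i j => (N j)⁻¹ i j
  have huup : ∀ a b, b < a → u a b = 0 := fun a b hab => hinv _ (hNdet b) (hNup b) a b hab
  have hu1 : ∀ a, u a a = 1 := by
    intro a
    have h := mul_diag_of_upper (hNup a) (hinv _ (hNdet a) (hNup a)) a
    rw [Matrix.mul_nonsing_inv _ (hNdet a), Matrix.one_apply_eq] at h
    have h1 : N a a a = 1 := by simp [N]
    rw [h1, one_mul] at h
    exact h.symm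
  have hudet : IsUnit u.det := by
    rw [Matrix.det_of_isUpperTriangular (fun a b h => huup a b h)]
    simp [hu1]
  have hDu : D * u = u * Matrix.diagonal fun a => D a a := by
    ext i j
    have h := congrFun (congrFun (Matrix.mul_nonsing_inv _ (hNdet j)) i) j
    have h1 : (N j * (N j)⁻¹) i j = (D * u) i j - D j j * u i j +
        (if i = j then u j j else 0) := by
      simp only [N, add_mul, sub_mul, Matrix.add_apply, Matrix.sub_apply]
      congr 1
      · congr 1
        rw [Matrix.scalar_apply, Matrix.diagonal_mul]
        rfl
      · by_cases hij : i = j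
        · subst hij
          rw [if_pos rfl, Matrix.single_mul_apply_same, one_mul]
          rfl
        · rw [if_neg hij, Matrix.single_mul_apply_of_ne _ _ _ _ _ hij]
    rw [h1, hu1] at h
    rw [Matrix.mul_diagonal, mul_comm]
    rw [Matrix.one_apply] at h
    exact sub_eq_zero.1 (add_eq_right.1 h)
  have hwup := hinv u hudet huup
  refine ⟨u, u⁻¹, huup, hwup, hu1, fun a => ?_, Matrix.nonsing_inv_mul _ hudet,
    Matrix.mul_nonsing_inv _ hudet, ?_⟩
  · have h := mul_diag_of_upper huup hwup a
    rw [Matrix.mul_nonsing_inv _ hudet, Matrix.one_apply_eq, hu1, one_mul] at h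
    exact h.symm
  · rw [mul_assoc, hDu, ← mul_assoc, Matrix.nonsing_inv_mul _ hudet, one_mul]

/-- An upper triangular matrix that is similar to a diagonal matrix with distinct entries has
distinct diagonal entries. -/
theorem diag_injective_of_conj {D : Matrix (Fin n) (Fin n) k} (hD : ∀ a b, b < a → D a b = 0)
    (g : GL (Fin n) k) {d : Fin n → k} (hd : Function.Injective d)
    (h : g.1 * D * (g⁻¹).1 = Matrix.diagonal d) : Function.Injective fun a => D a a := by
  have h1 : D.charpoly = (Matrix.diagonal d).charpoly := by
    rw [← h, Matrix.coe_units_inv]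
    exact (Matrix.charpoly_units_conj g D).symm
  have hdiag : (Matrix.diagonal d).IsUpperTriangular := fun a b h =>
    Matrix.diagonal_apply_ne _ (ne_of_gt h)
  rw [Matrix.charpoly_of_isUpperTriangular D (fun a b h => hD a b h),
    Matrix.charpoly_of_isUpperTriangular _ hdiag] at h1
  have h2 := congrArg Polynomial.roots h1
  simp only [Matrix.diagonal_apply_eq] at h2
  rw [Polynomial.roots_prod _ _ (Finset.prod_ne_zero_iff.2 fun _ _ => Polynomial.X_sub_C_ne_zero _),
    Polynomial.roots_prod _ _ (Finset.prod_ne_zero_iff.2 fun _ _ => Polynomial.X_sub_C_ne_zero _)]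
    at h2
  simp only [Polynomial.roots_X_sub_C, Multiset.bind_singleton] at h2
  have h3 : (Multiset.map (fun a => D a a) Finset.univ.val).Nodup := by
    rw [h2]
    exact Multiset.Nodup.map hd Finset.univ.nodup
  intro a b hab
  exact Multiset.inj_on_of_nodup_map h3 a (Finset.mem_univ a) b (Finset.mem_univ b) hab

end Triangular

namespace Periplectic

open RestrictedSubalgebra

variable {k : Type u} [Field k] {p n : ℕ} [Fact p.Prime] [CharP k p]

/-! ### Irreducibility of the baby Verma modules -/

/-- The matrix `D` with `χ(A) = tr(D A)`. -/
def charMatrix (χ : Module.Dual k ((periplectic k p n).part 0)) : Matrix (Fin n) (Fin n) k :=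
  Matrix.of fun a b => χ (evenIso k p n (Matrix.single b a 1))

theorem chi_evenIso (χ : Module.Dual k ((periplectic k p n).part 0))
    (A : Matrix (Fin n) (Fin n) k) : χ (evenIso k p n A) = (charMatrix χ * A).trace := by
  conv_lhs => rw [Matrix.matrix_eq_sum_single A]
  simp only [map_sum, Matrix.trace, Matrix.diag_apply, Matrix.mul_apply]
  rw [Finset.sum_comm]
  refine Finset.sum_congr rfl fun b _ => Finset.sum_congr rfl fun a _ => ?_
  have h : Matrix.single a b (A a b) = A a b • Matrix.single a b (1 : k) := by
    rw [Matrix.smul_single, smul_eq_mul, mul_one]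
  rw [h, map_smul, map_smul, smul_eq_mul, mul_comm]
  rfl

theorem trace_mul_single (D : Matrix (Fin n) (Fin n) k) (a b : Fin n) :
    (D * Matrix.single a b 1).trace = D b a := by
  rw [Matrix.trace_mul_single]
  simp

/-- If `χ` vanishes on `n⁺` and is regular semisimple, its matrix has distinct diagonal entries: they
are the roots of the characteristic polynomial, which is invariant under conjugation. -/
theorem diag_charMatrix_injective {χ : Module.Dual k ((periplectic k p n).part 0)}
    (hup : ∀ a b, b < a → charMatrix χ a b = 0) (h : IsRegularSemisimple p χ) :
    Function.Injective fun a => charMatrix χ a a := by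
  obtain ⟨g, hplus, hminus, hne⟩ := h
  have hco : ∀ A, coadAction p g χ (evenIso k p n A) =
      ((g.1 * charMatrix χ * (g⁻¹).1) * A).trace := by
    intro A
    have h1 : adAction p g⁻¹ (evenIso k p n A) = evenIso k p n ((g⁻¹).1 * A * g.1) := by
      apply Subtype.ext
      change barMat g⁻¹ * evenMat A * barMat g⁻¹⁻¹ = evenMat _
      rw [inv_inv]
      simp [barMat, evenMat, Matrix.fromBlocks_multiply, Matrix.transpose_mul, Matrix.mul_assoc]
    rw [coadAction, LinearMap.comp_apply, h1, chi_evenIso]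
    rw [← Matrix.mul_assoc, Matrix.trace_mul_comm]
    simp only [Matrix.mul_assoc]
  have hE : ∀ a b, coadAction p g χ (evenIso k p n (Matrix.single a b 1)) =
      (g.1 * charMatrix χ * (g⁻¹).1) b a := fun a b => by rw [hco, trace_mul_single]
  refine diag_injective_of_conj hup g (d := fun a => (g.1 * charMatrix χ * (g⁻¹).1) a a) ?_ ?_
  · have hne' : ∀ i j : Fin n, i < j → (g.1 * charMatrix χ * (g⁻¹).1) i i ≠
        (g.1 * charMatrix χ * (g⁻¹).1) j j := by
      intro i j hij h
      refine hne i j hij ?_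
      rw [map_sub, cartanElt, cartanElt, hE, hE, h, sub_self]
    intro i j hij
    rcases lt_trichotomy i j with h | h | h
    · exact absurd hij (hne' i j h)
    · exact h
    · exact absurd hij.symm (hne' j i h)
  · ext a b
    rcases lt_trichotomy a b with h | h | h
    · rw [Matrix.diagonal_apply_ne _ h.ne, ← hE]
      exact hminus _ (Submodule.subset_span ⟨b, a, h, rfl⟩)
    · subst h
      rw [Matrix.diagonal_apply_eq]
    · rw [Matrix.diagonal_apply_ne _ h.ne', ← hE]
      exact hplus _ (Submodule.subset_span ⟨b, a, h, rfl⟩)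

/-- The element `Hₐ` of the Cartan subalgebra. -/
def cartanBasisElt (a : Fin n) : (cartanSub k p n).part 0 :=
  ⟨evenMat (Matrix.single a a 1), (mem_even_iff _).2 ⟨_, rfl⟩, by
    rintro (i | i) (j | j) hij <;> simp [evenMat, Matrix.single_apply] <;> grind⟩

section Verma

variable (χ : Module.Dual k ((periplectic k p n).part 0)) (hχ : ∀ x ∈ nPlus k p n, χ x = 0)
  (μ : Module.Dual k ((cartanSub k p n).part 0)) (hμ : μ ∈ weights p χ)

theorem redGen_smul_vermaMk_one (i : ZMod 2) (x : (borelSub k p n).part i) :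
    (periplectic k p n).redGen χ i (Submodule.inclusion (borelSub_le k p n i) x) •
      vermaMk χ hχ μ hμ 1 = μ (borelProj p i x) • vermaMk χ hχ μ hμ 1 := by
  rw [smul_vermaMk, mul_one, ← one_mul ((periplectic k p n).redGen χ i _), ← redMap_redGen,
    vermaMk_mul_redMap, borelChar_redGen]

/-- The generator of `Z_χ(μ)` is a highest weight vector. -/
theorem vermaMk_one_isHighestWeight :
    (repOfHom (χ := χ) (Algebra.lsmul k k (BabyVerma p χ hχ μ hμ))).IsHighestWeight
      (vermaMk χ hχ μ hμ 1) (fun a => μ (cartanBasisElt a)) := by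
  have hmem : ∀ a b : Fin n, a ≤ b → evenMat (Matrix.single a b (1 : k)) ∈
      (borelSub k p n).part 0 := by
    refine fun a b hab => ⟨(mem_even_iff _).2 ⟨_, rfl⟩, fun i j hij => ?_, fun i j => ?_⟩
    · have : ¬ (a = i ∧ b = j) := by rintro ⟨rfl, rfl⟩; exact absurd hab hij.not_ge
      simp [evenMat, this]
    · simp [evenMat]
  refine ⟨fun a b hab => ?_, fun a => ?_, fun B => ?_⟩
  · refine (redGen_smul_vermaMk_one χ hχ μ hμ 0 ⟨_, hmem a b hab.le⟩).trans ?_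
    have h : borelProj p 0 ⟨_, hmem a b hab.le⟩ = 0 := by
      refine cartanSub_ext p fun i => ?_
      rw [borelProj_apply_inl]
      have : ¬ (a = i ∧ b = i) := by rintro ⟨rfl, rfl⟩; exact lt_irrefl _ hab
      simp [evenMat, this]
    rw [h, map_zero, zero_smul]
  · refine (redGen_smul_vermaMk_one χ hχ μ hμ 0 ⟨_, hmem a a le_rfl⟩).trans ?_
    have h : borelProj p 0 ⟨_, hmem a a le_rfl⟩ = cartanBasisElt a := by
      refine cartanSub_ext p fun i => ?_
      rw [borelProj_apply_inl]
      rfl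
    rw [h]
  · have hB : (symIso k p n B).1 ∈ (borelSub k p n).part 1 :=
      ⟨(symIso k p n B).2, fun i j _ => by simp [symIso], fun i j => by simp [symIso]⟩
    refine (redGen_smul_vermaMk_one χ hχ μ hμ 1 ⟨_, hB⟩).trans ?_
    rw [borelProj_odd, map_zero, zero_smul]

/-- On the toral basis element `H_a`, the condition defining `Λ(χ)` is `c ^ p - c = χ(H_a) ^ p`. -/
theorem pow_sub_weight_cartanBasisElt (hp : 2 < p) (μ : Module.Dual k ((cartanSub k p n).part 0))
    (hμ : μ ∈ weights p χ) (a : Fin n) :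
    μ (cartanBasisElt a) ^ p - μ (cartanBasisElt a) = χ (cartanElt k p a) ^ p := by
  have h := hμ (cartanBasisElt a)
  have h1 : (cartanSub k p n).pmap (cartanBasisElt a) = cartanBasisElt a := by
    apply Subtype.ext
    change evenMat _ ^ p = evenMat _
    rw [evenMat_pow ((Fact.out : p.Prime).odd_of_ne_two hp.ne'), single_diag_pow a (by omega)]
  rwa [h1] at h

/-- If the weights of `χ` are distinct, the weights in `Λ(χ)` have no integral differences. -/
theorem weight_sub_ne_int (hinj : Function.Injective fun a => charMatrix χ a a)
    {c : Fin n → k} (hc : ∀ a, c a ^ p - c a = χ (cartanElt k p a) ^ p) {a b : Fin n} (hab : a ≠ b)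
    (z : ℤ) : c a - c b + z ≠ 0 := by
  intro h
  have h1 : c a = c b - z := by rw [← sub_eq_zero, ← h]; ring
  have hz : (z : k) ^ p = z := by
    have := map_intCast (frobenius k p) z
    rwa [frobenius_def] at this
  have h2 := hc a
  rw [h1, sub_pow_char, hz] at h2
  have h3 : χ (cartanElt k p a) ^ p = χ (cartanElt k p b) ^ p := by
    rw [← h2, ← hc b]; ring
  exact hab (hinj (frobenius_inj k p h3))

/-- A subspace stable under the operators of `repOfHom` is a submodule. -/
theorem smul_mem_of_rep_stable (h2 : (2 : k) ≠ 0) {M : Type v} [AddCommGroup M] [Module k M]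
    [Module (RedEnv (periplectic k p n) χ) M] [IsScalarTower k (RedEnv (periplectic k p n) χ) M]
    {Q : Submodule k M}
    (hE : ∀ A, ∀ x ∈ Q, (repOfHom (χ := χ) (Algebra.lsmul k k M)).even A x ∈ Q)
    (hS : ∀ A, ∀ x ∈ Q, (repOfHom (χ := χ) (Algebra.lsmul k k M)).sym A x ∈ Q)
    (hC : ∀ A, ∀ x ∈ Q, (repOfHom (χ := χ) (Algebra.lsmul k k M)).skew A x ∈ Q)
    (w : RedEnv (periplectic k p n) χ) (x : M) (hx : x ∈ Q) : w • x ∈ Q := by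
  have key : ∀ i : ZMod 2, i = 0 ∨ i = 1 := by decide
  induction w using redEnv_induction generalizing x with
  | hgen i y =>
    rcases key i with rfl | rfl
    · obtain ⟨A, rfl⟩ := exists_evenIso y
      exact hE A x hx
    · obtain ⟨B, C, rfl⟩ := exists_symIso_add_skewIso h2 y
      rw [map_add, add_smul]
      exact add_mem (hS B x hx) (hC C x hx)
  | hscalar c =>
    rw [algebraMap_smul]
    exact Submodule.smul_mem _ _ hx
  | hadd a b ha hb =>
    rw [add_smul]
    exact add_mem (ha x hx) (hb x hx)
  | hmul a b ha hb =>
    rw [mul_smul]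
    exact ha _ (hb x hx)

/-- Every nonzero submodule of `Z_χ(μ)` is the whole module if `χ` is regular semisimple. -/
theorem babyVerma_eq_top (hp : 2 < p) (hreg : IsRegularSemisimple p χ)
    (W : Submodule (RedEnv (periplectic k p n) χ) (BabyVerma p χ hχ μ hμ)) (hW : W ≠ ⊥) :
    W = ⊤ := by
  have hodd : Odd p := (Fact.out : p.Prime).odd_of_ne_two hp.ne'
  have h2 : (2 : k) ≠ 0 := by
    have := (CharP.cast_eq_zero_iff k p 2).not.2 (Nat.not_dvd_of_pos_of_lt two_pos hp)
    simpa using this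
  have hup : ∀ a b, b < a → charMatrix χ a b = 0 := fun a b hab =>
    hχ _ (Submodule.subset_span ⟨b, a, hab, rfl⟩)
  have hinj := diag_charMatrix_injective hup hreg
  obtain ⟨u, w, huup, hwup, hu1, hw1, hwu, huw, hdiag⟩ :=
    exists_unitriangular_diagonalization hup hinj
  let ρ := repOfHom (χ := χ) (Algebra.lsmul k k (BabyVerma p χ hχ μ hμ))
  have hv := vermaMk_one_isHighestWeight χ hχ μ hμ
  let ρ' := ρ.twist u w hwu
  have hE' : ∀ a b, ρ'.E a b = ρ.even (u * Matrix.single a b 1 * w) := fun a b => rfl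
  -- the entries of a conjugated matrix unit
  have hconj : ∀ a b i j : Fin n, (u * Matrix.single a b (1 : k) * w) i j = u i a * w b j := by
    intro a b i j
    rw [Matrix.mul_apply, Finset.sum_eq_single b]
    · rw [Matrix.mul_single_apply_same, mul_one]
    · intro l _ hl
      rw [Matrix.mul_single_apply_of_ne _ _ _ _ _ hl, zero_mul]
    · intro h
      exact absurd (Finset.mem_univ b) h
  have hconj_up : ∀ a b : Fin n, a ≤ b → ∀ i j, j < i →
      (u * Matrix.single a b (1 : k) * w) i j = 0 := by
    intro a b hab i j hji
    rw [hconj]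
    rcases lt_or_ge a i with h | h
    · rw [huup i a h, zero_mul]
    · rw [hwup b j (hji.trans_le (h.trans hab)), mul_zero]
  have hnil : ∀ a b, a ≠ b → ρ'.E a b ^ p = 0 := by
    intro a b hab
    have h0 : (u * Matrix.single a b (1 : k) * w) ^ p = 0 := by
      refine pow_eq_zero_of_le (show 2 ≤ p by omega) ?_
      have : (u * Matrix.single a b (1 : k) * w) ^ 2 =
          u * Matrix.single a b 1 * (w * u) * Matrix.single a b 1 * w := by
        rw [pow_two]; simp only [Matrix.mul_assoc]
      rw [this, hwu, mul_one, mul_assoc u, Matrix.single_mul_single_of_ne _ _ _ _ hab.symm,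
        mul_zero, zero_mul]
    -- `χ` takes the value `tr (w D u E_{a,b})` here, and `w D u` is diagonal
    have h1 : χ (evenIso k p n (u * Matrix.single a b 1 * w)) = 0 := by
      rw [chi_evenIso, ← mul_assoc, Matrix.trace_mul_comm, ← mul_assoc, ← mul_assoc, hdiag,
        trace_mul_single, Matrix.diagonal_apply_ne _ hab.symm]
    rw [hE', repOfHom_even_pow _ hodd, h0, h1, map_zero, zero_pow (by omega), map_zero, add_zero]
  -- conjugation by unitriangular matrices keeps the diagonal of upper triangular ones
  have hv' : ρ'.IsHighestWeight (vermaMk χ hχ μ hμ 1) (fun a => μ (cartanBasisElt a)) := by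
    refine ⟨fun a b hab => ?_, fun a => ?_, fun B => hv.sym _⟩
    · rw [hE', hv.even_apply (hconj_up a b hab.le)]
      rw [Finset.sum_eq_zero, zero_smul]
      intro i _
      rw [hconj]
      rcases lt_or_ge a i with h | h
      · rw [huup i a h, zero_mul, mul_zero]
      · rw [hwup b i (h.trans_lt hab), mul_zero, mul_zero]
    · rw [hE', hv.even_apply (hconj_up a a le_rfl)]
      congr 1
      rw [Finset.sum_eq_single a]
      · rw [hconj, hu1, hw1, mul_one, mul_one]
      · intro i _ hia
        rw [hconj]
        rcases lt_or_gt_of_ne hia with h | h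
        · rw [hwup a i h, mul_zero, mul_zero]
        · rw [huup i a h, zero_mul, mul_zero]
      · intro h
        exact absurd (Finset.mem_univ a) h
  have hcp := pow_sub_weight_cartanBasisElt χ hp μ hμ
  have huwT : w.transpose * u.transpose = 1 := by
    rw [← Matrix.transpose_mul, huw, Matrix.transpose_one]
  have hback : ∀ Q : Submodule k (BabyVerma p χ hχ μ hμ), vermaMk χ hχ μ hμ 1 ∈ Q →
      (∀ A, ∀ x ∈ Q, ρ'.even A x ∈ Q) → (∀ A, ∀ x ∈ Q, ρ'.sym A x ∈ Q) →
      (∀ A, ∀ x ∈ Q, ρ'.skew A x ∈ Q) → Q = ⊤ := by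
    intro Q hvQ hE hS hC
    rw [eq_top_iff]
    intro z _
    obtain ⟨r, rfl⟩ := vermaMk_surjective χ hχ μ hμ z
    have h1 : vermaMk χ hχ μ hμ r = r • vermaMk χ hχ μ hμ 1 := by rw [smul_vermaMk, mul_one]
    rw [h1]
    refine smul_mem_of_rep_stable χ h2 (fun A x hx => ?_) (fun A x hx => ?_) (fun A x hx => ?_)
      r _ hvQ
    · have h := hE (w * A * u) x hx
      have h3 : u * (w * A * u) * w = A := by
        calc _ = (u * w) * A * (u * w) := by simp only [Matrix.mul_assoc]
          _ = A := by rw [huw, one_mul, mul_one]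
      change ρ.even (u * (w * A * u) * w) x ∈ Q at h
      rwa [h3] at h
    · have h := hS (w * A * w.transpose) x hx
      have h3 : u * (w * A * w.transpose) * u.transpose = A := by
        calc _ = (u * w) * A * (w.transpose * u.transpose) := by simp only [Matrix.mul_assoc]
          _ = A := by rw [huw, huwT, one_mul, mul_one]
      change ρ.sym (u * (w * A * w.transpose) * u.transpose) x ∈ Q at h
      rwa [h3] at h
    · have h := hC (u.transpose * A * u) x hx
      have h3 : w.transpose * (u.transpose * A * u) * w = A := by
        calc _ = (w.transpose * u.transpose) * A * (u * w) := by simp only [Matrix.mul_assoc]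
          _ = A := by rw [huw, huwT, one_mul, mul_one]
      change ρ.skew (w.transpose * (u.transpose * A * u) * w) x ∈ Q at h
      rwa [h3] at h
  have hWst : ∀ (r : RedEnv (periplectic k p n) χ) (x : BabyVerma p χ hχ μ hμ),
      x ∈ W.restrictScalars k → r • x ∈ W.restrictScalars k := fun r x hx => W.smul_mem r hx
  have htop := ρ'.eq_top_of_isHighestWeight h2 hv' hnil
    (fun a b hab z => weight_sub_ne_int χ hinj hcp hab z) hback
    (W.restrictScalars k) (by simpa using hW)
    (fun A x hx => hWst _ x hx) (fun A x hx => hWst _ x hx) (fun A x hx => hWst _ x hx)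
  simpa using htop

end Verma

end Periplectic
end

/-! ### Jacobson's formula -/

section Jacobson

open Polynomial

theorem choose_pred_prime_cast (k : Type*) [Field k] (p : ℕ) [Fact p.Prime] [CharP k p] {i : ℕ}
    (hi : i < p) : (((p - 1).choose i : ℕ) : k) = (-1) ^ i := by
  have hp : p.Prime := Fact.out
  induction i with
  | zero => simp
  | succ i ih =>
    have h1 : p.choose (i + 1) = (p - 1).choose i + (p - 1).choose (i + 1) := by
      conv_lhs => rw [← Nat.sub_add_cancel hp.one_le]
      exact Nat.choose_succ_succ' _ _
    have h2 : ((p.choose (i + 1) : ℕ) : k) = 0 :=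
      (CharP.cast_eq_zero_iff k p _).2 (hp.dvd_choose_self (Nat.succ_ne_zero i) hi)
    rw [h1, Nat.cast_add, ih (by omega)] at h2
    rw [pow_succ, mul_neg_one]
    exact eq_neg_of_add_eq_zero_right h2

variable {k : Type*} [Field k] {p : ℕ} [Fact p.Prime] [CharP k p]

/-- In characteristic `p`, `(L - R)^{p-1} = ∑ L^i R^{p-1-i}` for commuting `L` and `R`. -/
theorem Commute.sub_pow_pred_prime {A : Type*} [Ring A] [Algebra k A] {L R : A}
    (h : Commute L R) : (L - R) ^ (p - 1) = ∑ i ∈ Finset.range p, L ^ i * R ^ (p - 1 - i) := by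
  have hp : p.Prime := Fact.out
  rw [sub_eq_add_neg, h.neg_right.add_pow, Nat.sub_add_cancel hp.one_le]
  refine Finset.sum_congr rfl fun i hi => ?_
  have hi' := Finset.mem_range.1 hi
  have h1 := congrArg (algebraMap k A) (choose_pred_prime_cast k p hi')
  rw [map_natCast, map_pow, map_neg, map_one] at h1
  rw [h1, neg_pow R, mul_assoc, mul_assoc, (Commute.neg_one_right (R ^ _)).pow_right i |>.eq,
    ← mul_assoc ((-1) ^ _), ← pow_add, Nat.sub_add_cancel (by omega)]
  have h2 := congrArg (algebraMap k A) (choose_pred_prime_cast k p (i := p - 1) (by omega))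
  rw [Nat.choose_self, Nat.cast_one, map_one, map_pow, map_neg, map_one] at h2
  rw [← h2, one_mul]

theorem sum_pow_mul_pow_eq_commutator_iterate {A : Type*} [Ring A] [Algebra k A] (f g : A) :
    ∑ i ∈ Finset.range p, f ^ i * g * f ^ (p - 1 - i) = (fun g => f * g - g * f)^[p - 1] g := by
  have h := Commute.sub_pow_pred_prime (k := k) (p := p)
    (LinearMap.commute_mulLeft_right (R := k) f f)
  have h1 := congrArg (fun T : Module.End k A => T g) h
  have h2 : ⇑(LinearMap.mulLeft k f - LinearMap.mulRight k f) = fun g => f * g - g * f := by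
    ext g; simp
  rw [Module.End.pow_apply, h2] at h1
  rw [h1, LinearMap.sum_apply]
  refine Finset.sum_congr rfl fun i _ => ?_
  rw [Module.End.mul_apply, LinearMap.pow_mulLeft, LinearMap.pow_mulRight, LinearMap.mulLeft_apply,
    LinearMap.mulRight_apply, mul_assoc]

/-- The coefficient of `t^i` in the `m`-fold commutator `[x + t y, [x + t y, … [x + t y, y]]]`. -/
def commutatorCoeff {A : Type*} [Ring A] (x y : A) : ℕ → ℕ → A
  | 0, i => if i = 0 then y else 0
  | m + 1, 0 => x * commutatorCoeff x y m 0 - commutatorCoeff x y m 0 * x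
  | m + 1, i + 1 => (x * commutatorCoeff x y m (i + 1) - commutatorCoeff x y m (i + 1) * x) +
      (y * commutatorCoeff x y m i - commutatorCoeff x y m i * y)

theorem coeff_commutator_iterate {A : Type*} [Ring A] (x y : A) (m i : ℕ) :
    ((fun g : A[X] => (C x + C y * X) * g - g * (C x + C y * X))^[m] (C y)).coeff i =
      commutatorCoeff x y m i := by
  induction m generalizing i with
  | zero => simp [commutatorCoeff, coeff_C]
  | succ m ih =>
    rw [Function.iterate_succ_apply']
    generalize (fun g : A[X] => (C x + C y * X) * g - g * (C x + C y * X))^[m] (C y) = g at ih ⊢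
    have h1 : (C x + C y * X) * g - g * (C x + C y * X) =
        (C x * g - g * C x) + (C y * g - g * C y) * X := by
      rw [add_mul, mul_add, mul_assoc (C y) X g, X_mul, sub_mul, mul_assoc (C y) g X,
        mul_assoc g (C y) X]
      abel
    rw [h1]
    cases i with
    | zero => simp [commutatorCoeff, ih]
    | succ i => simp [commutatorCoeff, ih]

theorem map_commutatorCoeff {A B : Type*} [Ring A] [Ring B] (φ : B →+ A)
    (hφ : ∀ X Y, φ X * φ Y - φ Y * φ X = φ (X * Y - Y * X)) (x y : B) (m i : ℕ) :
    φ (commutatorCoeff x y m i) = commutatorCoeff (φ x) (φ y) m i := by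
  induction m generalizing i with
  | zero =>
    simp only [commutatorCoeff]
    split_ifs <;> simp
  | succ m ih =>
    cases i with
    | zero => simp only [commutatorCoeff, ← hφ, ih]
    | succ i => simp only [commutatorCoeff, ← hφ, ih, map_add]

theorem derivative_pow_eq_sum {A : Type*} [Ring A] (f : A[X]) (m : ℕ) :
    derivative (f ^ m) = ∑ i ∈ Finset.range m, f ^ i * derivative f * f ^ (m - 1 - i) := by
  induction m with
  | zero => simp
  | succ m ih =>
    rw [pow_succ', derivative_mul, ih, Finset.sum_range_succ', Finset.mul_sum, add_comm]
    congr 1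
    · refine Finset.sum_congr rfl fun i _ => ?_
      rw [pow_succ', show m + 1 - 1 - (i + 1) = m - 1 - i by omega]
      simp only [mul_assoc]
    · simp

theorem coeff_linear_pow_succ {A : Type*} [Ring A] [Algebra k A] (x y : A) (i : ℕ) :
    ((C x + C y * X) ^ p).coeff (i + 1) * ((i : A) + 1) = commutatorCoeff x y (p - 1) i := by
  rw [← coeff_derivative, derivative_pow_eq_sum]
  have h1 : derivative (C x + C y * X) = C y := by simp
  rw [h1, sum_pow_mul_pow_eq_commutator_iterate (k := k), coeff_commutator_iterate]

/-- In characteristic `p`, `(x + y)^p - x^p - y^p` is a sum of iterated commutators. -/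
theorem add_pow_char_eq_add_commutators {A : Type*} [Ring A] [Algebra k A] (x y : A) :
    (x + y) ^ p = x ^ p + y ^ p +
      ∑ i ∈ Finset.range (p - 1), ((i : k) + 1)⁻¹ • commutatorCoeff x y (p - 1) i := by
  have hp : p.Prime := Fact.out
  let ev : A[X] →+* A := eval₂RingHom' (RingHom.id A) 1 fun a => Commute.one_right a
  have hdeg1 : (C x + C y * X : A[X]).natDegree ≤ 1 := by
    refine (natDegree_add_le _ _).trans (max_le (by simp) ?_)
    exact (natDegree_C_mul_le _ _).trans natDegree_X_le
  have hdeg : ((C x + C y * X : A[X]) ^ p).natDegree < p + 1 :=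
    Nat.lt_succ_of_le ((natDegree_pow_le_of_le p hdeg1).trans (by simp))
  have h1 : ev ((C x + C y * X) ^ p) = (x + y) ^ p := by
    rw [map_pow]
    congr 1
    simp [ev, eval₂RingHom']
  have h2 : ev ((C x + C y * X) ^ p) =
      ∑ i ∈ Finset.range (p + 1), ((C x + C y * X) ^ p).coeff i := by
    change eval₂ (RingHom.id A) 1 _ = _
    rw [eval₂_eq_sum_range' _ hdeg]
    simp
  rw [← h1, h2, Finset.sum_range_succ]
  have h3 : ((C x + C y * X) ^ p).coeff p = y ^ p := by
    have := coeff_pow_of_natDegree_le (m := p) hdeg1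
    rw [mul_one] at this
    rw [this]
    simp [coeff_C]
  have h4 : ∑ i ∈ Finset.range p, ((C x + C y * X) ^ p).coeff i = x ^ p +
      ∑ i ∈ Finset.range (p - 1), ((C x + C y * X) ^ p).coeff (i + 1) := by
    rw [← Nat.sub_add_cancel hp.one_le, Finset.sum_range_succ', Nat.sub_add_cancel hp.one_le,
      add_comm]
    congr 1
    have : ∀ f : A[X], f.coeff 0 = constantCoeff f := fun f => rfl
    rw [this, map_pow]
    simp
  rw [h3, h4, add_right_comm]
  congr 1
  refine Finset.sum_congr rfl fun i hi => ?_
  have hi' : ((i : k) + 1) ≠ 0 := by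
    have := (CharP.cast_eq_zero_iff k p (i + 1)).not.2
      (Nat.not_dvd_of_pos_of_lt (Nat.succ_pos i) (by have := Finset.mem_range.1 hi; omega))
    simpa using this
  rw [← coeff_linear_pow_succ (k := k)]
  have h5 : ((i : A) + 1) = algebraMap k A ((i : k) + 1) := by simp
  rw [h5, ← Algebra.commutes, ← Algebra.smul_def, smul_smul, inv_mul_cancel₀ hi', one_smul]

/-- For a Lie homomorphism `φ` between associative algebras of characteristic `p`, the map
`x ↦ φ(x)^p - φ(x^p)` is additive. -/
theorem pow_sub_map_pow_add {A B : Type*} [Ring A] [Algebra k A] [Ring B] [Algebra k B]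
    (φ : B →ₗ[k] A) (hφ : ∀ X Y, φ X * φ Y - φ Y * φ X = φ (X * Y - Y * X)) (x y : B) :
    φ (x + y) ^ p - φ ((x + y) ^ p) = (φ x ^ p - φ (x ^ p)) + (φ y ^ p - φ (y ^ p)) := by
  rw [add_pow_char_eq_add_commutators (k := k) x y, map_add φ x y, add_pow_char_eq_add_commutators (k := k) (φ x), map_add,
    map_add, map_sum]
  simp only [map_smul]
  have h : ∀ i, φ (commutatorCoeff x y (p - 1) i) = commutatorCoeff (φ x) (φ y) (p - 1) i :=
    map_commutatorCoeff φ.toAddMonoidHom hφ x y (p - 1)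
  simp only [h]
  abel

/-- `X (X - 1) ⋯ (X - p + 1) = X^p - X` in characteristic `p`. -/
theorem descPochhammer_prime (k : Type*) [Field k] (p : ℕ) [Fact p.Prime] [CharP k p] :
    descPochhammer k p = X ^ p - X := by
  have hp : p.Prime := Fact.out
  have h : descPochhammer (ZMod p) p = X ^ p - X := by
    have hm : (X ^ p - X : (ZMod p)[X]).Monic :=
      monic_X_pow_sub (by rw [degree_X]; exact_mod_cast hp.one_lt)
    have hd : (X ^ p - X : (ZMod p)[X]).degree = p := by
      rw [degree_sub_eq_left_of_degree_lt, degree_X_pow]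
      rw [degree_X_pow, degree_X]
      exact_mod_cast hp.one_lt
    have hd' : (descPochhammer (ZMod p) p).degree = p := by
      rw [degree_eq_natDegree (monic_descPochhammer _ _).ne_zero, descPochhammer_natDegree]
    refine eq_of_degree_sub_lt_of_eval_finset_eq Finset.univ ?_ fun c _ => ?_
    · rw [Finset.card_univ, ZMod.card, ← hd']
      refine degree_sub_lt_left (by rw [hd', hd]) (monic_descPochhammer _ _).ne_zero ?_
      rw [(monic_descPochhammer _ _).leadingCoeff, hm.leadingCoeff]
    · rw [← ZMod.natCast_zmod_val c, descPochhammer_eval_eq_descFactorial,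
        Nat.descFactorial_eq_zero_iff_lt.2 (ZMod.val_lt c)]
      simp [ZMod.pow_card]
  have h1 := congrArg (Polynomial.map (ZMod.castHom (dvd_refl p) k)) h
  rw [descPochhammer_map] at h1
  simpa using h1

/-- If `d a = a d + 1` in characteristic `p`, then `(a d)^p - a d = a^p d^p`. -/
theorem weyl_mul_pow_prime {A : Type*} [Ring A] [Algebra k A] {a d : A} (h : d * a = a * d + 1) :
    (a * d) ^ p - a * d = a ^ p * d ^ p := by
  have h1 : ∀ m : ℕ, (a * d) * d ^ m = d ^ m * (a * d - m) := by
    intro m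
    induction m with
    | zero => simp
    | succ m ih =>
      have h2 : a * d * d = d * (a * d - 1) := by
        have : d * (a * d) = a * d * d + d := by rw [← mul_assoc, h, add_mul, one_mul]
        rw [mul_sub, this]; simp
      rw [pow_succ', ← mul_assoc, h2, mul_assoc, sub_mul, ih, one_mul, mul_assoc]
      congr 1
      push_cast
      rw [← sub_sub, mul_sub (d ^ m) _ (1 : A), mul_one]
  have h3 : ∀ m : ℕ, a ^ m * d ^ m = aeval (a * d) (descPochhammer k m) := by
    intro m
    induction m with
    | zero => simp
    | succ m ih =>
      rw [descPochhammer_succ_right, map_mul, ← ih, pow_succ, pow_succ', mul_assoc, ← mul_assoc a,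
        h1, ← mul_assoc]
      simp
  rw [h3, descPochhammer_prime]
  simp

end Jacobson

noncomputable section

/-! ### Superoscillators and `gl(n|n)` -/

theorem superSign_comm (k : Type u) [Field k] (i j : ZMod 2) : superSign k i j = superSign k j i := by
  simp only [superSign, and_comm]

theorem superSign_add_left (k : Type u) [Field k] (i j l : ZMod 2) :
    superSign k (i + j) l = superSign k i l * superSign k j l := by
  have key : ∀ i : ZMod 2, i = 0 ∨ i = 1 := by decide
  have h11 : (1 + 1 : ZMod 2) = 0 := by decide
  rcases key i with rfl | rfl <;> rcases key j with rfl | rfl <;> rcases key l with rfl | rfl <;>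
    simp [superSign, h11]

theorem superSign_mul_self (k : Type u) [Field k] (i j : ZMod 2) :
    superSign k i j * superSign k i j = 1 := by
  unfold superSign
  split_ifs <;> simp

/-- Generators `z α l` and `w α l` of an associative superalgebra, of the parity of the index `α`,
which satisfy the canonical supercommutation relations: the `z` supercommute, the `w` supercommute,
and `w α l` acts on the `z` as the partial derivative with respect to `z α l`. -/
structure SuperOscillator (k : Type u) [Field k] (n : ℕ) (A : Type v) [Ring A] [Algebra k A] where
  z : Fin n ⊕ Fin n → Fin n → A
  w : Fin n ⊕ Fin n → Fin n → A
  z_mul_z : ∀ α β l m,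
    z α l * z β m = superSign k (idxParity α) (idxParity β) • (z β m * z α l)
  w_mul_w : ∀ α β l m,
    w α l * w β m = superSign k (idxParity α) (idxParity β) • (w β m * w α l)
  w_mul_z : ∀ α β l m, w α l * z β m =
    superSign k (idxParity α) (idxParity β) • (z β m * w α l) + if α = β ∧ l = m then 1 else 0

namespace SuperOscillator

variable {k : Type u} [Field k] {n : ℕ} {A : Type v} [Ring A] [Algebra k A]
variable (o : SuperOscillator k n A)

/-- The summand `z α l * w β l` of the operator of the matrix unit at `(α, β)`. -/
def term (α β : Fin n ⊕ Fin n) (l : Fin n) : A := o.z α l * o.w β l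

/-- The operator of the matrix unit at `(α, β)`. -/
def unit (α β : Fin n ⊕ Fin n) : A := ∑ l, o.term α β l

theorem term_mul_z (α β γ : Fin n ⊕ Fin n) (l m : Fin n) : o.term α β l * o.z γ m =
    superSign k (idxParity α + idxParity β) (idxParity γ) • (o.z γ m * o.term α β l) +
      if β = γ ∧ l = m then o.z α l else 0 := by
  rw [term, mul_assoc, o.w_mul_z, mul_add, mul_smul_comm, ← mul_assoc, o.z_mul_z, smul_mul_assoc,
    smul_smul, mul_ite, mul_one, mul_zero, superSign_add_left, mul_assoc,
    mul_comm (superSign k (idxParity α) _)]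

theorem term_mul_w (α β γ : Fin n ⊕ Fin n) (l m : Fin n) : o.term α β l * o.w γ m =
    superSign k (idxParity α + idxParity β) (idxParity γ) • (o.w γ m * o.term α β l -
      if γ = α ∧ m = l then o.w β l else 0) := by
  have h : (if γ = α ∧ m = l then o.w β l else 0) = (if γ = α ∧ m = l then 1 else 0) * o.w β l := by
    split_ifs <;> simp
  rw [term, h, ← mul_assoc (o.w γ m), o.w_mul_z, add_mul, add_sub_cancel_right, mul_assoc,
    o.w_mul_w, mul_smul_comm, smul_mul_assoc, smul_smul, mul_assoc, superSign_add_left,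
    superSign_comm k (idxParity γ), mul_right_comm, superSign_mul_self, one_mul]

theorem unit_mul_z (α β γ : Fin n ⊕ Fin n) (m : Fin n) : o.unit α β * o.z γ m =
    superSign k (idxParity α + idxParity β) (idxParity γ) • (o.z γ m * o.unit α β) +
      if β = γ then o.z α m else 0 := by
  simp only [unit, Finset.sum_mul, Finset.mul_sum, term_mul_z, Finset.sum_add_distrib,
    Finset.smul_sum, ite_and]
  congr 1
  split_ifs <;> simp

theorem unit_mul_w (α β γ : Fin n ⊕ Fin n) (m : Fin n) : o.unit α β * o.w γ m =
    superSign k (idxParity α + idxParity β) (idxParity γ) • (o.w γ m * o.unit α β -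
      if γ = α then o.w β m else 0) := by
  simp only [unit, Finset.sum_mul, Finset.mul_sum, term_mul_w, ← Finset.smul_sum,
    Finset.sum_sub_distrib, ite_and]
  congr 2
  split_ifs <;> simp

/-- The operators of the matrix units satisfy the supercommutation relations of `gl(n|n)`. -/
theorem unit_bracket (α β γ δ : Fin n ⊕ Fin n) :
    o.unit α β * o.unit γ δ -
      superSign k (idxParity α + idxParity β) (idxParity γ + idxParity δ) •
        (o.unit γ δ * o.unit α β) =
    (if β = γ then o.unit α δ else 0) -
      superSign k (idxParity α + idxParity β) (idxParity γ + idxParity δ) •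
        if δ = α then o.unit γ β else 0 := by
  set s := superSign k (idxParity α + idxParity β) (idxParity γ + idxParity δ) with hs
  have hs' : s = superSign k (idxParity α + idxParity β) (idxParity γ) *
      superSign k (idxParity α + idxParity β) (idxParity δ) := by
    rw [hs, superSign_comm, superSign_add_left, superSign_comm, superSign_comm k (idxParity δ)]
  have h : ∀ m, o.unit α β * o.term γ δ m = s • (o.term γ δ m * o.unit α β) +
      ((if β = γ then o.term α δ m else 0) - s • if δ = α then o.term γ β m else 0) := by
    intro m
    rw [term, ← mul_assoc, unit_mul_z, add_mul, smul_mul_assoc, mul_assoc, unit_mul_w,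
      mul_smul_comm, smul_smul, ← hs', mul_sub, smul_sub, ite_mul, zero_mul, mul_ite, mul_zero,
      mul_assoc]
    simp only [term]
    abel
  have h1 : o.unit α β * o.unit γ δ = s • (o.unit γ δ * o.unit α β) +
      ((if β = γ then o.unit α δ else 0) - s • if δ = α then o.unit γ β else 0) := by
    conv_lhs => rw [unit.eq_1 o γ δ, Finset.mul_sum]
    simp only [h, Finset.sum_add_distrib, Finset.sum_sub_distrib, ← Finset.smul_sum,
      ← Finset.sum_mul]
    congr 2
    · split_ifs <;> simp [unit]
    · split_ifs <;> simp [unit]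
  rw [h1]
  abel

/-- The action of `gl(n|n)` through superoscillators. -/
def toLinear : BlockMat k n →ₗ[k] A where
  toFun X := ∑ α, ∑ β, X α β • o.unit α β
  map_add' X Y := by simp [add_smul, Finset.sum_add_distrib]
  map_smul' c X := by simp [Finset.smul_sum, smul_smul]

theorem toLinear_apply (X : BlockMat k n) : o.toLinear X = ∑ α, ∑ β, X α β • o.unit α β := rfl

theorem toLinear_single (α β : Fin n ⊕ Fin n) : o.toLinear (Matrix.single α β 1) = o.unit α β := by
  rw [toLinear_apply, Finset.sum_eq_single α, Finset.sum_eq_single β]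
  · simp
  · intro b _ hb
    rw [Matrix.single_apply_of_col_ne _ _ hb.symm, zero_smul]
  · simp
  · intro a _ ha
    refine Finset.sum_eq_zero fun b _ => ?_
    rw [Matrix.single_apply_of_row_ne ha.symm, zero_smul]
  · simp

/-- `toLinear` is a homomorphism of Lie superalgebras. -/
theorem toLinear_bracket {i j : ZMod 2} {X Y : BlockMat k n} (hX : X ∈ glPart k n i)
    (hY : Y ∈ glPart k n j) :
    o.toLinear X * o.toLinear Y - superSign k i j • (o.toLinear Y * o.toLinear X) =
      o.toLinear (X * Y - superSign k i j • (Y * X)) := by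
  have h : ∀ α β γ δ, (X α β • o.unit α β) * (Y γ δ • o.unit γ δ) -
      superSign k i j • ((Y γ δ • o.unit γ δ) * (X α β • o.unit α β)) =
      (if β = γ then (X α β * Y γ δ) • o.unit α δ else 0) -
      superSign k i j • if δ = α then (Y γ δ * X α β) • o.unit γ β else 0 := by
    intro α β γ δ
    by_cases h1 : idxParity α + idxParity β = i
    · by_cases h2 : idxParity γ + idxParity δ = j
      · subst h1 h2
        have := congrArg (fun a => (X α β * Y γ δ) • a) (o.unit_bracket α β γ δ)
        simp only [smul_sub, smul_ite, smul_zero, smul_comm (X α β * Y γ δ)] at this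
        rw [smul_mul_smul_comm, smul_mul_smul_comm, mul_comm (Y γ δ), this]
        simp only [smul_ite, smul_zero]
      · simp [hY γ δ h2]
    · simp [hX α β h1]
  have hXY : ∀ X Y : BlockMat k n, o.toLinear X * o.toLinear Y =
      ∑ α, ∑ β, ∑ γ, ∑ δ, (X α β • o.unit α β) * (Y γ δ • o.unit γ δ) := by
    intro X Y
    simp only [toLinear_apply, Finset.sum_mul]
    simp only [Finset.mul_sum]
  have hYX : o.toLinear Y * o.toLinear X =
      ∑ α, ∑ β, ∑ γ, ∑ δ, (Y γ δ • o.unit γ δ) * (X α β • o.unit α β) := by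
    simp only [toLinear_apply, Finset.mul_sum]
    simp only [Finset.sum_mul]
  rw [hXY, hYX]
  simp only [Finset.smul_sum, ← Finset.sum_sub_distrib]
  simp only [h]
  simp only [Finset.sum_sub_distrib, ← Finset.smul_sum]
  rw [map_sub, map_smul]
  have hmul : ∀ X Y : BlockMat k n,
      o.toLinear (X * Y) = ∑ α, ∑ β, ∑ γ, (X α γ * Y γ β) • o.unit α β := by
    intro X Y
    simp only [toLinear_apply, Matrix.mul_apply, Finset.sum_smul]
  congr 1
  · rw [hmul]
    refine Finset.sum_congr rfl fun α _ => ?_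
    refine (Finset.sum_congr rfl fun β _ => Finset.sum_comm).trans (Finset.sum_comm.trans ?_)
    simp only [Finset.sum_ite_eq, Finset.mem_univ, if_true]
  · rw [hmul]
    simp only [Finset.sum_ite_eq', Finset.mem_univ, if_true]
    exact congrArg _ ((Finset.sum_congr rfl fun α _ => Finset.sum_comm).trans
      (Finset.sum_comm.trans (Finset.sum_congr rfl fun γ _ => Finset.sum_comm)))

end SuperOscillator
end

noncomputable section

theorem Finset.sum_pow_char_of_commute {A ι : Type*} [Ring A] (p : ℕ) [Fact p.Prime] [CharP A p]
    (s : Finset ι) (f : ι → A) (h : ∀ i j, Commute (f i) (f j)) :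
    (∑ i ∈ s, f i) ^ p = ∑ i ∈ s, f i ^ p := by
  classical
  induction s using Finset.induction_on with
  | empty => simp [(Fact.out : p.Prime).ne_zero]
  | insert a s ha ih =>
    rw [Finset.sum_insert ha, Finset.sum_insert ha,
      add_pow_char_of_commute _ (Commute.sum_right _ _ _ fun i _ => h a i), ih]

namespace SuperOscillator

open RestrictedSubalgebra Periplectic

variable {k : Type u} [Field k] {n : ℕ} {A : Type v} [Ring A] [Algebra k A]
variable (o : SuperOscillator k n A)

theorem commute_term (α β : Fin n ⊕ Fin n) (h : idxParity α = idxParity β) (l m : Fin n) :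
    Commute (o.term α β l) (o.term α β m) := by
  by_cases hlm : l = m
  · rw [hlm]
  · have h1 : ∀ i, superSign k (idxParity α + idxParity β) i = 1 := by
      intro i
      rw [superSign_add_left, h, superSign_mul_self]
    have h2 : Commute (o.term α β l) (o.z α m) := by
      have := o.term_mul_z α β α l m
      rwa [h1, one_smul, if_neg (by simp [hlm]), add_zero] at this
    have h3 : Commute (o.term α β l) (o.w β m) := by
      have := o.term_mul_w α β β l m
      rwa [h1, one_smul, if_neg (by simp [Ne.symm hlm]), sub_zero] at this
    exact h2.mul_right h3

theorem odd_term_mul_self (h2 : (2 : k) ≠ 0) (i j l : Fin n) :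
    o.term (Sum.inr i) (Sum.inr j) l * o.term (Sum.inr i) (Sum.inr j) l =
      if i = j then o.term (Sum.inr i) (Sum.inr j) l else 0 := by
  have hs : superSign k (idxParity (Sum.inr i : Fin n ⊕ Fin n))
      (idxParity (Sum.inr j : Fin n ⊕ Fin n)) = -1 := by simp [superSign, idxParity]
  have hs' : superSign k (idxParity (Sum.inr j : Fin n ⊕ Fin n))
      (idxParity (Sum.inr i : Fin n ⊕ Fin n)) = -1 := by simp [superSign, idxParity]
  have hz : o.z (Sum.inr i) l * o.z (Sum.inr i) l = 0 := by
    have h := o.z_mul_z (Sum.inr i) (Sum.inr i) l l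
    have hs : superSign k (idxParity (Sum.inr i : Fin n ⊕ Fin n))
      (idxParity (Sum.inr i : Fin n ⊕ Fin n)) = -1 := by simp [superSign, idxParity]
    rw [hs, neg_one_smul, eq_neg_iff_add_eq_zero, ← two_smul k] at h
    exact (smul_eq_zero_iff_right h2).1 h
  have h : o.term (Sum.inr i) (Sum.inr j) l * o.term (Sum.inr i) (Sum.inr j) l =
      o.z (Sum.inr i) l * (o.w (Sum.inr j) l * o.z (Sum.inr i) l) * o.w (Sum.inr j) l := by
    simp only [term, mul_assoc]
  rw [h, o.w_mul_z, hs', neg_one_smul, mul_add, mul_neg, ← mul_assoc, hz, zero_mul, neg_zero,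
    zero_add]
  by_cases hij : i = j
  · simp [hij, term]
  · rw [if_neg (by simp [Ne.symm hij]), if_neg hij, mul_zero, zero_mul]

variable {p : ℕ} [Fact p.Prime] [CharP k p]

theorem odd_unit_pow [CharP A p] (hp : 2 < p) (i j : Fin n) :
    o.unit (Sum.inr i) (Sum.inr j) ^ p = if i = j then o.unit (Sum.inr i) (Sum.inr j) else 0 := by
  have h2 : (2 : k) ≠ 0 := by
    have := (CharP.cast_eq_zero_iff k p 2).not.2 (Nat.not_dvd_of_pos_of_lt two_pos hp)
    exact_mod_cast this
  rw [unit, Finset.sum_pow_char_of_commute p _ _ (o.commute_term _ _ (by simp [idxParity]))]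
  have h : ∀ l, o.term (Sum.inr i) (Sum.inr j) l ^ p =
      if i = j then o.term (Sum.inr i) (Sum.inr j) l else 0 := by
    intro l
    have hl := o.odd_term_mul_self h2 i j l
    split_ifs at hl ⊢ with hij
    · exact IsIdempotentElem.pow_eq hl (Fact.out : p.Prime).ne_zero
    · refine pow_eq_zero_of_le (by omega : 2 ≤ p) ?_
      rw [pow_two, hl]
  simp only [h]
  split_ifs <;> simp

theorem even_unit_pow [CharP A p] {b : Fin n → Fin n → k}
    (hz : ∀ i l, o.z (Sum.inl i) l ^ p = if i = l then 1 else 0)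
    (hw : ∀ i l, o.w (Sum.inl i) l ^ p = algebraMap k A (b i l ^ p)) (i j : Fin n) :
    o.unit (Sum.inl i) (Sum.inl j) ^ p =
      (if i = j then o.unit (Sum.inl i) (Sum.inl j) else 0) + algebraMap k A (b j i ^ p) := by
  have h1 : ∀ i j : Fin n, superSign k (idxParity (Sum.inl i : Fin n ⊕ Fin n))
      (idxParity (Sum.inl j : Fin n ⊕ Fin n)) = 1 := by simp [superSign, idxParity]
  rw [unit, Finset.sum_pow_char_of_commute p _ _ (o.commute_term _ _ (by simp [idxParity]))]
  have h : ∀ l, o.term (Sum.inl i) (Sum.inl j) l ^ p =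
      (if i = j then o.term (Sum.inl i) (Sum.inl j) l else 0) +
        if i = l then algebraMap k A (b j l ^ p) else 0 := by
    intro l
    have hc := o.w_mul_z (Sum.inl j) (Sum.inl i) l l
    rw [h1, one_smul] at hc
    have hpow : o.z (Sum.inl i) l ^ p * o.w (Sum.inl j) l ^ p =
        if i = l then algebraMap k A (b j l ^ p) else 0 := by
      rw [hz, hw, ite_mul, one_mul, zero_mul]
    by_cases hij : i = j
    · subst hij
      rw [if_pos (by simp)] at hc
      have := weyl_mul_pow_prime (k := k) (p := p) hc
      rw [hpow] at this
      rw [← this, if_pos rfl, term]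
      abel
    · rw [if_neg (by simp [Ne.symm hij]), add_zero] at hc
      rw [term, (show Commute _ _ from hc.symm).mul_pow, hpow, if_neg hij, zero_add]
  simp only [h]
  rw [Finset.sum_add_distrib]
  congr 1
  · split_ifs <;> simp
  · simp

variable (p) in
/-- The action of `gl(n)`, the even part of the periplectic superalgebra. -/
def evenOp : Matrix (Fin n) (Fin n) k →ₗ[k] A :=
  o.toLinear ∘ₗ ((periplectic k p n).part 0).subtype ∘ₗ evenIso k p n

theorem evenOp_single (i j : Fin n) : o.evenOp p (Matrix.single i j 1) =
    o.unit (Sum.inl i) (Sum.inl j) - o.unit (Sum.inr j) (Sum.inr i) := by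
  have h : (evenIso k p n (Matrix.single i j 1)).1 =
      Matrix.single (Sum.inl i) (Sum.inl j) 1 - Matrix.single (Sum.inr j) (Sum.inr i) 1 := by
    ext (a | a) (b | b) <;> simp [evenIso, evenMat, Matrix.single_apply, and_comm]
  rw [evenOp, LinearMap.comp_apply, LinearMap.comp_apply, Submodule.subtype_apply, h, map_sub,
    toLinear_single, toLinear_single]

theorem evenOp_bracket (X Y : Matrix (Fin n) (Fin n) k) :
    o.evenOp p X * o.evenOp p Y - o.evenOp p Y * o.evenOp p X = o.evenOp p (X * Y - Y * X) := by
  have h := o.toLinear_bracket (evenIso k p n X).2.2 (evenIso k p n Y).2.2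
  simp only [superSign, zero_ne_one, and_self, if_false, one_smul] at h
  refine h.trans (congrArg o.toLinear ?_)
  simp [evenIso, evenMat, Matrix.fromBlocks_multiply, sub_eq_add_neg,
      Matrix.fromBlocks_neg, Matrix.fromBlocks_add, add_comm]

/-- The `p`-character of the action of `gl(n)`. By additivity it is enough to look at the matrix
units, where Jacobson's formula is not needed. -/
theorem evenOp_pow [CharP A p] (hp : 2 < p) {χ : Module.Dual k (Matrix (Fin n) (Fin n) k)}
    (hz : ∀ i l, o.z (Sum.inl i) l ^ p = if i = l then 1 else 0)
    (hw : ∀ i l, o.w (Sum.inl i) l ^ p = algebraMap k A (χ (Matrix.single l i 1) ^ p))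
    (X : Matrix (Fin n) (Fin n) k) :
    o.evenOp p X ^ p - o.evenOp p (X ^ p) = algebraMap k A (χ X ^ p) := by
  have hunit : ∀ i j, o.evenOp p (Matrix.single i j 1) ^ p -
      o.evenOp p (Matrix.single i j 1 ^ p) = algebraMap k A (χ (Matrix.single i j 1) ^ p) := by
    intro i j
    have hcomm : Commute (o.unit (Sum.inl i) (Sum.inl j)) (o.unit (Sum.inr j) (Sum.inr i)) := by
      have := o.unit_bracket (Sum.inl i) (Sum.inl j) (Sum.inr j) (Sum.inr i)
      simp only [reduceCtorEq, if_false, smul_zero, sub_zero] at this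
      rw [sub_eq_zero] at this
      rw [Commute, SemiconjBy]
      simpa [superSign, idxParity] using this
    rw [evenOp_single, sub_pow_char_of_commute _ hcomm, o.odd_unit_pow hp,
      o.even_unit_pow (b := fun i l => χ (Matrix.single l i 1)) hz hw]
    by_cases hij : i = j
    · subst hij
      rw [single_diag_pow i (by omega), evenOp_single, if_pos rfl, if_pos rfl]
      abel
    · have h0 : Matrix.single i j (1 : k) ^ p = 0 := by
        refine pow_eq_zero_of_le (by omega : 2 ≤ p) ?_
        rw [pow_two, Matrix.single_mul_single_of_ne _ _ _ _ (Ne.symm hij)]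
      rw [if_neg hij, if_neg (Ne.symm hij), h0]
      simp
  have : ExpChar k p := ExpChar.prime Fact.out
  induction X using Matrix.induction_on' with
  | h_zero => simp [(Fact.out : p.Prime).ne_zero]
  | h_add X Y hX hY =>
    rw [pow_sub_map_pow_add (o.evenOp p) o.evenOp_bracket, hX, hY, map_add, add_pow_char, map_add]
  | h_std_basis i j c =>
    have h : Matrix.single i j c = c • Matrix.single i j (1 : k) := by simp [Matrix.smul_single]
    rw [h, smul_pow, map_smul, map_smul, smul_pow, map_smul, ← smul_sub, hunit, smul_eq_mul,
      mul_pow, map_mul, Algebra.smul_def]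

/-- The action of `U_χ(g)` through superoscillators. -/
def redHom [CharP A p] (hp : 2 < p) (χ : Module.Dual k ((periplectic k p n).part 0))
    (hz : ∀ i l, o.z (Sum.inl i) l ^ p = if i = l then 1 else 0)
    (hw : ∀ i l, o.w (Sum.inl i) l ^ p =
      algebraMap k A (χ (evenIso k p n (Matrix.single l i 1)) ^ p)) :
    RedEnv (periplectic k p n) χ →ₐ[k] A :=
  redLift _ χ (fun i => o.toLinear ∘ₗ ((periplectic k p n).part i).subtype)
    (fun _ _ x y => o.toLinear_bracket x.2.2 y.2.2)
    (by
      intro x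
      obtain ⟨X, rfl⟩ := exists_evenIso x
      refine Eq.trans ?_ (o.evenOp_pow (χ := χ ∘ₗ evenIso k p n) hp hz hw X)
      refine congrArg (fun a => o.evenOp p X ^ p - o.toLinear a) ?_
      exact evenMat_pow ((Fact.out : p.Prime).odd_of_ne_two hp.ne') X)

theorem redHom_redGen [CharP A p] (hp : 2 < p) (χ : Module.Dual k ((periplectic k p n).part 0))
    (hz : ∀ i l, o.z (Sum.inl i) l ^ p = if i = l then 1 else 0)
    (hw : ∀ i l, o.w (Sum.inl i) l ^ p =
      algebraMap k A (χ (evenIso k p n (Matrix.single l i 1)) ^ p))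
    (i : ZMod 2) (x : (periplectic k p n).part i) :
    o.redHom hp χ hz hw ((periplectic k p n).redGen χ i x) = o.toLinear x.1 :=
  redLift_redGen _ _ _ _ _ _ _

end SuperOscillator
end

noncomputable section

/-! ### Truncated functions on the group `GL(n)` -/

theorem Derivation.pow_apply_mul {k R : Type*} [CommRing k] [CommRing R] [Algebra k R]
    (D : Derivation k R R) {x : R} (hx : D (D x) = 0) (m : ℕ) (f : R) :
    (D.toLinearMap ^ m) (x * f) =
      x * (D.toLinearMap ^ m) f + (m : k) • (D x * (D.toLinearMap ^ (m - 1)) f) := by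
  induction m with
  | zero => simp
  | succ m ih =>
    have h : ∀ m, (D.toLinearMap ^ (m + 1)) f = D ((D.toLinearMap ^ m) f) := by
      intro m
      rw [pow_succ', Module.End.mul_apply]
      rfl
    have h1 : (D.toLinearMap ^ (m + 1)) (x * f) = D ((D.toLinearMap ^ m) (x * f)) := by
      rw [pow_succ', Module.End.mul_apply]
      rfl
    rw [h1, ih, map_add, D.leibniz, ← h, D.map_smul, D.leibniz, hx, Nat.add_sub_cancel]
    simp only [smul_eq_mul, mul_zero, add_zero]
    rw [add_assoc, mul_comm _ (D x), Nat.cast_succ, add_smul _ (1 : k), one_smul,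
      add_comm (D x * _)]
    congr 2
    rcases m with _ | m
    · simp
    · rw [Nat.add_sub_cancel, h]

namespace Periplectic

open MvPolynomial

variable (k : Type u) [Field k] (p n : ℕ)

/-- The ideal generated by the `p`-th powers of the coordinates of the matrix minus those of the
identity matrix. -/
def frobeniusIdeal : Ideal (MvPolynomial (Fin n × Fin n) k) :=
  Ideal.span (Set.range fun q : Fin n × Fin n => X q ^ p - C (if q.1 = q.2 then 1 else 0))

/-- The functions on the Frobenius kernel of `GL(n)`, the algebra with generators `x_{i,l}` and
relations `x_{i,l}^p = δ_{i,l}`. -/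
def FrobeniusKernel : Type u := MvPolynomial (Fin n × Fin n) k ⧸ frobeniusIdeal k p n

instance : CommRing (FrobeniusKernel k p n) :=
  inferInstanceAs (CommRing (MvPolynomial (Fin n × Fin n) k ⧸ frobeniusIdeal k p n))

instance : Algebra k (FrobeniusKernel k p n) :=
  inferInstanceAs (Algebra k (MvPolynomial (Fin n × Fin n) k ⧸ frobeniusIdeal k p n))

/-- The quotient map from the polynomial ring. -/
def frobeniusMk : MvPolynomial (Fin n × Fin n) k →ₐ[k] FrobeniusKernel k p n :=
  Ideal.Quotient.mkₐ k (frobeniusIdeal k p n)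

theorem frobeniusMk_surjective : Function.Surjective (frobeniusMk k p n) :=
  Ideal.Quotient.mkₐ_surjective _ _

variable {k p n}

theorem frobeniusMk_eq_zero {f : MvPolynomial (Fin n × Fin n) k} :
    frobeniusMk k p n f = 0 ↔ f ∈ frobeniusIdeal k p n := Ideal.Quotient.eq_zero_iff_mem

/-- The coordinate functions. -/
def frobeniusCoord (i l : Fin n) : FrobeniusKernel k p n := frobeniusMk k p n (X (i, l))

theorem frobeniusCoord_pow (i l : Fin n) :
    (frobeniusCoord i l : FrobeniusKernel k p n) ^ p = if i = l then 1 else 0 := by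
  rw [frobeniusCoord, ← map_pow]
  have h : (X (i, l) ^ p - C (if i = l then 1 else 0) : MvPolynomial (Fin n × Fin n) k) ∈
      frobeniusIdeal k p n := Ideal.subset_span ⟨(i, l), rfl⟩
  rw [← frobeniusMk_eq_zero, map_sub, sub_eq_zero] at h
  rw [h]
  split_ifs <;> simp

/-- Evaluation at the identity matrix. -/
def frobeniusEval (hp : p ≠ 0) : FrobeniusKernel k p n →ₐ[k] k :=
  Ideal.Quotient.liftₐ _ (aeval fun q : Fin n × Fin n => if q.1 = q.2 then (1 : k) else 0) (by
    intro a ha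
    have : frobeniusIdeal k p n ≤
        RingHom.ker (aeval fun q : Fin n × Fin n => if q.1 = q.2 then (1 : k) else 0) := by
      rw [frobeniusIdeal, Ideal.span_le]
      rintro _ ⟨q, rfl⟩
      rw [SetLike.mem_coe, RingHom.mem_ker, map_sub, map_pow, aeval_X, aeval_C]
      split_ifs <;> simp [hp]
    exact this ha)

theorem frobeniusKernel_induction {P : FrobeniusKernel k p n → Prop}
    (hC : ∀ c, P (algebraMap k _ c)) (hadd : ∀ f g, P f → P g → P (f + g))
    (hmul : ∀ f i l, P f → P (frobeniusCoord i l * f)) (f : FrobeniusKernel k p n) : P f := by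
  obtain ⟨f, rfl⟩ := frobeniusMk_surjective k p n f
  induction f using MvPolynomial.induction_on with
  | C c => exact (AlgHom.commutes (frobeniusMk k p n) c).symm ▸ hC c
  | add f g hf hg => rw [map_add]; exact hadd _ _ hf hg
  | mul_X f q hf => rw [map_mul, mul_comm]; exact hmul _ _ _ hf

variable [CharP k p]

theorem pderiv_mem_frobeniusIdeal (q : Fin n × Fin n) {f : MvPolynomial (Fin n × Fin n) k}
    (hf : f ∈ frobeniusIdeal k p n) : pderiv q f ∈ frobeniusIdeal k p n := by
  induction hf using Submodule.span_induction with
  | mem f h =>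
    obtain ⟨q, rfl⟩ := h
    have h0 : ((p : ℕ) : MvPolynomial (Fin n × Fin n) k) = 0 := by
      rw [← map_natCast (C : k →+* _), CharP.cast_eq_zero, map_zero]
    rw [map_sub, pderiv_C, sub_zero, Derivation.leibniz_pow, ← Nat.cast_smul_eq_nsmul
      (MvPolynomial (Fin n × Fin n) k), h0, zero_smul]
    exact zero_mem _
  | zero => rw [map_zero]; exact zero_mem _
  | add f g _ _ hf hg => rw [map_add]; exact add_mem hf hg
  | smul a f hf' hf =>
    rw [smul_eq_mul, Derivation.leibniz]
    exact add_mem (Ideal.mul_mem_left _ _ hf) (Ideal.mul_mem_right _ _ hf')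

theorem frobeniusMk_pderiv_eq_zero (q : Fin n × Fin n) (f : MvPolynomial (Fin n × Fin n) k)
    (hf : frobeniusMk k p n f = 0) : frobeniusMk k p n (pderiv q f) = 0 :=
  frobeniusMk_eq_zero.2 (pderiv_mem_frobeniusIdeal q (frobeniusMk_eq_zero.1 hf))

/-- The partial derivative with respect to the coordinate `x_{j,l}`. -/
def frobeniusDeriv (j l : Fin n) :
    Derivation k (FrobeniusKernel k p n) (FrobeniusKernel k p n) :=
  Derivation.liftOfSurjective (frobeniusMk_surjective k p n) (frobeniusMk_pderiv_eq_zero (j, l))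

theorem frobeniusDeriv_coord (j l i m : Fin n) :
    frobeniusDeriv j l (frobeniusCoord i m : FrobeniusKernel k p n) =
      if j = i ∧ l = m then 1 else 0 := by
  refine (Derivation.liftOfSurjective_apply (frobeniusMk_surjective k p n)
    (frobeniusMk_pderiv_eq_zero (j, l)) (X (i, m))).trans ?_
  rw [pderiv_X]
  by_cases h : j = i ∧ l = m
  · obtain ⟨rfl, rfl⟩ := h
    simp
  · rw [if_neg h, Pi.single_eq_of_ne, map_zero]
    intro h'
    exact h (by simpa [eq_comm] using h')

theorem frobeniusDeriv_comm (j l i m : Fin n) (f : FrobeniusKernel k p n) :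
    frobeniusDeriv j l (frobeniusDeriv i m f) = frobeniusDeriv i m (frobeniusDeriv j l f) := by
  induction f using frobeniusKernel_induction with
  | hC c => simp
  | hadd f g hf hg => simp only [map_add, hf, hg]
  | hmul f a b hf =>
    have h : ∀ i m (P : Prop) [Decidable P],
        frobeniusDeriv i m (if P then (1 : FrobeniusKernel k p n) else 0) = 0 := by
      intro i m P _
      split_ifs <;> simp
    simp only [Derivation.leibniz, map_add, smul_eq_mul, hf, frobeniusDeriv_coord, h]
    ring

/-- The `p`-th power of a partial derivative vanishes. -/
theorem frobeniusDeriv_pow [Fact p.Prime] (j l : Fin n) :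
    ((frobeniusDeriv j l).toLinearMap : Module.End k (FrobeniusKernel k p n)) ^ p = 0 := by
  have hp : p ≠ 0 := (Fact.out : p.Prime).ne_zero
  ext f
  rw [LinearMap.zero_apply]
  induction f using frobeniusKernel_induction with
  | hC c =>
    rw [← pow_sub_one_mul hp, Module.End.mul_apply]
    exact (congrArg _ (Derivation.map_algebraMap _ c)).trans (map_zero _)
  | hadd f g hf hg => rw [map_add, hf, hg, add_zero]
  | hmul f i a hf =>
    rw [Derivation.pow_apply_mul, hf, CharP.cast_eq_zero, zero_smul, mul_zero, add_zero]
    rw [frobeniusDeriv_coord]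
    split_ifs <;> simp

end Periplectic
end

noncomputable section

/-! ### The oscillator representation -/

namespace Periplectic

open RestrictedSubalgebra

variable (k : Type u) [Field k] (p n : ℕ)

/-- The exterior algebra on `n²` generators. -/
abbrev OscillatorExterior : Type u := ExteriorAlgebra k (Fin n × Fin n → k)

/-- The space of the oscillator representation: functions on the Frobenius kernel of `GL(n)` with
values in the exterior algebra. -/
abbrev OscillatorSpace : Type u := FrobeniusKernel k p n ⊗[k] OscillatorExterior k n

theorem nontrivial_oscillatorSpace (hp : p ≠ 0) : Nontrivial (OscillatorSpace k p n) :=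
  (Algebra.TensorProduct.lift (frobeniusEval (k := k) (n := n) hp)
    (ExteriorAlgebra.algebraMapInv (R := k) (M := Fin n × Fin n → k))
    fun _ _ => Commute.all _ _).toRingHom.domain_nontrivial

variable {k p n}

/-- An operator on functions, acting on the first tensor factor. -/
abbrev evenVarOp : Module.End k (FrobeniusKernel k p n) →ₐ[k] Module.End k (OscillatorSpace k p n) :=
  Module.End.rTensorAlgHom k (FrobeniusKernel k p n) (OscillatorExterior k n)

/-- An operator on the exterior algebra, acting on the second tensor factor. -/
abbrev oddVarOp : Module.End k (OscillatorExterior k n) →ₐ[k] Module.End k (OscillatorSpace k p n) :=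
  Module.End.lTensorAlgHom k (OscillatorExterior k n) (FrobeniusKernel k p n)

theorem evenVarOp_mul_oddVarOp (f : Module.End k (FrobeniusKernel k p n))
    (g : Module.End k (OscillatorExterior k n)) :
    evenVarOp f * oddVarOp g = oddVarOp g * evenVarOp f :=
  TensorProduct.ext' fun _ _ => rfl

/-- Multiplication by a generator of the exterior algebra. -/
def exteriorMul (q : Fin n × Fin n) : Module.End k (OscillatorExterior k n) :=
  LinearMap.mulLeft k (ExteriorAlgebra.ι k (Pi.single q 1 : Fin n × Fin n → k))

/-- The odd derivative with respect to a generator of the exterior algebra. -/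
def exteriorDeriv (q : Fin n × Fin n) : Module.End k (OscillatorExterior k n) :=
  CliffordAlgebra.contractLeft (Q := 0) (LinearMap.proj q)

theorem exteriorMul_mul (q r : Fin n × Fin n) :
    (exteriorMul q * exteriorMul r : Module.End k (OscillatorExterior k n)) =
      -(exteriorMul r * exteriorMul q) := by
  refine LinearMap.ext fun x => ?_
  have h := ExteriorAlgebra.ι_add_mul_swap (R := k) (Pi.single q 1 : Fin n × Fin n → k)
    (Pi.single r 1)
  change ExteriorAlgebra.ι k _ * (ExteriorAlgebra.ι k _ * x) =
    -(ExteriorAlgebra.ι k _ * (ExteriorAlgebra.ι k _ * x))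
  rw [← mul_assoc, ← mul_assoc, eq_neg_of_add_eq_zero_left h, neg_mul]

theorem exteriorDeriv_mul (q r : Fin n × Fin n) :
    (exteriorDeriv q * exteriorDeriv r : Module.End k (OscillatorExterior k n)) =
      -(exteriorDeriv r * exteriorDeriv q) :=
  LinearMap.ext fun x => CliffordAlgebra.contractLeft_comm (Q := 0) _ _ x

theorem exteriorDeriv_mul_exteriorMul (q r : Fin n × Fin n) :
    (exteriorDeriv q * exteriorMul r : Module.End k (OscillatorExterior k n)) =
      -(exteriorMul r * exteriorDeriv q : Module.End k (OscillatorExterior k n)) +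
        if q = r then 1 else 0 := by
  refine LinearMap.ext fun x => ?_
  refine (CliffordAlgebra.contractLeft_ι_mul (Q := 0) _ _ _).trans ?_
  rw [sub_eq_neg_add, LinearMap.add_apply]
  congr 1
  rw [LinearMap.proj_apply, Pi.single_apply]
  split_ifs <;> simp

/-- Multiplication by a function. -/
def mulOp (g : FrobeniusKernel k p n) : Module.End k (OscillatorSpace k p n) :=
  evenVarOp (LinearMap.mulLeft k g)

theorem mulOp_sum {ι : Type*} (s : Finset ι) (g : ι → FrobeniusKernel k p n) :
    mulOp (∑ i ∈ s, g i) = ∑ i ∈ s, mulOp (g i) :=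
  map_sum (evenVarOp.toLinearMap ∘ₗ LinearMap.mul k (FrobeniusKernel k p n)) _ _

variable [CharP k p]

theorem frobeniusDeriv_mul_coord (j l i m : Fin n) :
    ((frobeniusDeriv j l).toLinearMap * LinearMap.mulLeft k (frobeniusCoord i m) :
      Module.End k (FrobeniusKernel k p n)) =
    LinearMap.mulLeft k (frobeniusCoord i m) * (frobeniusDeriv j l).toLinearMap +
      if j = i ∧ l = m then 1 else 0 := by
  refine LinearMap.ext fun f => ?_
  refine ((frobeniusDeriv j l).leibniz _ _).trans ?_
  rw [frobeniusDeriv_coord, LinearMap.add_apply]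
  congr 1
  split_ifs <;> simp

/-- The partial derivatives, shifted by scalars. -/
def shiftedDeriv (b : Fin n → Fin n → k) (j l : Fin n) : Module.End k (FrobeniusKernel k p n) :=
  (frobeniusDeriv j l).toLinearMap + algebraMap k _ (b j l)

theorem shiftedDeriv_mul_coord (b : Fin n → Fin n → k) (j l i m : Fin n) :
    (shiftedDeriv b j l * LinearMap.mulLeft k (frobeniusCoord i m) :
      Module.End k (FrobeniusKernel k p n)) =
    LinearMap.mulLeft k (frobeniusCoord i m) * shiftedDeriv b j l +
      if j = i ∧ l = m then 1 else 0 := by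
  rw [shiftedDeriv, add_mul, mul_add, frobeniusDeriv_mul_coord, Algebra.commutes]
  abel

theorem shiftedDeriv_mul (b : Fin n → Fin n → k) (j l i m : Fin n) :
    (shiftedDeriv b j l * shiftedDeriv b i m : Module.End k (FrobeniusKernel k p n)) =
      shiftedDeriv b i m * shiftedDeriv b j l := by
  have h : Commute ((frobeniusDeriv j l).toLinearMap : Module.End k (FrobeniusKernel k p n))
      (frobeniusDeriv i m).toLinearMap := LinearMap.ext fun f => frobeniusDeriv_comm j l i m f
  exact ((h.add_right (Algebra.commute_algebraMap_right _ _)).add_left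
    (Algebra.commute_algebraMap_left _ _)).eq

theorem shiftedDeriv_pow [Fact p.Prime] (b : Fin n → Fin n → k) (j l : Fin n) :
    (shiftedDeriv b j l : Module.End k (FrobeniusKernel k p n)) ^ p =
      algebraMap k _ (b j l ^ p) := by
  have : Nontrivial (FrobeniusKernel k p n) :=
    (frobeniusEval (k := k) (n := n) (Fact.out : p.Prime).ne_zero).toRingHom.domain_nontrivial
  have : CharP (Module.End k (FrobeniusKernel k p n)) p :=
    charP_of_injective_algebraMap (algebraMap k _).injective p
  rw [shiftedDeriv, add_pow_char_of_commute _ (Algebra.commute_algebraMap_right _ _),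
    frobeniusDeriv_pow, zero_add, map_pow]

/-- The superoscillators acting on the oscillator space. -/
def oscillator (b : Fin n → Fin n → k) :
    SuperOscillator k n (Module.End k (OscillatorSpace k p n)) where
  z := Sum.elim (fun i l => evenVarOp (LinearMap.mulLeft k (frobeniusCoord i l)))
    fun i l => oddVarOp (exteriorMul (i, l))
  w := Sum.elim (fun j l => evenVarOp (shiftedDeriv b j l))
    fun j l => oddVarOp (exteriorDeriv (j, l))
  z_mul_z := by
    have h : ∀ x y : FrobeniusKernel k p n, LinearMap.mulLeft k x * LinearMap.mulLeft k y =
        LinearMap.mulLeft k y * LinearMap.mulLeft k x :=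
      fun x y => LinearMap.ext fun f => mul_left_comm x y f
    rintro (i | i) (j | j) l m
    · simp only [Sum.elim_inl, superSign, idxParity, zero_ne_one, and_self, if_false, one_smul,
        ← map_mul, h]
    · simp [superSign, idxParity, evenVarOp_mul_oddVarOp]
    · simp [superSign, idxParity, evenVarOp_mul_oddVarOp]
    · simp only [Sum.elim_inr, superSign, idxParity, and_self, if_true, neg_one_smul, ← map_mul,
        ← map_neg, ← exteriorMul_mul]
  w_mul_w := by
    rintro (i | i) (j | j) l m
    · simp only [Sum.elim_inl, superSign, idxParity, zero_ne_one, and_self, if_false, one_smul,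
        ← map_mul]
      rw [shiftedDeriv_mul]
    · simp [superSign, idxParity, evenVarOp_mul_oddVarOp]
    · simp [superSign, idxParity, evenVarOp_mul_oddVarOp]
    · simp only [Sum.elim_inr, superSign, idxParity, and_self, if_true, neg_one_smul, ← map_mul,
        ← map_neg, ← exteriorDeriv_mul]
  w_mul_z := by
    rintro (i | i) (j | j) l m
    · simp only [Sum.elim_inl, superSign, idxParity, zero_ne_one, and_self, if_false, one_smul,
        ← map_mul, shiftedDeriv_mul_coord, map_add, Sum.inl.injEq]
      split_ifs <;> simp
    · simp [superSign, idxParity, evenVarOp_mul_oddVarOp]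
    · simp [superSign, idxParity, evenVarOp_mul_oddVarOp]
    · simp only [Sum.elim_inr, superSign, idxParity, and_self, if_true, neg_one_smul, ← map_mul,
        exteriorDeriv_mul_exteriorMul, map_add, map_neg, Sum.inr.injEq, Prod.mk.injEq]
      split_ifs <;> simp

/-- The vector field by which the matrix unit at `(i, j)` acts on functions. -/
def euler (i j : Fin n) : Derivation k (FrobeniusKernel k p n) (FrobeniusKernel k p n) :=
  ∑ l, (frobeniusCoord i l : FrobeniusKernel k p n) • frobeniusDeriv j l

theorem euler_apply (i j : Fin n) (g : FrobeniusKernel k p n) :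
    euler i j g = ∑ l, frobeniusCoord i l * frobeniusDeriv j l g := by
  change Derivation.coeFnAddMonoidHom (euler i j) g = _
  rw [euler, map_sum, Finset.sum_apply]
  rfl

theorem oscillator_z_pow (b : Fin n → Fin n → k) (i l : Fin n) :
    (oscillator b).z (Sum.inl i) l ^ p =
      (if i = l then 1 else 0 : Module.End k (OscillatorSpace k p n)) := by
  refine (map_pow evenVarOp _ p).symm.trans ?_
  rw [LinearMap.pow_mulLeft, frobeniusCoord_pow]
  split_ifs
  · rw [LinearMap.mulLeft_one]
    exact map_one evenVarOp
  · rw [LinearMap.mulLeft_zero_eq_zero, map_zero]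

variable [Fact p.Prime]

theorem charP_end_oscillatorSpace : CharP (Module.End k (OscillatorSpace k p n)) p :=
  have := nontrivial_oscillatorSpace k p n (Fact.out : p.Prime).ne_zero
  charP_of_injective_algebraMap (algebraMap k _).injective p

/-- The scalars by which the partial derivatives are shifted, so that the oscillator representation
has `p`-character `χ`. -/
def shiftOf (χ : Module.Dual k ((periplectic k p n).part 0)) (j l : Fin n) : k :=
  χ (evenIso k p n (Matrix.single l j 1))

theorem oscillator_w_pow (b : Fin n → Fin n → k) (i l : Fin n) :
    (oscillator b).w (Sum.inl i) l ^ p =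
      algebraMap k (Module.End k (OscillatorSpace k p n)) (b i l ^ p) := by
  refine (map_pow evenVarOp _ p).symm.trans ?_
  rw [shiftedDeriv_pow, AlgHom.commutes]

/-- The oscillator representation of `U_χ(g)`. -/
def oscillatorHom (hp : 2 < p) (χ : Module.Dual k ((periplectic k p n).part 0)) :
    RedEnv (periplectic k p n) χ →ₐ[k] Module.End k (OscillatorSpace k p n) :=
  have := charP_end_oscillatorSpace (k := k) (p := p) (n := n)
  (oscillator (shiftOf χ)).redHom hp χ (oscillator_z_pow _) (oscillator_w_pow _)

theorem oscillatorHom_redGen (hp : 2 < p) (χ : Module.Dual k ((periplectic k p n).part 0))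
    (i : ZMod 2) (x : (periplectic k p n).part i) :
    oscillatorHom hp χ ((periplectic k p n).redGen χ i x) =
      (oscillator (shiftOf χ)).toLinear x.1 :=
  have := charP_end_oscillatorSpace (k := k) (p := p) (n := n)
  SuperOscillator.redHom_redGen _ hp χ (oscillator_z_pow _) (oscillator_w_pow _) i x

theorem oscillator_E_mulOp (hp : 2 < p) (χ : Module.Dual k ((periplectic k p n).part 0))
    (i j : Fin n) (g : FrobeniusKernel k p n) :
    (repOfHom (oscillatorHom hp χ)).E i j * mulOp g =
      mulOp g * (repOfHom (oscillatorHom hp χ)).E i j + mulOp (euler i j g) := by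
  have h1 : (repOfHom (oscillatorHom hp χ)).E i j =
      (oscillator (shiftOf χ)).unit (Sum.inl i) (Sum.inl j) -
        (oscillator (shiftOf χ)).unit (Sum.inr j) (Sum.inr i) := by
    rw [← SuperOscillator.evenOp_single (p := p)]
    exact oscillatorHom_redGen hp χ 0 _
  have hodd : (oscillator (shiftOf χ)).unit (Sum.inr j) (Sum.inr i) * mulOp g =
      mulOp g * (oscillator (shiftOf χ)).unit (Sum.inr j) (Sum.inr i) := by
    simp only [SuperOscillator.unit, SuperOscillator.term, Finset.sum_mul, Finset.mul_sum]
    refine Finset.sum_congr rfl fun l _ => ?_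
    simp only [oscillator, Sum.elim_inr, mulOp, ← map_mul]
    exact (evenVarOp_mul_oddVarOp _ _).symm
  have hl : ∀ l, (oscillator (shiftOf χ)).term (Sum.inl i) (Sum.inl j) l * mulOp g =
      mulOp g * (oscillator (shiftOf χ)).term (Sum.inl i) (Sum.inl j) l +
        mulOp (frobeniusCoord i l * frobeniusDeriv j l g) := by
    intro l
    simp only [SuperOscillator.term, oscillator, Sum.elim_inl, mulOp, ← map_mul, ← map_add]
    refine congrArg evenVarOp (LinearMap.ext fun f => ?_)
    simp only [shiftedDeriv, Module.End.mul_apply, LinearMap.mulLeft_apply, LinearMap.add_apply,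
      Derivation.coeFn_coe, Derivation.leibniz, Module.algebraMap_end_apply, smul_eq_mul,
      mul_add, Algebra.smul_def]
    ring
  have heven : (oscillator (shiftOf χ)).unit (Sum.inl i) (Sum.inl j) * mulOp g =
      mulOp g * (oscillator (shiftOf χ)).unit (Sum.inl i) (Sum.inl j) + mulOp (euler i j g) := by
    have h2 : mulOp (euler i j g) = ∑ l, mulOp (frobeniusCoord i l * frobeniusDeriv j l g) := by
      rw [euler_apply, mulOp_sum]
    rw [h2]
    simp only [SuperOscillator.unit, Finset.sum_mul, Finset.mul_sum, hl, Finset.sum_add_distrib]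
  rw [h1, sub_mul, mul_sub, hodd, heven]
  abel

theorem oscillator_sym_mulOp (hp : 2 < p) (χ : Module.Dual k ((periplectic k p n).part 0))
    (B : Matrix (Fin n) (Fin n) k) (g : FrobeniusKernel k p n) :
    (repOfHom (oscillatorHom hp χ)).sym B * mulOp g =
      mulOp g * (repOfHom (oscillatorHom hp χ)).sym B := by
  have h1 : (repOfHom (oscillatorHom hp χ)).sym B =
      (oscillator (shiftOf χ)).toLinear (symIso k p n B).1 := oscillatorHom_redGen hp χ 1 _
  rw [h1, SuperOscillator.toLinear_apply]
  simp only [Finset.sum_mul, Finset.mul_sum]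
  refine Finset.sum_congr rfl fun α _ => Finset.sum_congr rfl fun β _ => ?_
  rcases α with i | i <;> rcases β with j | j
  · simp [symIso]
  · rw [smul_mul_assoc, mul_smul_comm]
    congr 1
    simp only [SuperOscillator.unit, SuperOscillator.term, Finset.sum_mul, Finset.mul_sum]
    refine Finset.sum_congr rfl fun l _ => ?_
    simp only [oscillator, Sum.elim_inl, Sum.elim_inr, mulOp]
    rw [mul_assoc, ← evenVarOp_mul_oddVarOp, ← mul_assoc, ← mul_assoc, ← map_mul, ← map_mul]
    congr 2
    exact LinearMap.ext fun f => mul_left_comm (frobeniusCoord i l) g f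
  · simp [symIso]
  · simp [symIso]

end Periplectic
end

noncomputable section

/-! ### Derivatives of determinants -/

theorem Derivation.apply_prod {k R ι : Type*} [CommRing k] [CommRing R] [Algebra k R]
    [DecidableEq ι] (D : Derivation k R R) (s : Finset ι) (f : ι → R) :
    D (∏ i ∈ s, f i) = ∑ i ∈ s, ∏ j ∈ s, Function.update f i (D (f i)) j := by
  induction s using Finset.induction_on with
  | empty => simp
  | insert a s ha ih =>
    rw [Finset.prod_insert ha, D.leibniz, ih, Finset.sum_insert ha, Finset.prod_insert ha,
      Function.update_self, smul_eq_mul, smul_eq_mul, Finset.mul_sum, add_comm, mul_comm _ (D _)]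
    congr 1
    · congr 1
      refine Finset.prod_congr rfl fun j hj => ?_
      rw [Function.update_of_ne (ne_of_mem_of_not_mem hj ha)]
    · refine Finset.sum_congr rfl fun i hi => ?_
      rw [Finset.prod_insert ha, Function.update_of_ne (ne_of_mem_of_not_mem hi ha).symm]

/-- The derivative of a determinant is the sum over the rows of the determinants in which that row
is differentiated. -/
theorem Derivation.apply_det {k R ι : Type*} [CommRing k] [CommRing R] [Algebra k R]
    [DecidableEq ι] [Fintype ι] (D : Derivation k R R) (M : Matrix ι ι R) :
    D M.det = ∑ c, (M.updateRow c fun a => D (M c a)).det := by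
  have h : ∀ M : Matrix ι ι R, D M.det = ∑ c, (M.updateCol c fun a => D (M a c)).det := by
    intro M
    simp only [Matrix.det_apply, map_sum]
    rw [Finset.sum_comm]
    refine Finset.sum_congr rfl fun σ _ => ?_
    rw [Units.smul_def, map_zsmul, Derivation.apply_prod, ← Finset.smul_sum, ← Units.smul_def]
    congr 1
    refine Finset.sum_congr rfl fun c _ => Finset.prod_congr rfl fun i _ => ?_
    rw [Matrix.updateCol_apply, Function.update_apply]
    split_ifs with hi
    · rw [hi]
    · rfl
  rw [← Matrix.det_transpose, h]
  refine Finset.sum_congr rfl fun c _ => ?_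
  rw [Matrix.updateCol_transpose, Matrix.det_transpose]
  rfl

namespace Periplectic

open RestrictedSubalgebra

variable {k : Type u} [Field k] {p n : ℕ}

/-! ### Leading minors and shifts of weights -/

/-- The leading minor of size `r` of the generic matrix. -/
def leadingMinor (r : ℕ) (hr : r ≤ n) : FrobeniusKernel k p n :=
  (Matrix.of fun i l : Fin r => frobeniusCoord (Fin.castLE hr i) (Fin.castLE hr l)).det

variable [CharP k p]

theorem euler_coord (i j a m : Fin n) : euler i j (frobeniusCoord a m : FrobeniusKernel k p n) =
    if j = a then frobeniusCoord i m else 0 := by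
  simp only [euler_apply, frobeniusDeriv_coord, ite_and]
  split_ifs <;> simp

/-- The leading minors are highest weight vectors for `gl(n)`. -/
theorem euler_leadingMinor {i j : Fin n} (hij : i ≤ j) (r : ℕ) (hr : r ≤ n) :
    euler i j (leadingMinor r hr : FrobeniusKernel k p n) =
      if i = j ∧ i.1 < r then leadingMinor r hr else 0 := by
  rw [leadingMinor, Derivation.apply_det]
  have hzero : ∀ c : Fin r, Fin.castLE hr c ≠ j → (Matrix.updateRow
      (Matrix.of fun i l : Fin r =>
        (frobeniusCoord (Fin.castLE hr i) (Fin.castLE hr l) : FrobeniusKernel k p n)) c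
      fun a => euler i j (Matrix.of (fun i l : Fin r =>
        (frobeniusCoord (Fin.castLE hr i) (Fin.castLE hr l) : FrobeniusKernel k p n)) c a)).det =
        0 := by
    intro c hc
    refine Matrix.det_eq_zero_of_row_eq_zero c fun a => ?_
    rw [Matrix.updateRow_self, Matrix.of_apply, euler_coord, if_neg (Ne.symm hc)]
  by_cases hj : j.1 < r
  · have hi : i.1 < r := lt_of_le_of_lt hij hj
    have hj' : Fin.castLE hr ⟨j.1, hj⟩ = j := rfl
    have hi' : Fin.castLE hr ⟨i.1, hi⟩ = i := rfl
    rw [Finset.sum_eq_single (⟨j.1, hj⟩ : Fin r)]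
    · have h1 : (fun a : Fin r => euler i j (Matrix.of (fun i l : Fin r =>
          (frobeniusCoord (Fin.castLE hr i) (Fin.castLE hr l) : FrobeniusKernel k p n))
            ⟨j.1, hj⟩ a)) = Matrix.of (fun i l : Fin r =>
          (frobeniusCoord (Fin.castLE hr i) (Fin.castLE hr l) : FrobeniusKernel k p n))
            ⟨i.1, hi⟩ := by
        funext a
        rw [Matrix.of_apply, euler_coord, if_pos hj'.symm, Matrix.of_apply, hi']
      rw [h1]
      split_ifs with h
      · obtain ⟨rfl, -⟩ := h
        rw [Matrix.updateRow_eq_self]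
      · refine Matrix.det_updateRow_eq_zero fun h' => h ⟨?_, hi⟩
        exact Fin.ext (Fin.mk.inj h')
    · intro c _ hc
      refine hzero c fun h => hc (Fin.ext ?_)
      exact congrArg (fun i : Fin n => i.1) h
    · simp
  · rw [Finset.sum_eq_zero fun c _ => hzero c fun h => hj (h ▸ c.2), if_neg]
    rintro ⟨rfl, h⟩
    exact hj h

variable [Fact p.Prime]

theorem leadingMinor_pow (r : ℕ) (hr : r ≤ n) :
    (leadingMinor r hr : FrobeniusKernel k p n) ^ p = 1 := by
  have : Nontrivial (FrobeniusKernel k p n) :=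
    (frobeniusEval (k := k) (n := n) (Fact.out : p.Prime).ne_zero).toRingHom.domain_nontrivial
  have : CharP (FrobeniusKernel k p n) p :=
    charP_of_injective_algebraMap (algebraMap k _).injective p
  rw [leadingMinor, ← frobenius_def, RingHom.map_det]
  refine Eq.trans (congrArg Matrix.det ?_) Matrix.det_one
  ext i l : 2
  rw [RingHom.mapMatrix_apply, Matrix.map_apply, Matrix.of_apply, frobenius_def,
    frobeniusCoord_pow, Matrix.one_apply]
  simp

/-- The weights of the highest weight vectors in the oscillator representation. -/
def oscillatorWeights (hp : 2 < p) (χ : Module.Dual k ((periplectic k p n).part 0)) :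
    Set (Fin n → k) :=
  {c | ∃ v, v ≠ 0 ∧ (repOfHom (oscillatorHom hp χ)).IsHighestWeight v c}

section Weights

variable (hp : 2 < p) (χ : Module.Dual k ((periplectic k p n).part 0))

/-- Multiplication by a leading minor shifts the weights by a fundamental weight. -/
theorem add_fundamental_mem_oscillatorWeights {c : Fin n → k} (hc : c ∈ oscillatorWeights hp χ)
    (r : ℕ) (hr : r ≤ n) :
    (c + fun a => if a.1 < r then 1 else 0) ∈ oscillatorWeights hp χ := by
  obtain ⟨v, hv0, hv⟩ := hc
  have hE : ∀ a b, a ≤ b → (repOfHom (oscillatorHom hp χ)).E a b (mulOp (leadingMinor r hr) v) =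
      mulOp (leadingMinor r hr) ((repOfHom (oscillatorHom hp χ)).E a b v) +
        mulOp (if a = b ∧ a.1 < r then leadingMinor r hr else 0) v := by
    intro a b hab
    have h := congrArg (fun T => T v) (oscillator_E_mulOp hp χ a b (leadingMinor r hr))
    rwa [euler_leadingMinor hab] at h
  have hmul0 : mulOp (0 : FrobeniusKernel k p n) = 0 := by
    rw [mulOp, LinearMap.mulLeft_zero_eq_zero, map_zero]
  refine ⟨mulOp (leadingMinor r hr) v, fun h => hv0 ?_, fun a b hab => ?_, fun a => ?_, fun B => ?_⟩
  · have h1 : (mulOp (leadingMinor r hr) : Module.End k (OscillatorSpace k p n)) ^ p = 1 := by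
      rw [mulOp, ← map_pow, LinearMap.pow_mulLeft, leadingMinor_pow, LinearMap.mulLeft_one]
      exact map_one evenVarOp
    rw [← Module.End.one_apply (R := k) v, ← h1, ← pow_sub_one_mul (Fact.out : p.Prime).ne_zero,
      Module.End.mul_apply, h, map_zero]
  · rw [hE a b hab.le, hv.raise a b hab, map_zero, if_neg (by simp [hab.ne]), hmul0, zero_add,
      LinearMap.zero_apply]
  · rw [hE a a le_rfl, hv.weight, map_smul, Pi.add_apply, add_smul]
    congr 1
    by_cases h : a.1 < r
    · rw [if_pos ⟨rfl, h⟩, if_pos h, one_smul]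
    · rw [if_neg (by simp [h]), if_neg h, hmul0, zero_smul, LinearMap.zero_apply]
  · have h := congrArg (fun T => T v) (oscillator_sym_mulOp hp χ B (leadingMinor r hr))
    refine h.trans ?_
    rw [Module.End.mul_apply, hv.sym, map_zero]

theorem add_nsmul_mem_oscillatorWeights {w : Fin n → k}
    (hw : ∀ c ∈ oscillatorWeights hp χ, c + w ∈ oscillatorWeights hp χ) (m : ℕ)
    {c : Fin n → k} (hc : c ∈ oscillatorWeights hp χ) : c + m • w ∈ oscillatorWeights hp χ := by
  induction m with
  | zero => simpa using hc
  | succ m ih =>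
    rw [succ_nsmul, ← add_assoc]
    exact hw _ ih

theorem add_single_mem_oscillatorWeights {c : Fin n → k} (hc : c ∈ oscillatorWeights hp χ)
    (a : Fin n) : c + Pi.single a 1 ∈ oscillatorWeights hp χ := by
  have h := add_fundamental_mem_oscillatorWeights hp χ
    (add_nsmul_mem_oscillatorWeights hp χ
      (fun c hc => add_fundamental_mem_oscillatorWeights hp χ hc a.1 a.2.le) (p - 1) hc)
    (a.1 + 1) a.2
  convert h using 1
  -- In characteristic `p`, the difference of two fundamental weights is a sum of fundamental weights.
  rw [add_assoc]
  congr 1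
  funext b
  have hp1 : ((p - 1 : ℕ) : k) = -1 := by
    rw [Nat.cast_sub (by omega), CharP.cast_eq_zero, Nat.cast_one, zero_sub]
  rw [Pi.add_apply, Pi.smul_apply, nsmul_eq_mul, hp1]
  rcases lt_trichotomy b a with h | h | h
  · rw [Pi.single_eq_of_ne h.ne, if_pos (Fin.lt_def.1 h), if_pos (Nat.lt_succ_of_lt h)]
    ring
  · subst h
    simp
  · rw [Pi.single_eq_of_ne h.ne', if_neg (Fin.lt_def.1 h).not_gt, if_neg (not_lt.2 h)]
    ring

theorem mem_oscillatorWeights_of_natCast {c d : Fin n → k} (hc : c ∈ oscillatorWeights hp χ)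
    (h : ∀ a, ∃ m : ℕ, d a = c a + m) : d ∈ oscillatorWeights hp χ := by
  choose m hm using h
  have key : ∀ s : Finset (Fin n), c + ∑ a ∈ s, m a • Pi.single a (1 : k) ∈
      oscillatorWeights hp χ := by
    intro s
    induction s using Finset.induction_on with
    | empty => simpa using hc
    | insert a s ha ih =>
      rw [Finset.sum_insert ha, add_comm (m a • _), ← add_assoc]
      exact add_nsmul_mem_oscillatorWeights hp χ
        (fun c hc => add_single_mem_oscillatorWeights hp χ hc a) (m a) ih
  convert key Finset.univ
  funext b
  rw [hm, Pi.add_apply, Finset.sum_apply, Finset.sum_eq_single b]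
  · simp
  · intro a _ hab
    rw [Pi.smul_apply, Pi.single_eq_of_ne hab.symm, smul_zero]
  · simp

end Weights

/-- A solution of `x^p = x` is the image of a natural number. -/
theorem exists_natCast_of_pow_eq_self {x : k} (hx : x ^ p = x) : ∃ m : ℕ, x = m := by
  obtain ⟨m, rfl⟩ := (mem_bot_iff_intCast p k).1
    ((Subfield.mem_bot_iff_pow_eq_self k p).2 hx)
  refine ⟨((m : ZMod p)).val, ?_⟩
  have h := congrArg (ZMod.castHom (dvd_refl p) k) (ZMod.natCast_zmod_val (m : ZMod p))
  rw [map_natCast, map_intCast] at h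
  exact h.symm

theorem weightOfCoords_cartanBasisElt (c : Fin n → k) (a : Fin n) :
    weightOfCoords k p c (cartanBasisElt a) = c a := by
  refine (Finset.sum_eq_single a (fun b _ hb => ?_) fun h => absurd (Finset.mem_univ a) h).trans ?_
  · simp [cartanBasisElt, evenMat, hb.symm]
  · simp [cartanBasisElt, evenMat]

theorem eq_sum_cartanBasisElt (H : (cartanSub k p n).part 0) :
    H = ∑ a, H.1 (Sum.inl a) (Sum.inl a) • cartanBasisElt a := by
  refine cartanSub_ext p fun i => ?_
  rw [AddSubmonoidClass.coe_finsetSum, Matrix.sum_apply, Finset.sum_eq_single i]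
  · simp [cartanBasisElt, evenMat]
  · intro b _ hb
    simp [cartanBasisElt, evenMat, hb]
  · simp

/-- All generalized baby Verma modules are nonzero. -/
theorem nontrivial_babyVerma [IsAlgClosed k] (hp : 2 < p)
    (χ : Module.Dual k ((periplectic k p n).part 0)) (hχ : ∀ x ∈ nPlus k p n, χ x = 0)
    (μ : Module.Dual k ((cartanSub k p n).part 0)) (hμ : μ ∈ weights p χ) :
    Nontrivial (BabyVerma p χ hχ μ hμ) := by
  have hodd : Odd p := (Fact.out : p.Prime).odd_of_ne_two hp.ne'
  have h2 : (2 : k) ≠ 0 := by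
    have := (CharP.cast_eq_zero_iff k p 2).not.2 (Nat.not_dvd_of_pos_of_lt two_pos hp)
    simpa using this
  have := nontrivial_oscillatorSpace k p n (Fact.out : p.Prime).ne_zero
  set φ := oscillatorHom hp χ with hφ
  obtain ⟨v, hv0, c, hv⟩ := (repOfHom φ).exists_isHighestWeight h2 (by omega : 1 < p)
    (fun a b hab => repOfHom_E_pow φ hodd (by omega) hab.ne
      (hχ _ (Submodule.subset_span ⟨a, b, hab, rfl⟩)))
    (fun a => repOfHom_E_pow_sub φ hodd a)
  have hc : ∀ a, c a ^ p - c a = χ (cartanElt k p a) ^ p := by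
    intro a
    rw [← weightOfCoords_cartanBasisElt (p := p) c a]
    exact pow_sub_weight_cartanBasisElt χ hp _ (weightOfCoords_mem_weights φ h2 hv0 hv) a
  obtain ⟨v, hv0, hv⟩ := mem_oscillatorWeights_of_natCast hp χ (d := fun a => μ (cartanBasisElt a))
    ⟨v, hv0, hv⟩ (by
      intro a
      have h : (μ (cartanBasisElt a) - c a) ^ p = μ (cartanBasisElt a) - c a := by
        rw [sub_pow_char]
        linear_combination pow_sub_weight_cartanBasisElt χ hp μ hμ a - hc a
      obtain ⟨m, hm⟩ := exists_natCast_of_pow_eq_self h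
      exact ⟨m, by rw [← hm]; ring⟩)
  have hμ' : weightOfCoords k p (fun a => μ (cartanBasisElt a)) = μ := by
    refine LinearMap.ext fun H => ?_
    conv_rhs => rw [eq_sum_cartanBasisElt H]
    rw [map_sum]
    change ∑ a, μ (cartanBasisElt a) * H.1 (Sum.inl a) (Sum.inl a) = _
    exact Finset.sum_congr rfl fun a _ =>
      (mul_comm _ _).trans (map_smul μ (H.1 (Sum.inl a) (Sum.inl a)) (cartanBasisElt a)).symm
  let : Module (RedEnv (periplectic k p n) χ) (OscillatorSpace k p n) :=
    Module.compHom _ φ.toRingHom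
  have : IsScalarTower k (RedEnv (periplectic k p n) χ) (OscillatorSpace k p n) :=
    ⟨fun a w x => by
      change φ (a • w) x = a • φ w x
      rw [map_smul, LinearMap.smul_apply]⟩
  obtain ⟨f, hf⟩ := exists_verma_hom χ hχ μ hμ v (by
    intro i x
    have := repOfHom_borel_apply φ h2 hv i x
    rw [hμ'] at this
    exact this)
  refine ⟨vermaMk χ hχ μ hμ 1, 0, fun h => hv0 ?_⟩
  rw [← one_smul (RedEnv (periplectic k p n) χ) v, ← hf, h, map_zero]

end Periplectic
end

theorem mainTheorem3 (k : Type u) [Field k] [IsAlgClosed k] (p : ℕ) [Fact p.Prime] [CharP k p]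
    (hp : 2 < p) (n : ℕ) (hn : 0 < n)
    (χ : Module.Dual k ((Periplectic.periplectic k p n).part 0))
    (hχ : ∀ x ∈ Periplectic.nPlus k p n, χ x = 0) :
    (∀ (M : Type v) [AddCommGroup M] [Module k M]
        [Module (RestrictedSubalgebra.RedEnv (Periplectic.periplectic k p n) χ) M]
        [IsScalarTower k (RestrictedSubalgebra.RedEnv (Periplectic.periplectic k p n) χ) M]
        (ℳ : ZMod 2 → Submodule k M),
      RestrictedSubalgebra.IsIrreducible (Periplectic.periplectic k p n) χ ℳ →
      ∃ (μ : Module.Dual k ((Periplectic.cartanSub k p n).part 0))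
        (hμ : μ ∈ Periplectic.weights p χ)
        (f : Periplectic.BabyVerma p χ hχ μ hμ
          →ₗ[RestrictedSubalgebra.RedEnv (Periplectic.periplectic k p n) χ] M) (d : ZMod 2),
        Function.Surjective f ∧
        ∀ (i : ZMod 2), ∀ z ∈ Periplectic.babyVermaPart p χ hχ μ hμ i, f z ∈ ℳ (i + d)) ∧
    (Periplectic.IsRegularSemisimple p χ →
      ∀ (μ : Module.Dual k ((Periplectic.cartanSub k p n).part 0))
        (hμ : μ ∈ Periplectic.weights p χ),
        RestrictedSubalgebra.IsIrreducible (Periplectic.periplectic k p n) χ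
          (Periplectic.babyVermaPart p χ hχ μ hμ)) := by
  refine ⟨fun M _ _ _ _ ℳ hM => Periplectic.irreducible_is_quotient hp χ hχ M ℳ hM,
    fun hreg μ hμ => ?_⟩
  have h2 : (2 : k) ≠ 0 := by
    have := (CharP.cast_eq_zero_iff k p 2).not.2 (Nat.not_dvd_of_pos_of_lt two_pos hp)
    simpa using this
  exact
    { toIsSupermodule := Periplectic.babyVerma_isSupermodule χ hχ μ hμ h2
      nontrivial := Periplectic.nontrivial_babyVerma hp χ hχ μ hμ
      eq_bot_or_eq_top := fun W _ =>
        or_iff_not_imp_left.2 (Periplectic.babyVerma_eq_top χ hχ μ hμ hp hreg W) }
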